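/- A straight-line drawing $\Gamma$ of a graph maps the vertices to distinct points of the plane and the edges to the segments between them; it is monotone if every two vertices are joined by a path for which there is a line such that the projections of the vertices of the path onto the line appear in the same order as on the path. Let $T$ be a tree rooted at $r$, with edges directed away from $r$, and let $T_u$ be the subtree rooted at $u$. The slope of an edge $(u,v)$ is the counterclockwise angle from the direction of the positive $x$-axis to the direction from $u$ to $v$. A drawing of $T$ is non-strictly slope-disjoint if for every vertex $u$ there are angles $0\le a_1(u)<a_2(u)\le\pi$ such that (1) every edge $e$ that is in $T_u$ or enters $u$ from its parent satisfies $a_1(u)<\mathrm{slope}(e)<a_2(u)$; (2) if $v$ is a child of $u$, then $a_1(u)\le a_1(v)<a_2(v)\le a_2(u)$; (3) if $u_1\ne u_2$ have the same parent, then $a_2(u_1)\le a_1(u_2)$ or $a_2(u_2)\le a_1(u_1)$. The tree is ordered if the cyclic order of the edges incident to each vertex is fixed. A drawing of an ordered rooted tree is near-convex monotone if it is monotone, the edges around each vertex appear counterclockwise in the given cyclic order, and any two consecutive edges incident to a vertex, with the possible exception of a single pair of consecutive edges incident to $r$, form an angle $\theta$ with $0<\theta\le\pi$. Theorem. There is an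 algorithm that, given an $n$-vertex ordered tree $T$ (as adjacency lists) and a root $r$ of $T$, produces in $O(n)$ time (on a unit-cost RAM with words of $O(\log n)$ bits) a monotone drawing of $T$ such that: (i) $r$ is drawn at $(0,0)$; (ii) the drawing is non-strictly slope-disjoint; (iii) the drawing is near-convex monotone; (iv) the drawing is contained in the second octant $\{(x,y): 0\le x\le y\}$, which is bounded by the half-lines from the origin with slopes $\pi/4$ and $\pi/2$; (v) the drawing fits in a $2n\times 2n$ grid, i.e. all vertices are at integer points $(x,y)$ with $0\le x,y\le 2n-1$. -/

import Mathlib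

namespace TreeDrawing

/-! ## A unit-cost word RAM

Programs act on registers and on a random-access memory, both holding natural numbers.
Each elementary instruction and each evaluated test costs one step, and no instruction may
produce a number `≥ W`, where `W` is the word bound. -/

/-- Arithmetic operations on words (`sub` is truncated at `0`, `div` rounds down). -/
inductive Op where
  | add | sub | mul | div

/-- Value of an arithmetic operation. -/
def Op.eval : Op → ℕ → ℕ → ℕ
  | .add, a, b => a + b
  | .sub, a, b => a - b
  | .mul, a, b => a * b
  | .div, a, b => a / b

/-- Programs. Registers are named by natural numbers; a program mentions finitely many. -/
inductive Program where
  /-- do nothing -/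
  | skip : Program
  /-- `R[d] := c` -/
  | const (d c : ℕ) : Program
  /-- `R[d] := R[a] o R[b]` -/
  | arith (o : Op) (d a b : ℕ) : Program
  /-- `R[d] := M[R[a]]` -/
  | load (d a : ℕ) : Program
  /-- `M[R[a]] := R[b]` -/
  | store (a b : ℕ) : Program
  /-- `p; q` -/
  | seq (p q : Program) : Program
  /-- `if R[a] < R[b] then p else q` -/
  | ifLt (a b : ℕ) (p q : Program) : Program
  /-- `while R[a] < R[b] do p` -/
  | whileLt (a b : ℕ) (p : Program) : Program

/-- A configuration: the contents of the registers and of the memory. -/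
structure Config where
  reg : ℕ → ℕ
  mem : ℕ → ℕ

/-- Overwrite register `d`. -/
def Config.setReg (s : Config) (d x : ℕ) : Config :=
  { s with reg := Function.update s.reg d x }

/-- Overwrite memory cell `a`. -/
def Config.setMem (s : Config) (a x : ℕ) : Config :=
  { s with mem := Function.update s.mem a x }

/-- `Runs W p s t s'`: with word bound `W`, program `p` started in configuration `s` halts
after exactly `t` steps in configuration `s'`, without ever producing a number `≥ W`. -/
inductive Runs (W : ℕ) : Program → Config → ℕ → Config → Prop
  | skip (s : Config) : Runs W .skip s 1 s
  | const (s : Config) (d c : ℕ) (h : c < W) : Runs W (.const d c) s 1 (s.setReg d c)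
  | arith (s : Config) (o : Op) (d a b : ℕ) (h : o.eval (s.reg a) (s.reg b) < W) :
      Runs W (.arith o d a b) s 1 (s.setReg d (o.eval (s.reg a) (s.reg b)))
  | load (s : Config) (d a : ℕ) (h : s.mem (s.reg a) < W) :
      Runs W (.load d a) s 1 (s.setReg d (s.mem (s.reg a)))
  | store (s : Config) (a b : ℕ) (h : s.reg b < W) :
      Runs W (.store a b) s 1 (s.setMem (s.reg a) (s.reg b))
  | seq {p q : Program} {s₁ s₂ s₃ : Config} {t₁ t₂ : ℕ}
      (h₁ : Runs W p s₁ t₁ s₂) (h₂ : Runs W q s₂ t₂ s₃) :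
      Runs W (.seq p q) s₁ (t₁ + t₂) s₃
  | ifTrue {a b : ℕ} {p q : Program} {s s' : Config} {t : ℕ}
      (h : s.reg a < s.reg b) (hp : Runs W p s t s') :
      Runs W (.ifLt a b p q) s (t + 1) s'
  | ifFalse {a b : ℕ} {p q : Program} {s s' : Config} {t : ℕ}
      (h : ¬ s.reg a < s.reg b) (hq : Runs W q s t s') :
      Runs W (.ifLt a b p q) s (t + 1) s'
  | whileTrue {a b : ℕ} {p : Program} {s s' s'' : Config} {t t' : ℕ}
      (h : s.reg a < s.reg b) (hp : Runs W p s t s')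
      (hw : Runs W (.whileLt a b p) s' t' s'') :
      Runs W (.whileLt a b p) s (t + t' + 1) s''
  | whileFalse {a b : ℕ} {p : Program} {s : Config} (h : ¬ s.reg a < s.reg b) :
      Runs W (.whileLt a b p) s 1 s

/-! ## Ordered trees and their encoding -/

section Graph

variable {V : Type*}

/-- `ord v` lists every neighbour of `v` exactly once. Read cyclically, it fixes the order of
the edges incident to `v`. -/
def IsEdgeOrder (G : SimpleGraph V) (ord : V → List V) : Prop :=
  ∀ v, (ord v).Nodup ∧ ∀ w, w ∈ ord v ↔ G.Adj v w

/-- `v` is a child of `u` in the tree `G` rooted at `r`. -/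
def IsChild (G : SimpleGraph V) (r u v : V) : Prop :=
  G.Adj u v ∧ G.dist r v = G.dist r u + 1

/-- `v` is a vertex of the subtree rooted at `u`, in the tree `G` rooted at `r`. -/
def InSubtree (G : SimpleGraph V) (r u v : V) : Prop :=
  Relation.ReflTransGen (IsChild G r) u v

/-! ## Drawings

The plane is `ℂ`, the point `(x, y)` being `x + y i`. A straight-line drawing is given by the
positions of the vertices. -/

/-- Distinct vertices have distinct positions. -/
def IsStraightLineDrawing (Γ : V → ℂ) : Prop :=
  Function.Injective Γ

/-- The path `p` is drawn monotonically: there is a line, with direction vector `d`, on which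
the projections of the vertices appear in the same order as on `p`. -/
def IsMonotonePath {G : SimpleGraph V} (Γ : V → ℂ) {u v : V} (p : G.Walk u v) : Prop :=
  ∃ d : ℂ, d ≠ 0 ∧ (p.support.map fun w => inner ℝ d (Γ w)).Pairwise (· < ·)

/-- Monotone straight-line drawings of a graph. -/
def IsMonotoneDrawing (G : SimpleGraph V) (Γ : V → ℂ) : Prop :=
  IsStraightLineDrawing Γ ∧
    ∀ u v : V, ∃ p : G.Walk u v, p.IsPath ∧ IsMonotonePath Γ p

/-- The slope, in `[0, 2π)`, of the edge directed from `u` to `v`. -/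
noncomputable def slope (Γ : V → ℂ) (u v : V) : ℝ :=
  toIcoMod Real.two_pi_pos 0 (Γ v - Γ u).arg

/-- The angle in `[0, 2π)` of the counterclockwise rotation around `v` that takes the
direction of the edge `vw` to that of the edge `vw'`. -/
noncomputable def ccwAngle (Γ : V → ℂ) (v w w' : V) : ℝ :=
  toIcoMod Real.two_pi_pos 0 ((Γ w' - Γ v).arg - (Γ w - Γ v).arg)

/-- Non-strictly slope-disjoint drawings of the tree `G` rooted at `r`, with edges directed
away from the root. -/
def IsNonStrictlySlopeDisjoint (G : SimpleGraph V) (r : V) (Γ : V → ℂ) : Prop :=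
  ∃ a₁ a₂ : V → ℝ,
    (∀ u, 0 ≤ a₁ u ∧ a₁ u < a₂ u ∧ a₂ u ≤ Real.pi ∧
      (∀ w z, InSubtree G r u w → IsChild G r w z → slope Γ w z ∈ Set.Ioo (a₁ u) (a₂ u)) ∧
      (∀ p, IsChild G r p u → slope Γ p u ∈ Set.Ioo (a₁ u) (a₂ u))) ∧
    (∀ u v, IsChild G r u v → a₁ u ≤ a₁ v ∧ a₁ v < a₂ v ∧ a₂ v ≤ a₂ u) ∧
    (∀ p u₁ u₂, IsChild G r p u₁ → IsChild G r p u₂ → u₁ ≠ u₂ →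
      (a₁ u₁ < a₂ u₁ ∧ a₂ u₁ ≤ a₁ u₂ ∧ a₁ u₂ < a₂ u₂) ∨
      (a₁ u₂ < a₂ u₂ ∧ a₂ u₂ ≤ a₁ u₁ ∧ a₁ u₁ < a₂ u₁))

/-- The drawing respects the order of the edges: around each vertex `v`, the edges appear
counterclockwise in the cyclic order given by `ord v`. -/
def RespectsOrder (ord : V → List V) (Γ : V → ℂ) : Prop :=
  ∀ v w₀ l, ord v = w₀ :: l →
    (w₀ :: l).Pairwise fun w w' => ccwAngle Γ v w₀ w < ccwAngle Γ v w₀ w'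

/-- `w'` follows `w` in the cyclic order given by the list `l`, which has at least two
elements. -/
def CyclicSucc (l : List V) (w w' : V) : Prop :=
  2 ≤ l.length ∧ (w, w') ∈ l.zip (l.rotate 1)

/-- Near-convex monotone drawings of an ordered tree rooted at `r`: all pairs of consecutive
edges at a vertex, except possibly one pair at `r`, form an angle in `(0, π]`. -/
def IsNearConvexMonotone (G : SimpleGraph V) (r : V) (ord : V → List V) (Γ : V → ℂ) : Prop :=
  IsMonotoneDrawing G Γ ∧ RespectsOrder ord Γ ∧
    ∃ e : V × V, ∀ v w w', CyclicSucc (ord v) w w' →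
      (v = r ∧ (w, w') = e) ∨ ccwAngle Γ v w w' ∈ Set.Ioc 0 Real.pi

/-- The set of points of the plane covered by the drawing. -/
def drawnSet (G : SimpleGraph V) (Γ : V → ℂ) : Set ℂ :=
  Set.range Γ ∪ ⋃ (u : V) (v : V) (_ : G.Adj u v), segment ℝ (Γ u) (Γ v)

end Graph

/-- The closed second octant. -/
def secondOctant : Set ℂ := {z | 0 ≤ z.re ∧ z.re ≤ z.im}

/-- All vertices lie on the points `(x, y)` of the integer grid with `0 ≤ x, y < N`, which
has `N` columns and `N` rows. -/
def FitsInGrid {V : Type*} (Γ : V → ℂ) (N : ℕ) : Prop :=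
  ∀ v, ∃ x y : ℕ, x < N ∧ y < N ∧ Γ v = ⟨x, y⟩

/-! ## Input and output -/

/-- Address at which the adjacency list of vertex `i` starts. -/
def listAddr {n : ℕ} (ord : Fin n → List (Fin n)) (i : ℕ) : ℕ :=
  n + 1 + (((List.finRange n).take i).map fun v => (ord v).length).sum

/-- Adjacency arrays: the addresses at which the lists of the vertices `0, …, n - 1` start and
the address at which the last list ends (`n + 1` words), followed by the lists. -/
def inputWords {n : ℕ} (ord : Fin n → List (Fin n)) : List ℕ :=
  ((List.range (n + 1)).map (listAddr ord)) ++
    ((List.finRange n).flatMap fun v => (ord v).map fun w => (w : ℕ))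

/-- Initial configuration: `n` and `r` are in registers `0` and `1`, the adjacency arrays
are at the beginning of the memory, everything else is `0`. -/
def inputConfig {n : ℕ} (r : Fin n) (ord : Fin n → List (Fin n)) : Config where
  reg := fun i => if i = 0 then n else if i = 1 then (r : ℕ) else 0
  mem := fun i => (inputWords ord).getD i 0

/-- The drawing computed by a halted machine: registers `0` and `1` contain the addresses of
the arrays of the x-coordinates and of the y-coordinates of the vertices. -/
def outputDrawing (n : ℕ) (s : Config) : Fin n → ℂ :=
  fun v => ⟨(s.mem (s.reg 0 + v) : ℝ), (s.mem (s.reg 1 + v) : ℝ)⟩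

end TreeDrawing

set_option linter.unusedSimpArgs false
set_option linter.unnecessarySeqFocus false

/-! Write every edge direction, away from the root, as a positive multiple of `(1 - t, 1)`. As `t`
grows from 0 to 1 the slope grows from π/4 to π/2, so a drawing amounts to a choice of parameters
and lengths. With `N = n³ + 1`, each vertex owns an interval `[lo, hi)` of integers inside `[0, N)`.
The root owns all of it, and the interval of a vertex is cut among its children, in their
counterclockwise order after the parent, in proportion to the subtree sizes. The edge entering a
vertex is an integer vector `(k - j, k)` with `j / k` in `[lo / N, hi / N)`.

Intervals are nested along the tree and disjoint between siblings. This gives slope-disjointness. It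
also gives monotonicity: two branches below a common ancestor have directions separated by a single
one, and its normal increases up one branch and down the other
(`IsConeDrawing.exists_increasing_walk`). For near-convexity a child inherits the vector of its
parent whenever the parameter of that vector lies in the child's interval. Hence the first child
never has a larger parameter than its parent, and the last never a smaller one.

The grid bound is a potential argument. An interval of width `w` admits an edge of height `k < N / w
+ 1`. For a vertex at height `y` with `sz` vertices in its subtree, the quantity `y + 2N(sz - 1) /
(w - sz²)` never increases from parent to child (`Placement.Good.step`); the term `sz²` pays for the
rounding of the endpoints. At the root it is below `2n` because `N > n³`.

The program finds a breadth-first order, accumulates subtree sizes in reverse order and places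
vertices in order. It scans each adjacency list a bounded number of times, and the lists have total
length `2n - 2`. Intermediate numbers are `O(n⁶)`. Correctness and running time are proved together
with the timed calculus `WP`. -/

namespace TreeDrawing

/-! ### Rooted ordered trees: parents, order of the children, subtree sizes. -/

/-- The neighbour lists `ord` are those of a tree with root `r` and parent function `par`. -/
structure IsRooting {n : ℕ} (r : Fin n) (ord : Fin n → List (Fin n)) (par : Fin n → Fin n)
    (depth : Fin n → ℕ) : Prop where
  par_root : par r = r
  depth_par : ∀ v, v ≠ r → depth v = depth (par v) + 1
  nodup_ord : ∀ u, (ord u).Nodup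
  mem_ord : ∀ u w, w ∈ ord u ↔ (w ≠ r ∧ par w = u) ∨ (u ≠ r ∧ w = par u)
  sum_length : ∑ u, (ord u).length + 2 = 2 * n

theorem exists_isChild {V : Type*} {G : SimpleGraph V} (hG : G.IsTree) {r v : V} (hv : v ≠ r) :
    ∃ u, IsChild G r u v := by
  obtain ⟨p, hp, hl⟩ := hG.connected.exists_path_of_dist r v
  have hnil : ¬ p.Nil := SimpleGraph.Walk.not_nil_of_ne hv.symm
  have hadj := p.adj_penultimate hnil
  refine ⟨p.penultimate, hadj, ?_⟩
  rcases hG.dist_eq_dist_add_one_of_adj r hadj with h | h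
  · have h1 := SimpleGraph.dist_le p.dropLast
    have h2 : p.dropLast.length + 1 = p.length :=
      SimpleGraph.Walk.length_dropLast_add_one hnil
    omega
  · exact h

/-- A shortest path to a parent of `v`, extended by the edge to `v`, is a path from the root. A tree
has only one such path, so the parent is its penultimate vertex. -/
theorem IsChild.unique {V : Type*} {G : SimpleGraph V} (hG : G.IsTree) {r u u' v : V}
    (h : IsChild G r u v) (h' : IsChild G r u' v) : u = u' := by
  obtain ⟨p, hp, hl⟩ := hG.connected.exists_path_of_dist r v
  have key : ∀ x, IsChild G r x v → x = p.penultimate := by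
    intro x hx
    by_contra hne
    obtain ⟨q, hq, hql⟩ := hG.connected.exists_path_of_dist r x
    have hnot : v ∉ q.support := by
      classical
      intro hmem
      have h1 := SimpleGraph.dist_le (q.takeUntil v hmem)
      have h2 := q.length_takeUntil_le_length hmem
      have := hx.2
      omega
    have hc : (q.concat hx.1).IsPath := hq.concat hnot hx.1
    have := (hG.isAcyclic.subsingleton_path r v).elim ⟨_, hc⟩ ⟨p, hp⟩
    have h3 : q.concat hx.1 = p := congrArg Subtype.val this
    apply hne
    rw [← h3, SimpleGraph.Walk.penultimate_concat]
  rw [key u h, key u' h']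

theorem exists_isRooting {n : ℕ} {G : SimpleGraph (Fin n)} (hG : G.IsTree) (r : Fin n)
    {ord : Fin n → List (Fin n)} (hord : IsEdgeOrder G ord) :
    ∃ par : Fin n → Fin n, IsRooting r ord par (G.dist r) ∧
      ∀ u v, IsChild G r u v ↔ v ≠ r ∧ par v = u := by
  classical
  let par : Fin n → Fin n := fun v => if h : v = r then r else (exists_isChild hG h).choose
  have hpar : ∀ v, v ≠ r → IsChild G r (par v) v := by
    intro v hv
    simp only [par, dif_neg hv]
    exact (exists_isChild hG hv).choose_spec
  have hiff : ∀ u v, IsChild G r u v ↔ v ≠ r ∧ par v = u := by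
    intro u v
    constructor
    · intro h
      have hv : v ≠ r := by
        rintro rfl
        have := h.2
        simp at this
      exact ⟨hv, (hpar v hv).unique hG h⟩
    · rintro ⟨hv, rfl⟩
      exact hpar v hv
  refine ⟨par, ⟨by simp [par], fun v hv => (hpar v hv).2, fun u => (hord u).1, ?_, ?_⟩, hiff⟩
  · intro u w
    rw [(hord u).2, ← hiff]
    constructor
    · intro h
      rcases hG.dist_eq_dist_add_one_of_adj r h with h' | h'
      · right
        have := (hiff w u).1 ⟨h.symm, h'⟩
        exact ⟨this.1, this.2.symm⟩
      · exact Or.inl ⟨h, h'⟩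
    · rintro (h | ⟨h, rfl⟩)
      · exact h.1
      · exact (hpar u h).1.symm
  -- Handshake count with `n - 1` edges. This total makes scanning all lists linear and keeps the
  -- input below address `3 * n`.
  · have h1 : ∀ u, (ord u).length = G.degree u := by
      intro u
      rw [← SimpleGraph.card_neighborFinset_eq_degree, ← List.toFinset_card_of_nodup (hord u).1]
      congr 1
      ext w
      simp [(hord u).2]
    have h2 := G.sum_degrees_eq_twice_card_edges
    have h3 := hG.card_edgeFinset
    simp only [h1, h2]
    rw [Fintype.card_fin] at h3
    omega

/-- The children of `u`, in counterclockwise order after the parent of `u`. -/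
def childList {n : ℕ} (ord : Fin n → List (Fin n)) (par : Fin n → Fin n) (u : Fin n) :
    List (Fin n) :=
  (ord u).drop ((ord u).idxOf (par u) + 1) ++ (ord u).take ((ord u).idxOf (par u))

namespace IsRooting

variable {n : ℕ} {r : Fin n} {ord : Fin n → List (Fin n)} {par : Fin n → Fin n}
  {depth : Fin n → ℕ}

theorem par_notMem_root (h : IsRooting r ord par depth) : par r ∉ ord r := by
  rw [h.par_root, h.mem_ord]
  simp

/-- The root is its own parent and is not in its own list, so `idxOf` returns the length: the
dropped part is empty and the taken part is everything. The cyclic order at the root is thus cut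
where the list begins. -/
theorem childList_root (h : IsRooting r ord par depth) : childList ord par r = ord r := by
  have := List.idxOf_eq_length h.par_notMem_root
  simp [childList, this]

theorem exists_ord_eq (h : IsRooting r ord par depth) {u : Fin n} (hu : u ≠ r) :
    ∃ A B, ord u = A ++ par u :: B ∧ childList ord par u = B ++ A := by
  have hm : par u ∈ ord u := (h.mem_ord u _).2 (Or.inr ⟨hu, rfl⟩)
  have hlt := List.idxOf_lt_length_of_mem hm
  refine ⟨(ord u).take ((ord u).idxOf (par u)), (ord u).drop ((ord u).idxOf (par u) + 1), ?_, rfl⟩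
  conv_lhs => rw [← List.take_append_drop ((ord u).idxOf (par u)) (ord u)]
  rw [List.drop_eq_getElem_cons hlt, List.getElem_idxOf]

theorem isRotated_ord (h : IsRooting r ord par depth) {v : Fin n} (hv : v ≠ r) :
    (par v :: childList ord par v) ~r ord v := by
  obtain ⟨A, B, hA, hB⟩ := h.exists_ord_eq hv
  rw [hA, hB, ← List.cons_append]
  exact List.isRotated_append

theorem mem_childList (h : IsRooting r ord par depth) {u w : Fin n} :
    w ∈ childList ord par u ↔ w ≠ r ∧ par w = u := by
  by_cases hu : u = r
  · subst hu
    rw [h.childList_root, h.mem_ord]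
    simp
  · obtain ⟨A, B, hA, hB⟩ := h.exists_ord_eq hu
    have hnd := h.nodup_ord u
    have hmem := h.mem_ord u w
    rw [hA] at hnd hmem
    rw [hB]
    have hp : par u ∉ A ∧ par u ∉ B := by
      rw [List.nodup_append] at hnd
      simp only [List.nodup_cons] at hnd
      exact ⟨fun hh => hnd.2.2 _ hh _ (by simp) rfl, hnd.2.1.1⟩
    have hne : w ≠ r → par w = u → w ≠ par u := by
      rintro hw rfl he
      have h1 := h.depth_par _ hw
      have h2 := h.depth_par _ hu
      rw [← he] at h2
      omega
    simp only [List.mem_append, List.mem_cons] at hmem ⊢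
    constructor
    · intro hw
      rcases hmem.1 (by tauto) with h1 | h1
      · exact h1
      · exfalso
        rcases h1 with ⟨_, rfl⟩
        tauto
    · intro hw
      have h1 := hmem.2 (Or.inl hw)
      have h2 := hne hw.1 hw.2
      tauto

theorem nodup_childList (h : IsRooting r ord par depth) (u : Fin n) :
    (childList ord par u).Nodup := by
  by_cases hu : u = r
  · subst hu
    rw [h.childList_root]
    exact h.nodup_ord _
  · obtain ⟨A, B, hA, hB⟩ := h.exists_ord_eq hu
    have hnd := h.nodup_ord u
    rw [hA] at hnd
    rw [hB]
    have := (List.perm_append_comm (l₁ := A) (l₂ := par u :: B)).nodup_iff.1 hnd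
    simp only [List.cons_append, List.nodup_cons] at this
    exact this.2

theorem sum_childList (h : IsRooting r ord par depth) (f : Fin n → ℕ) (u : Fin n) :
    ((childList ord par u).map f).sum = ∑ w with w ≠ r ∧ par w = u, f w := by
  rw [← List.sum_toFinset _ (h.nodup_childList u)]
  apply Finset.sum_congr _ fun _ _ => rfl
  ext w
  simp [h.mem_childList]

theorem mem_ord_of_mem_childList (h : IsRooting r ord par depth) {u w : Fin n} :
    w ∈ ord u ∧ w ≠ par u ↔ w ∈ childList ord par u := by
  rw [h.mem_childList, h.mem_ord]
  constructor
  · rintro ⟨h1 | h1, h2⟩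
    · exact h1
    · exact absurd h1.2 h2
  · intro h1
    refine ⟨Or.inl h1, ?_⟩
    rintro rfl
    by_cases hu : u = r
    · subst hu
      exact h1.1 h.par_root
    · have h3 := h.depth_par _ h1.1
      have h2 := h.depth_par _ hu
      rw [h1.2] at h3
      omega

theorem size_le (h : IsRooting r ord par depth) {size : Fin n → ℕ}
    (hsize : ∀ u, size u = 1 + ((childList ord par u).map size).sum) (hroot : size r = n)
    (v : Fin n) : size v ≤ n := by
  induction hd : depth v generalizing v with
  | zero =>
    by_cases hv : v = r
    · rw [hv, hroot]
    · have := h.depth_par v hv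
      omega
  | succ d ih =>
    by_cases hv : v = r
    · rw [hv, hroot]
    · have h1 := ih (par v) (by have := h.depth_par v hv; omega)
      have h2 := List.single_le_sum (fun x _ => Nat.zero_le x) (size v)
        (List.mem_map_of_mem (f := size) (h.mem_childList.2 ⟨hv, rfl⟩))
      have h3 := hsize (par v)
      omega

theorem induction (h : IsRooting r ord par depth) {P : Fin n → Prop} (root : P r)
    (step : ∀ v, v ≠ r → P (par v) → P v) (v : Fin n) : P v := by
  induction hd : depth v generalizing v with
  | zero =>
    by_cases hv : v = r
    · exact hv ▸ root
    · have := h.depth_par v hv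
      omega
  | succ d ih =>
    by_cases hv : v = r
    · exact hv ▸ root
    · exact step v hv (ih _ (by have := h.depth_par v hv; omega))

end IsRooting

/-- Sizes of the subtrees, for a recursion that may descend `k` levels. -/
def sizeAux {n : ℕ} (ord : Fin n → List (Fin n)) (par : Fin n → Fin n) : ℕ → Fin n → ℕ
  | 0, _ => 1
  | k + 1, u => 1 + ((childList ord par u).map (sizeAux ord par k)).sum

/-- With `H` the greatest depth, the fuel `H - depth u` can only run out at a leaf. Summing the
recursion over all vertices yields every non-root size once on both sides; cancelling leaves `size r
= n`. -/
theorem IsRooting.exists_size {n : ℕ} {r : Fin n} {ord : Fin n → List (Fin n)}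
    {par : Fin n → Fin n} {depth : Fin n → ℕ} (h : IsRooting r ord par depth) :
    ∃ size : Fin n → ℕ, (∀ u, size u = 1 + ((childList ord par u).map size).sum) ∧
      size r = n := by
  have hH : ∀ u, depth u ≤ Finset.univ.sup depth := fun u => Finset.le_sup (Finset.mem_univ u)
  generalize Finset.univ.sup depth = H at hH
  have hrec : ∀ u, sizeAux ord par (H - depth u) u =
      1 + ((childList ord par u).map fun w => sizeAux ord par (H - depth w) w).sum := by
    intro u
    have hd : ∀ w ∈ childList ord par u, depth w = depth u + 1 := by
      intro w hw
      rw [h.mem_childList] at hw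
      rw [h.depth_par w hw.1, hw.2]
    rcases hk : H - depth u with _ | k
    · rcases hl : childList ord par u with _ | ⟨w, l⟩
      · simp [sizeAux]
      · have h1 := hd w (by simp [hl])
        have h2 := hH w
        omega
    · rw [sizeAux]
      congr 2
      apply List.map_congr_left
      intro w hw
      have h1 := hd w hw
      have : H - depth w = k := by omega
      rw [this]
  refine ⟨fun u => sizeAux ord par (H - depth u) u, hrec, ?_⟩
  generalize hs : (fun u => sizeAux ord par (H - depth u) u) = size
  have hrec' : ∀ u, size u = 1 + ∑ w with w ≠ r ∧ par w = u, size w := by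
    intro u
    have := hrec u
    subst hs
    simp only at this ⊢
    rw [this, h.sum_childList]
  have h1 : ∑ u, size u = n + ∑ w with w ≠ r, size w := by
    conv_lhs => enter [2, u]; rw [hrec' u]
    rw [Finset.sum_add_distrib, ← Finset.sum_fiberwise (s := Finset.univ.filter (· ≠ r)) (g := par)]
    simp [Finset.filter_filter]
  have h2 : ∑ u, size u = size r + ∑ w with w ≠ r, size w := by
    rw [Finset.filter_ne' Finset.univ r, Finset.add_sum_erase _ _ (Finset.mem_univ r)]
  change size r = n
  omega

end TreeDrawing

namespace TreeDrawing

open Real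

/-! ### The slope as an increasing function of the parameter. -/

/-- The slope of the vectors `(κ (1 - t), κ)` with `κ > 0`. -/
noncomputable def slopeAngle (t : ℝ) : ℝ := π / 2 + arctan (t - 1)

theorem slopeAngle_strictMono : StrictMono slopeAngle := fun a b h => by
  have := arctan_strictMono (show a - 1 < b - 1 by linarith)
  unfold slopeAngle
  linarith

theorem slopeAngle_pos (t : ℝ) : 0 < slopeAngle t := by
  have := neg_pi_div_two_lt_arctan (t - 1)
  unfold slopeAngle
  linarith

theorem slopeAngle_lt_pi (t : ℝ) : slopeAngle t < π := by
  have := arctan_lt_pi_div_two (t - 1)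
  unfold slopeAngle
  linarith

theorem arg_eq_slopeAngle {κ : ℝ} (hκ : 0 < κ) (t : ℝ) :
    ((κ : ℂ) * ⟨1 - t, 1⟩).arg = slopeAngle t := by
  rw [Complex.arg_real_mul _ hκ]
  have hs : 0 < √(1 + (1 - t) ^ 2) := Real.sqrt_pos.2 (by positivity)
  have h : (⟨1 - t, 1⟩ : ℂ) = (√(1 + (1 - t) ^ 2) : ℝ) *
      (Complex.cos (slopeAngle t : ℝ) + Complex.sin (slopeAngle t : ℝ) * Complex.I) := by
    have h1 : slopeAngle t = π / 2 - arctan (1 - t) := by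
      rw [slopeAngle, show t - 1 = -(1 - t) by ring, arctan_neg]
      ring
    rw [h1, ← Complex.ofReal_cos, ← Complex.ofReal_sin, Real.cos_pi_div_two_sub,
      Real.sin_pi_div_two_sub, Real.sin_arctan, Real.cos_arctan]
    apply Complex.ext
    · simp
      field_simp
    · simp
      field_simp
  rw [h, Complex.arg_mul_cos_add_sin_mul_I hs]
  exact ⟨by have := slopeAngle_pos t; have := pi_pos; linarith, (slopeAngle_lt_pi t).le⟩

/-! ### Counterclockwise order under rotation of the list. -/

section Cyclic

variable {V : Type*}

/-- The entries of `l` appear counterclockwise around `v`, starting from the first one. -/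
def CcwSorted (Γ : V → ℂ) (v : V) (l : List V) : Prop :=
  ∀ w₀ l', l = w₀ :: l' →
    (w₀ :: l').Pairwise fun w w' => ccwAngle Γ v w₀ w < ccwAngle Γ v w₀ w'

theorem ccwAngle_mem_Ico (Γ : V → ℂ) (v a b : V) : ccwAngle Γ v a b ∈ Set.Ico 0 (2 * π) := by
  have := toIcoMod_mem_Ico Real.two_pi_pos 0 ((Γ b - Γ v).arg - (Γ a - Γ v).arg)
  rwa [zero_add] at this

theorem ccwAngle_eq_of_eq_add {Γ : V → ℂ} {v a b : V} {x : ℝ} (hx : x ∈ Set.Ico 0 (2 * π))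
    (k : ℤ) (h : (Γ b - Γ v).arg - (Γ a - Γ v).arg = x + k * (2 * π)) :
    ccwAngle Γ v a b = x := by
  unfold ccwAngle
  rw [toIcoMod_eq_iff, zero_add]
  exact ⟨hx, k, by simpa using h⟩

theorem exists_eq_ccwAngle_add (Γ : V → ℂ) (v a b : V) :
    ∃ k : ℤ, (Γ b - Γ v).arg - (Γ a - Γ v).arg = ccwAngle Γ v a b + k * (2 * π) := by
  refine ⟨toIcoDiv Real.two_pi_pos 0 ((Γ b - Γ v).arg - (Γ a - Γ v).arg), ?_⟩
  have := toIcoMod_add_toIcoDiv_zsmul Real.two_pi_pos 0 ((Γ b - Γ v).arg - (Γ a - Γ v).arg)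
  rw [zsmul_eq_mul] at this
  exact this.symm

theorem ccwAngle_self (Γ : V → ℂ) (v a : V) : ccwAngle Γ v a a = 0 :=
  ccwAngle_eq_of_eq_add ⟨le_rfl, Real.two_pi_pos⟩ 0 (by simp)

theorem ccwAngle_eq_sub {Γ : V → ℂ} {v a b c : V} (h : ccwAngle Γ v a b ≤ ccwAngle Γ v a c) :
    ccwAngle Γ v b c = ccwAngle Γ v a c - ccwAngle Γ v a b := by
  obtain ⟨k, hk⟩ := exists_eq_ccwAngle_add Γ v a b
  obtain ⟨m, hm⟩ := exists_eq_ccwAngle_add Γ v a c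
  have h1 := (ccwAngle_mem_Ico Γ v a b).1
  have h2 := (ccwAngle_mem_Ico Γ v a c).2
  refine ccwAngle_eq_of_eq_add ⟨by linarith, by linarith⟩ (m - k) ?_
  push_cast
  linarith

theorem ccwAngle_swap {Γ : V → ℂ} {v a b : V} (h : 0 < ccwAngle Γ v a b) :
    ccwAngle Γ v b a = 2 * π - ccwAngle Γ v a b := by
  obtain ⟨k, hk⟩ := exists_eq_ccwAngle_add Γ v a b
  have h2 := (ccwAngle_mem_Ico Γ v a b).2
  refine ccwAngle_eq_of_eq_add ⟨by linarith, by linarith⟩ (-1 - k) ?_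
  push_cast
  linarith

/-- Let `c` be the new first entry. Measured from `c`, the other angles drop by the angle of `c`,
while `a`, formerly at angle 0, reappears at 2π minus that amount and so comes after all the others.
-/
theorem CcwSorted.concat {Γ : V → ℂ} {v a : V} {l : List V} (h : CcwSorted Γ v (a :: l)) :
    CcwSorted Γ v (l ++ [a]) := by
  have hp := h a l rfl
  rintro b l' hl
  rcases l with _ | ⟨c, l''⟩
  · simp only [List.nil_append, List.cons.injEq] at hl
    obtain ⟨rfl, rfl⟩ := hl
    simp
  · simp only [List.cons_append, List.cons.injEq] at hl
    obtain ⟨rfl, rfl⟩ := hl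
    obtain ⟨hp1, hp2⟩ := List.pairwise_cons.1 hp
    have hle : ∀ w ∈ c :: l'', ccwAngle Γ v a c ≤ ccwAngle Γ v a w := by
      intro w hw
      rcases List.mem_cons.1 hw with rfl | hw
      · exact le_rfl
      · exact ((List.pairwise_cons.1 hp2).1 w hw).le
    have hpos := hp1 c (by simp)
    rw [ccwAngle_self] at hpos
    rw [← List.cons_append, List.pairwise_append]
    refine ⟨hp2.imp_of_mem fun {x y} hx hy hxy => ?_, by simp, ?_⟩
    · rw [ccwAngle_eq_sub (hle x hx), ccwAngle_eq_sub (hle y hy)]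
      linarith
    · intro x hx y hy
      rw [List.mem_singleton] at hy
      subst hy
      rw [ccwAngle_eq_sub (hle x hx), ccwAngle_swap hpos]
      have := (ccwAngle_mem_Ico Γ v y x).2
      linarith

theorem CcwSorted.isRotated {Γ : V → ℂ} {v : V} {l l' : List V} (h : CcwSorted Γ v l)
    (hl : l ~r l') : CcwSorted Γ v l' := by
  obtain ⟨k, rfl⟩ := hl
  induction k with
  | zero => simpa using h
  | succ k ih =>
    rw [← List.rotate_rotate]
    rcases hk : l.rotate k with _ | ⟨a, l''⟩ <;> rw [hk] at ih
    · simpa using ih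
    · simpa using ih.concat

theorem CyclicSucc.isRotated {l l' : List V} {w w' : V} (h : CyclicSucc l w w') (hl : l ~r l') :
    CyclicSucc l' w w' := by
  obtain ⟨k, rfl⟩ := hl
  refine ⟨by simpa using h.1, ?_⟩
  rw [List.rotate_rotate, add_comm, ← List.rotate_rotate, List.zip,
    ← List.zipWith_rotate_distrib _ _ _ _ (by simp), List.mem_rotate]
  exact h.2

theorem CyclicSucc.exists_getElem {l : List V} {w w' : V} (h : CyclicSucc l w w') :
    ∃ i, ∃ hi : i < l.length, l[i] = w ∧
      ((∃ hi' : i + 1 < l.length, l[i + 1] = w') ∨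
        (i + 1 = l.length ∧ l[0]'(Nat.zero_lt_of_lt hi) = w')) := by
  obtain ⟨i, hi, he⟩ := List.mem_iff_getElem.1 h.2
  have hi' : i < l.length := by
    rw [List.length_zip, List.length_rotate, min_self] at hi
    exact hi
  rw [List.getElem_zip, List.getElem_rotate, Prod.mk.injEq] at he
  refine ⟨i, hi', he.1, ?_⟩
  by_cases h1 : i + 1 < l.length
  · left
    refine ⟨h1, ?_⟩
    rw [← he.2]
    congr 1
    exact (Nat.mod_eq_of_lt h1).symm
  · right
    have h2 : i + 1 = l.length := by omega
    refine ⟨h2, ?_⟩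
    rw [← he.2]
    congr 1
    rw [h2, Nat.mod_self]

end Cyclic

/-! ### Walks along which a function increases. -/

section Monotone

variable {V : Type*} {G : SimpleGraph V}

/-- Walks are enough throughout: strictly increasing values exclude repeated vertices, so such a
walk is automatically a path. -/
theorem exists_increasing_walk_cons {f : V → ℝ} {u u' v : V} (hadj : G.Adj u u') (hf : f u < f u')
    (h : ∃ p : G.Walk u' v, (p.support.map f).Pairwise (· < ·)) :
    ∃ p : G.Walk u v, (p.support.map f).Pairwise (· < ·) := by
  obtain ⟨p, hp⟩ := h
  refine ⟨.cons hadj p, ?_⟩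
  rw [SimpleGraph.Walk.support_cons, List.map_cons, List.pairwise_cons]
  refine ⟨fun x hx => ?_, hp⟩
  rw [← p.cons_tail_support, List.map_cons] at hx hp
  rcases List.mem_cons.1 hx with rfl | hx
  · exact hf
  · exact hf.trans ((List.pairwise_cons.1 hp).1 x hx)

theorem exists_increasing_walk_down {f : V → ℝ} {r c v : V} (hv : InSubtree G r c v)
    (hf : ∀ a b, InSubtree G r c a → IsChild G r a b → f a < f b) :
    ∃ p : G.Walk c v, (p.support.map f).Pairwise (· < ·) := by
  suffices h : InSubtree G r c c → ∃ p : G.Walk c v, (p.support.map f).Pairwise (· < ·) from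
    h .refl
  refine Relation.ReflTransGen.head_induction_on
    (motive := fun x _ => InSubtree G r c x → ∃ p : G.Walk x v,
      (p.support.map f).Pairwise (· < ·)) hv ?_ ?_
  · intro _
    exact ⟨.nil, by simp⟩
  · intro a b hab _ ih hca
    exact exists_increasing_walk_cons hab.1 (hf a b hca hab) (ih (hca.tail hab))

theorem exists_increasing_walk_up {f : V → ℝ} {r c u v : V} (hu : InSubtree G r c u)
    (hf : ∀ a b, InSubtree G r c a → IsChild G r a b → f b < f a)
    (h : ∃ p : G.Walk c v, (p.support.map f).Pairwise (· < ·)) :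
    ∃ p : G.Walk u v, (p.support.map f).Pairwise (· < ·) := by
  induction hu with
  | refl => exact h
  | tail hca hab ih => exact exists_increasing_walk_cons hab.1.symm (hf _ _ hca hab) ih

end Monotone

/-! ### Cone drawings are monotone, slope-disjoint and near-convex. -/

section Drawing

variable {n : ℕ} {r : Fin n} {ord : Fin n → List (Fin n)} {par : Fin n → Fin n}
  {depth : Fin n → ℕ} {G : SimpleGraph (Fin n)}

/-- The edge that enters `v` has direction `(1 - t v, 1)`, and those of the subtree rooted at `v`
have parameters between `lo v` and `hi v`. -/
structure IsConeDrawing (r : Fin n) (ord : Fin n → List (Fin n)) (par : Fin n → Fin n)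
    (Γ : Fin n → ℂ) (t lo hi : Fin n → ℝ) : Prop where
  sub_par : ∀ v, v ≠ r → ∃ κ : ℝ, 0 < κ ∧ Γ v - Γ (par v) = (κ : ℂ) * ⟨1 - t v, 1⟩
  lo_lt : ∀ v, lo v < t v
  lt_hi : ∀ v, t v < hi v
  lo_par : ∀ v, v ≠ r → lo (par v) ≤ lo v
  hi_par : ∀ v, v ≠ r → hi v ≤ hi (par v)
  siblings : ∀ u, (childList ord par u).Pairwise fun w w' => hi w ≤ lo w'
  first_le : ∀ u, u ≠ r → ∀ h : 0 < (childList ord par u).length,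
    t (childList ord par u)[0] ≤ t u
  le_last : ∀ u, u ≠ r → ∀ h : 0 < (childList ord par u).length,
    t u ≤ t ((childList ord par u)[(childList ord par u).length - 1])

variable {Γ : Fin n → ℂ} {t lo hi : Fin n → ℝ}

/-- Induction on `v` down the tree. The third case arises when the parent of `v` is a proper
ancestor of `u` and `v` branches off the path from it to `u`. -/
theorem trichotomy_inSubtree (hr : IsRooting r ord par depth)
    (hch : ∀ u v, IsChild G r u v ↔ v ≠ r ∧ par v = u) (u v : Fin n) :
    InSubtree G r u v ∨ InSubtree G r v u ∨ ∃ w c₁ c₂, c₁ ≠ c₂ ∧ IsChild G r w c₁ ∧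
      IsChild G r w c₂ ∧ InSubtree G r c₁ u ∧ InSubtree G r c₂ v := by
  have hroot : InSubtree G r r u := by
    refine hr.induction (P := InSubtree G r r) .refl (fun x hx ih => ?_) u
    exact ih.tail ((hch _ _).2 ⟨hx, rfl⟩)
  refine hr.induction (P := fun v => InSubtree G r u v ∨ InSubtree G r v u ∨ ∃ w c₁ c₂, c₁ ≠ c₂ ∧
    IsChild G r w c₁ ∧ IsChild G r w c₂ ∧ InSubtree G r c₁ u ∧ InSubtree G r c₂ v)
    (Or.inr (Or.inl hroot)) (fun x hx ih => ?_) v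
  have hc := (hch _ _).2 ⟨hx, rfl⟩
  rcases ih with h | h | ⟨w, c₁, c₂, hne, h1, h2, h3, h4⟩
  · exact Or.inl (h.tail hc)
  · rcases Relation.ReflTransGen.cases_head h with h | ⟨c, h1, h2⟩
    · rw [← h]
      exact Or.inl (.single hc)
    · by_cases hcx : c = x
      · subst hcx
        exact Or.inr (Or.inl h2)
      · exact Or.inr (Or.inr ⟨_, c, x, hcx, h1, hc, h2, .refl⟩)
  · exact Or.inr (Or.inr ⟨w, c₁, c₂, hne, h1, h2, h3, h4.tail hc⟩)

namespace IsConeDrawing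

theorem inSubtree_le (h : IsConeDrawing r ord par Γ t lo hi)
    (hch : ∀ u v, IsChild G r u v ↔ v ≠ r ∧ par v = u) {c v : Fin n} (hv : InSubtree G r c v) :
    lo c ≤ lo v ∧ hi v ≤ hi c := by
  induction hv with
  | refl => exact ⟨le_rfl, le_rfl⟩
  | tail _ hab ih =>
    obtain ⟨hb, rfl⟩ := (hch _ _).1 hab
    exact ⟨ih.1.trans (h.lo_par _ hb), (h.hi_par _ hb).trans ih.2⟩

theorem inner_lt (h : IsConeDrawing r ord par Γ t lo hi)
    (hch : ∀ u v, IsChild G r u v ↔ v ≠ r ∧ par v = u) {a b : Fin n} (hab : IsChild G r a b)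
    {d : ℂ} (hd : 0 < d.re * (1 - t b) + d.im) : inner ℝ d (Γ a) < inner ℝ d (Γ b) := by
  obtain ⟨hb, rfl⟩ := (hch _ _).1 hab
  obtain ⟨κ, hκ, he⟩ := h.sub_par b hb
  have : inner ℝ d (Γ b) - inner ℝ d (Γ (par b)) = κ * (d.re * (1 - t b) + d.im) := by
    rw [← inner_sub_right, he, Complex.inner]
    simp
    ring
  have := mul_pos hκ hd
  linarith

theorem siblings_or (h : IsConeDrawing r ord par Γ t lo hi) (hr : IsRooting r ord par depth)
    (hch : ∀ u v, IsChild G r u v ↔ v ≠ r ∧ par v = u) {w c₁ c₂ : Fin n}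
    (h1 : IsChild G r w c₁) (h2 : IsChild G r w c₂) (hne : c₁ ≠ c₂) :
    hi c₁ ≤ lo c₂ ∨ hi c₂ ≤ lo c₁ := by
  rw [hch, ← hr.mem_childList] at h1 h2
  have : Std.Symm fun a b => hi a ≤ lo b ∨ hi b ≤ lo a := ⟨fun _ _ => Or.symm⟩
  exact ((h.siblings w).imp (S := fun a b => hi a ≤ lo b ∨ hi b ≤ lo a) Or.inl).forall h1 h2 hne

theorem exists_increasing_walk (h : IsConeDrawing r ord par Γ t lo hi)
    (hr : IsRooting r ord par depth) (hch : ∀ u v, IsChild G r u v ↔ v ≠ r ∧ par v = u)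
    (u v : Fin n) : ∃ d : ℂ, d ≠ 0 ∧ ∃ p : G.Walk u v,
      (p.support.map fun w => inner ℝ d (Γ w)).Pairwise (· < ·) := by
  rcases trichotomy_inSubtree hr hch u v with huv | huv | ⟨w, c₁, c₂, hne, h1, h2, h3, h4⟩
  -- Every edge points upwards, so height serves as the projection whenever one vertex is an
  -- ancestor of the other.
  · refine ⟨Complex.I, Complex.I_ne_zero, exists_increasing_walk_down huv fun a b _ hab => ?_⟩
    exact h.inner_lt hch hab (by simp)
  · refine ⟨-Complex.I, neg_ne_zero.2 Complex.I_ne_zero,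
      exists_increasing_walk_up huv (fun a b _ hab => ?_) ⟨.nil, by simp⟩⟩
    rw [inner_neg_left, inner_neg_left, neg_lt_neg_iff]
    exact h.inner_lt hch hab (by simp)
  · have key : ∀ c a b : Fin n, InSubtree G r c a → IsChild G r a b → lo c < t b ∧ t b < hi c := by
      intro c a b hca hab
      have := h.inSubtree_le hch (hca.tail hab)
      exact ⟨this.1.trans_lt (h.lo_lt b), (h.lt_hi b).trans_le this.2⟩
    have key' : ∀ c, lo c < t c ∧ t c < hi c := fun c => ⟨h.lo_lt c, h.lt_hi c⟩
    have walk : ∀ d : ℂ,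
        (∀ b, lo c₁ < t b → t b < hi c₁ → 0 < (-d).re * (1 - t b) + (-d).im) →
        (∀ b, lo c₂ < t b → t b < hi c₂ → 0 < d.re * (1 - t b) + d.im) →
        ∃ p : G.Walk u v, (p.support.map fun w => inner ℝ d (Γ w)).Pairwise (· < ·) := by
      intro d hd1 hd2
      have hup : ∀ a b, IsChild G r a b → lo c₁ < t b → t b < hi c₁ →
          inner ℝ d (Γ b) < inner ℝ d (Γ a) := by
        intro a b hab hb1 hb2
        have := h.inner_lt hch hab (hd1 b hb1 hb2)
        rwa [inner_neg_left, inner_neg_left, neg_lt_neg_iff] at this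
      refine exists_increasing_walk_up h3
        (fun a b hca hab => hup a b hab (key _ _ _ hca hab).1 (key _ _ _ hca hab).2) ?_
      refine exists_increasing_walk_cons h1.1.symm (hup _ _ h1 (key' _).1 (key' _).2) ?_
      refine exists_increasing_walk_cons h2.1 (h.inner_lt hch h2 (hd2 _ (key' _).1 (key' _).2)) ?_
      exact exists_increasing_walk_down h4 fun a b hca hab =>
        h.inner_lt hch hab (hd2 b (key _ _ _ hca hab).1 (key _ _ _ hca hab).2)
    rcases h.siblings_or hr hch h1 h2 hne with hlt | hlt
    -- The product of this vector with `(1 - t, 1)` is `t - hi c₁`: negative on the branch of `c₁`,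
    -- positive on that of `c₂`. In the mirrored case the product is `hi c₂ - t`.
    · refine ⟨⟨-1, 1 - hi c₁⟩, fun h0 => ?_, walk _ (fun b hb1 hb2 => ?_) fun b hb1 hb2 => ?_⟩
      · simpa using congrArg Complex.re h0
      · simp only [Complex.neg_re, Complex.neg_im]
        linarith
      · simp only
        linarith
    · refine ⟨⟨1, hi c₂ - 1⟩, fun h0 => ?_, walk _ (fun b hb1 hb2 => ?_) fun b hb1 hb2 => ?_⟩
      · simpa using congrArg Complex.re h0
      · simp only [Complex.neg_re, Complex.neg_im]
        linarith
      · simp only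
        linarith

theorem isMonotoneDrawing (h : IsConeDrawing r ord par Γ t lo hi)
    (hr : IsRooting r ord par depth) (hch : ∀ u v, IsChild G r u v ↔ v ≠ r ∧ par v = u) :
    IsMonotoneDrawing G Γ := by
  refine ⟨fun u v huv => ?_, fun u v => ?_⟩
  · obtain ⟨d, -, p, hp⟩ := h.exists_increasing_walk hr hch u v
    cases p with
    | nil => rfl
    | cons hadj q =>
      rw [SimpleGraph.Walk.support_cons, List.map_cons, List.pairwise_cons] at hp
      have := hp.1 _ (List.mem_map_of_mem q.end_mem_support)
      simp only [huv, lt_self_iff_false] at this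
  · obtain ⟨d, hd, p, hp⟩ := h.exists_increasing_walk hr hch u v
    refine ⟨p, ?_, d, hd, hp⟩
    rw [SimpleGraph.Walk.isPath_def]
    exact List.Nodup.of_map _ (hp.imp fun h => ne_of_lt h)

theorem arg_child (h : IsConeDrawing r ord par Γ t lo hi) {v : Fin n} (hv : v ≠ r) :
    (Γ v - Γ (par v)).arg = slopeAngle (t v) := by
  obtain ⟨κ, hκ, he⟩ := h.sub_par v hv
  rw [he, arg_eq_slopeAngle hκ]

theorem arg_par (h : IsConeDrawing r ord par Γ t lo hi) {v : Fin n} (hv : v ≠ r) :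
    (Γ (par v) - Γ v).arg = slopeAngle (t v) - π := by
  rw [← h.arg_child hv, ← neg_sub (Γ v)]
  apply Complex.arg_neg_eq_arg_sub_pi_of_im_pos
  obtain ⟨κ, hκ, he⟩ := h.sub_par v hv
  rw [he]
  simpa using hκ

theorem isNonStrictlySlopeDisjoint (h : IsConeDrawing r ord par Γ t lo hi)
    (hr : IsRooting r ord par depth) (hch : ∀ u v, IsChild G r u v ↔ v ≠ r ∧ par v = u) :
    IsNonStrictlySlopeDisjoint G r Γ := by
  have hlt : ∀ u, slopeAngle (lo u) < slopeAngle (hi u) := fun u =>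
    slopeAngle_strictMono ((h.lo_lt u).trans (h.lt_hi u))
  have hslope : ∀ u v, IsChild G r u v → slope Γ u v = slopeAngle (t v) := by
    intro u v huv
    obtain ⟨hv, rfl⟩ := (hch _ _).1 huv
    rw [slope, h.arg_child hv, toIcoMod_eq_self, zero_add]
    have := slopeAngle_lt_pi (t v)
    have := pi_pos
    exact ⟨(slopeAngle_pos _).le, by linarith⟩
  have hmem : ∀ u v w, IsChild G r w v → InSubtree G r u v →
      slope Γ w v ∈ Set.Ioo (slopeAngle (lo u)) (slopeAngle (hi u)) := by
    intro u v w hwv huv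
    have := h.inSubtree_le hch huv
    rw [hslope w v hwv]
    exact ⟨slopeAngle_strictMono (this.1.trans_lt (h.lo_lt v)),
      slopeAngle_strictMono ((h.lt_hi v).trans_le this.2)⟩
  have hm := slopeAngle_strictMono.monotone
  refine ⟨fun u => slopeAngle (lo u), fun u => slopeAngle (hi u), fun u => ⟨(slopeAngle_pos _).le,
    hlt u, (slopeAngle_lt_pi _).le, fun w z huw hwz => hmem u z w hwz (huw.tail hwz),
    fun p hp => hmem u u p hp .refl⟩, fun u v huv => ?_, fun p u₁ u₂ h1 h2 hne => ?_⟩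
  · obtain ⟨hv, rfl⟩ := (hch _ _).1 huv
    exact ⟨hm (h.lo_par v hv), hlt v, hm (h.hi_par v hv)⟩
  · rcases h.siblings_or hr hch h1 h2 hne with hle | hle
    · exact Or.inl ⟨hlt _, hm hle, hlt _⟩
    · exact Or.inr ⟨hlt _, hm hle, hlt _⟩

theorem ccwAngle_children (h : IsConeDrawing r ord par Γ t lo hi) {v w w' : Fin n} (hw : w ≠ r)
    (hpw : par w = v) (hw' : w' ≠ r) (hpw' : par w' = v) (hle : t w ≤ t w') :
    ccwAngle Γ v w w' = slopeAngle (t w') - slopeAngle (t w) := by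
  refine ccwAngle_eq_of_eq_add ⟨?_, ?_⟩ 0 ?_
  · exact sub_nonneg.2 (slopeAngle_strictMono.monotone hle)
  · have := slopeAngle_lt_pi (t w')
    have := slopeAngle_pos (t w)
    have := pi_pos
    linarith
  · rw [← h.arg_child hw, ← h.arg_child hw', hpw, hpw']
    simp

theorem ccwAngle_par_child (h : IsConeDrawing r ord par Γ t lo hi) {v w : Fin n} (hv : v ≠ r)
    (hw : w ≠ r) (hpw : par w = v) :
    ccwAngle Γ v (par v) w = slopeAngle (t w) - slopeAngle (t v) + π := by
  have h1 := slopeAngle_lt_pi (t w)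
  have h2 := slopeAngle_pos (t w)
  have h3 := slopeAngle_lt_pi (t v)
  have h4 := slopeAngle_pos (t v)
  refine ccwAngle_eq_of_eq_add ⟨by linarith, by linarith⟩ 0 ?_
  rw [h.arg_par hv, ← h.arg_child hw, hpw]
  simp
  ring

/-- The direction to the parent is represented by `slopeAngle (t v) - π`, so the raw difference of
arguments is negative and one full turn has to be added. -/
theorem ccwAngle_child_par (h : IsConeDrawing r ord par Γ t lo hi) {v w : Fin n} (hv : v ≠ r)
    (hw : w ≠ r) (hpw : par w = v) :
    ccwAngle Γ v w (par v) = slopeAngle (t v) - slopeAngle (t w) + π := by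
  have h1 := slopeAngle_lt_pi (t w)
  have h2 := slopeAngle_pos (t w)
  have h3 := slopeAngle_lt_pi (t v)
  have h4 := slopeAngle_pos (t v)
  refine ccwAngle_eq_of_eq_add ⟨by linarith, by linarith⟩ (-1) ?_
  rw [h.arg_par hv, ← h.arg_child hw, hpw]
  push_cast
  ring

theorem pairwise_t (h : IsConeDrawing r ord par Γ t lo hi) (u : Fin n) :
    (childList ord par u).Pairwise fun w w' => t w < t w' :=
  (h.siblings u).imp fun {a b} hab => (h.lt_hi a).trans_le (hab.trans (h.lo_lt b).le)

/-- Away from the root it suffices to treat the rotation of the list that begins with the parent.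
From there the angle of a child is π plus a difference of slopes, which increases with the parameter
and stays in (0, 2π). -/
theorem respectsOrder (h : IsConeDrawing r ord par Γ t lo hi) (hr : IsRooting r ord par depth) :
    RespectsOrder ord Γ := by
  intro v
  have hmem : ∀ w ∈ childList ord par v, w ≠ r ∧ par w = v := fun w hw => hr.mem_childList.1 hw
  have hp := h.pairwise_t v
  suffices hs : CcwSorted Γ v (ord v) from hs
  by_cases hv : v = r
  · subst hv
    rw [← hr.childList_root]
    intro w₀ l hl
    rw [hl] at hp hmem
    have hw₀ := hmem w₀ (by simp)
    have hle : ∀ w ∈ w₀ :: l, t w₀ ≤ t w := by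
      intro w hw
      rcases List.mem_cons.1 hw with rfl | hw
      · exact le_rfl
      · exact ((List.pairwise_cons.1 hp).1 w hw).le
    refine hp.imp_of_mem fun {x y} hx hy hxy => ?_
    rw [h.ccwAngle_children hw₀.1 hw₀.2 (hmem x hx).1 (hmem x hx).2 (hle x hx),
      h.ccwAngle_children hw₀.1 hw₀.2 (hmem y hy).1 (hmem y hy).2 (hle y hy)]
    have := slopeAngle_strictMono hxy
    linarith
  · refine CcwSorted.isRotated ?_ (hr.isRotated_ord hv)
    intro w₀ l hl
    simp only [List.cons.injEq] at hl
    obtain ⟨rfl, rfl⟩ := hl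
    rw [List.pairwise_cons]
    constructor
    · intro w hw
      rw [ccwAngle_self, h.ccwAngle_par_child hv (hmem w hw).1 (hmem w hw).2]
      have := slopeAngle_lt_pi (t v)
      have := slopeAngle_pos (t w)
      linarith
    · refine hp.imp_of_mem fun {x y} hx hy hxy => ?_
      rw [h.ccwAngle_par_child hv (hmem x hx).1 (hmem x hx).2,
        h.ccwAngle_par_child hv (hmem y hy).1 (hmem y hy).2]
      have := slopeAngle_strictMono hxy
      linarith

theorem ccwAngle_succ_mem_Ioc (h : IsConeDrawing r ord par Γ t lo hi)
    (hr : IsRooting r ord par depth) {v : Fin n} {i : ℕ}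
    (hi : i + 1 < (childList ord par v).length) :
    ccwAngle Γ v (childList ord par v)[i] (childList ord par v)[i + 1] ∈ Set.Ioc 0 π := by
  have hmem : ∀ w ∈ childList ord par v, w ≠ r ∧ par w = v := fun w hw => hr.mem_childList.1 hw
  have hlt := List.pairwise_iff_getElem.1 (h.pairwise_t v) i (i + 1) (by omega) hi (by omega)
  have h1 := hmem _ (List.getElem_mem (Nat.lt_of_succ_lt hi))
  have h2 := hmem _ (List.getElem_mem hi)
  rw [h.ccwAngle_children h1.1 h1.2 h2.1 h2.2 hlt.le]
  have := slopeAngle_strictMono hlt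
  have := slopeAngle_lt_pi (t (childList ord par v)[i + 1])
  have := slopeAngle_pos (t (childList ord par v)[i])
  exact ⟨by linarith, by linarith⟩

/-- Away from the root, the angle from the parent to the first child is π plus the slope of the
first child's edge minus that of the entering edge, and symmetrically for the last child; `first_le`
and `le_last` say that neither exceeds π. Angles between consecutive children are differences of
slopes, hence below π. -/
theorem isNearConvexMonotone (h : IsConeDrawing r ord par Γ t lo hi)
    (hr : IsRooting r ord par depth) (hch : ∀ u v, IsChild G r u v ↔ v ≠ r ∧ par v = u) :
    IsNearConvexMonotone G r ord Γ := by
  refine ⟨h.isMonotoneDrawing hr hch, h.respectsOrder hr,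
    -- The exceptional pair closes the cycle at the root, from the last entry back to the first. The
    -- default `r` occurs only for an empty list, which has no consecutive pairs.
    ((ord r).getLastD r, (ord r).headD r), fun v w w' hs => ?_⟩
  have hmem : ∀ w ∈ childList ord par v, w ≠ r ∧ par w = v := fun w hw => hr.mem_childList.1 hw
  by_cases hv : v = r
  · subst hv
    rw [← hr.childList_root] at hs ⊢
    obtain ⟨i, hi, rfl, ⟨hi', rfl⟩ | ⟨hi', rfl⟩⟩ := hs.exists_getElem
    · exact Or.inr (h.ccwAngle_succ_mem_Ioc hr hi')
    · refine Or.inl ⟨rfl, ?_⟩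
      rw [Prod.mk.injEq]
      constructor
      · rw [List.getLastD_eq_getLast?, List.getLast?_eq_getElem?,
          List.getElem?_eq_getElem (by omega)]
        simp [← hi']
      · rw [List.headD_eq_head?_getD, List.head?_eq_getElem?,
          List.getElem?_eq_getElem (by omega)]
        simp
  · right
    obtain ⟨i, hi, rfl, hw'⟩ := (hs.isRotated (hr.isRotated_ord hv).symm).exists_getElem
    have hlen := (hs.isRotated (hr.isRotated_ord hv).symm).1
    rw [List.length_cons] at hi hlen
    rcases i with _ | i
    · rcases hw' with ⟨hi', rfl⟩ | ⟨hi', rfl⟩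
      · have hpos : 0 < (childList ord par v).length := by omega
        have h1 := hmem _ (List.getElem_mem hpos)
        have h2 := slopeAngle_strictMono.monotone (h.first_le v hv hpos)
        simp only [List.getElem_cons_zero, List.getElem_cons_succ]
        rw [h.ccwAngle_par_child hv h1.1 h1.2]
        have := slopeAngle_lt_pi (t v)
        have := slopeAngle_pos (t (childList ord par v)[0])
        exact ⟨by linarith, by linarith⟩
      · rw [List.length_cons] at hi'
        omega
    · rcases hw' with ⟨hi', rfl⟩ | ⟨hi', rfl⟩
      · rw [List.length_cons] at hi'
        simp only [List.getElem_cons_succ]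
        exact h.ccwAngle_succ_mem_Ioc hr (by omega)
      · rw [List.length_cons] at hi'
        obtain rfl : i = (childList ord par v).length - 1 := by omega
        have h1 := hmem _ (List.getElem_mem (show (childList ord par v).length - 1 <
          (childList ord par v).length by omega))
        have h2 := slopeAngle_strictMono.monotone (h.le_last v hv (by omega))
        simp only [List.getElem_cons_zero, List.getElem_cons_succ]
        rw [h.ccwAngle_child_par hv h1.1 h1.2]
        have := slopeAngle_pos (t v)
        have := slopeAngle_lt_pi (t ((childList ord par v)[(childList ord par v).length - 1]))
        exact ⟨by linarith, by linarith⟩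

end IsConeDrawing

end Drawing

/-! ### Containment of the edges in the octant, by convexity. -/

theorem convex_secondOctant : Convex ℝ secondOctant := by
  rintro x ⟨hx1, hx2⟩ y ⟨hy1, hy2⟩ a b ha hb -
  refine ⟨?_, ?_⟩ <;>
    simp only [Complex.add_re, Complex.add_im, Complex.smul_re, Complex.smul_im, smul_eq_mul]
  · positivity
  · gcongr

theorem drawnSet_subset_secondOctant {V : Type*} {G : SimpleGraph V} {Γ : V → ℂ}
    (h : ∀ v, Γ v ∈ secondOctant) : drawnSet G Γ ⊆ secondOctant := by
  rintro z (⟨v, rfl⟩ | hz)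
  · exact h v
  · simp only [Set.mem_iUnion] at hz
    obtain ⟨u, v, -, hz⟩ := hz
    exact convex_secondOctant.segment_subset (h u) (h v) hz

end TreeDrawing

namespace TreeDrawing

/-! ### Integer placements and the bound on the height. -/

/-- Placement of a vertex: the interval `[lo, hi)` of its subtree, the vector `(k - j, k)` of the
edge entering it and its position `(x, y)`. -/
structure Placement where
  lo : ℕ
  hi : ℕ
  j : ℕ
  k : ℕ
  x : ℕ
  y : ℕ

namespace Placement

/-- Placement of a child whose subtree has `sz` of the `S` vertices of the subtrees of the
children, `off` of which precede it. -/
def step (N : ℕ) (p : Placement) (off sz S : ℕ) : Placement :=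
  let l := p.lo + (p.hi - p.lo) * off / S
  let h := p.lo + (p.hi - p.lo) * (off + sz) / S
  let k := if l * p.k ≤ p.j * N ∧ p.j * N < h * p.k then p.k else (N + (h - l) - 1) / (h - l)
  let j := if l * p.k ≤ p.j * N ∧ p.j * N < h * p.k then p.j else (k * l + N - 1) / N
  ⟨l, h, j, k, p.x + k - j, p.y + k⟩

/-- Invariant of the placement of a vertex whose subtree has `sz` vertices; the last field
bounds the height of the drawing of the subtree. -/
structure Good (N : ℕ) (K : ℝ) (sz : ℕ) (p : Placement) : Prop where
  sz_pos : 1 ≤ sz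
  lo_add : p.lo + sz ^ 2 < p.hi
  hi_le : p.hi ≤ N
  lo_mul : p.lo * p.k ≤ p.j * N
  lt_hi_mul : p.j * N < p.hi * p.k
  k_mul : p.k * (p.hi - p.lo) < N + (p.hi - p.lo)
  k_le : p.k ≤ p.y + 1
  x_le : p.x ≤ p.y
  cost : (p.y : ℝ) + 2 * N * (sz - 1) / (p.hi - p.lo - sz ^ 2) ≤ K

theorem Good.k_pos {N : ℕ} {K : ℝ} {sz : ℕ} {p : Placement} (h : p.Good N K sz) : 1 ≤ p.k := by
  have := h.lt_hi_mul
  rcases Nat.eq_zero_or_pos p.k with h0 | h0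
  · simp [h0] at this
  · exact h0

theorem Good.j_lt {N : ℕ} {K : ℝ} {sz : ℕ} {p : Placement} (h : p.Good N K sz) : p.j < p.k := by
  have h1 := h.lt_hi_mul
  have h2 := Nat.mul_le_mul_right p.k h.hi_le
  by_contra h3
  have h4 := Nat.mul_le_mul_right N (not_lt.1 h3)
  nlinarith

theorem Good.y_le {N : ℕ} {K : ℝ} {sz : ℕ} {p : Placement} (h : p.Good N K sz) :
    (p.y : ℝ) ≤ K := by
  refine le_trans ?_ h.cost
  have h1 : (1 : ℝ) ≤ sz := by exact_mod_cast h.sz_pos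
  have h2 : (p.lo : ℝ) + sz ^ 2 < p.hi := by exact_mod_cast h.lo_add
  have : (0 : ℝ) ≤ 2 * N * (sz - 1) / (p.hi - p.lo - sz ^ 2) :=
    div_nonneg (mul_nonneg (by positivity) (by linarith)) (by linarith)
  linarith

theorem step_j (N : ℕ) (p : Placement) (off sz S : ℕ) :
    let q := step N p off sz S
    q.j = if q.lo * p.k ≤ p.j * N ∧ p.j * N < q.hi * p.k then p.j else
      ((N + (q.hi - q.lo) - 1) / (q.hi - q.lo) * q.lo + N - 1) / N := by
  intro q
  by_cases hc : q.lo * p.k ≤ p.j * N ∧ p.j * N < q.hi * p.k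
  · rw [if_pos hc]
    exact if_pos hc
  · have hk : q.k = (N + (q.hi - q.lo) - 1) / (q.hi - q.lo) := if_neg hc
    rw [if_neg hc, ← hk]
    exact if_neg hc

/-- Call `hi - lo - sz²` the reduced width. Rounding costs a child less than one unit of width, and
replacing `(S + 1)²` by `sz²` compensates for it. So the reduced width per vertex does not decrease
from the parent, counted with `S` vertices, to the child. In particular it stays positive. -/
theorem step_interval {N : ℕ} {p : Placement} {off sz S : ℕ} (hp : p.lo + (S + 1) ^ 2 < p.hi)
    (hsz : 1 ≤ sz) (hS : off + sz ≤ S) :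
    let q := step N p off sz S
    p.lo ≤ q.lo ∧ q.lo + sz ^ 2 < q.hi ∧ q.hi ≤ p.hi ∧
      ((p.hi : ℝ) - p.lo - (S + 1) ^ 2) * sz ≤ (q.hi - q.lo - sz ^ 2) * S := by
  obtain ⟨w, hw⟩ : ∃ w, p.hi = p.lo + w := ⟨p.hi - p.lo, by omega⟩
  have hS0 : 0 < S := by omega
  obtain ⟨a, ha⟩ : ∃ a, a = w * off / S := ⟨_, rfl⟩
  obtain ⟨b, hb⟩ : ∃ b, b = w * (off + sz) / S := ⟨_, rfl⟩
  have hlo : (step N p off sz S).lo = p.lo + a := by simp [step, ha, hw]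
  have hhi : (step N p off sz S).hi = p.lo + b := by simp [step, hb, hw]
  have ha1 : a * S ≤ w * off := by rw [ha]; exact Nat.div_mul_le_self _ _
  have hb1 : w * (off + sz) < (b + 1) * S := by
    have := Nat.lt_div_mul_add (a := w * (off + sz)) hS0
    rw [← hb] at this
    linarith
  have hb2 : b ≤ w := by
    rw [hb]
    apply Nat.div_le_of_le_mul
    rw [mul_comm S]
    exact Nat.mul_le_mul_left _ hS
  have hwS : (S + 1) ^ 2 < w := by omega
  have ha1' : (a : ℝ) * S ≤ w * off := by exact_mod_cast ha1
  have hb1' : (w : ℝ) * (off + sz) < (b + 1) * S := by exact_mod_cast hb1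
  have hszS : (sz : ℝ) ≤ S := by exact_mod_cast (by omega : sz ≤ S)
  have hsz1 : (1 : ℝ) ≤ sz := by exact_mod_cast hsz
  -- The two roundings give `(b - a) * S > w * sz - S`; what remains is `S + sz² * S ≤ (S + 1)² *
  -- sz`, where `1 ≤ sz ≤ S`.
  have hD : ((w : ℝ) - (S + 1) ^ 2) * sz ≤ ((b : ℝ) - a - sz ^ 2) * S := by
    nlinarith [mul_nonneg (by positivity : (0 : ℝ) ≤ sz * S) (sub_nonneg.2 hszS),
      mul_nonneg (by positivity : (0 : ℝ) ≤ S) (sub_nonneg.2 hsz1)]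
  intro q
  change q.lo = _ at hlo
  change q.hi = _ at hhi
  refine ⟨by omega, ?_, by omega, ?_⟩
  · rw [hlo, hhi]
    have h1 : (0 : ℝ) < ((w : ℝ) - (S + 1) ^ 2) * sz := by
      have : ((S : ℝ) + 1) ^ 2 < w := by exact_mod_cast hwS
      exact mul_pos (by linarith) (by linarith)
    have h2 : (0 : ℝ) < (b : ℝ) - a - sz ^ 2 :=
      pos_of_mul_pos_left (lt_of_lt_of_le h1 hD) (by positivity)
    have h3 : (a : ℝ) + sz ^ 2 < b := by linarith
    have h4 : a + sz ^ 2 < b := by exact_mod_cast h3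
    omega
  · rw [hlo, hhi, hw]
    push_cast
    linarith

/-- For `k = ⌈N / (h - l)⌉` the half-open interval from `k * l / N` to `k * h / N` has length at
least 1, so it contains an integer, the least one being `j = ⌈k * l / N⌉`. -/
theorem step_vector {N : ℕ} {p : Placement} {off sz S : ℕ} (hN : 0 < N)
    (hlt : (step N p off sz S).lo < (step N p off sz S).hi) :
    let q := step N p off sz S
    q.lo * q.k ≤ q.j * N ∧ q.j * N < q.hi * q.k ∧
      ((q.k = p.k ∧ q.j = p.j) ∨ q.k * (q.hi - q.lo) < N + (q.hi - q.lo)) ∧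
      (q.lo * p.k ≤ p.j * N → p.j * N < q.hi * p.k → q.k = p.k ∧ q.j = p.j) := by
  intro q
  set l := q.lo with hl
  set h := q.hi with hh
  by_cases hc : l * p.k ≤ p.j * N ∧ p.j * N < h * p.k
  · have hk : q.k = p.k := if_pos hc
    have hj : q.j = p.j := if_pos hc
    rw [hk, hj]
    exact ⟨hc.1, hc.2, Or.inl ⟨rfl, rfl⟩, fun _ _ => ⟨rfl, rfl⟩⟩
  · have hk : q.k = (N + (h - l) - 1) / (h - l) := if_neg hc
    have hj : q.j = (q.k * l + N - 1) / N := if_neg hc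
    obtain ⟨w, hw⟩ : ∃ w, h = l + w := ⟨h - l, by omega⟩
    have hw' : h - l = w := by omega
    have hw0 : 0 < w := by omega
    rw [hw'] at hk ⊢
    have h1 : q.k * w ≤ N + w - 1 := by rw [hk]; exact Nat.div_mul_le_self _ _
    have h2 : N ≤ q.k * w := by
      have := Nat.lt_div_mul_add (a := N + w - 1) hw0
      rw [← hk] at this
      omega
    have h3 : q.j * N ≤ q.k * l + N - 1 := by rw [hj]; exact Nat.div_mul_le_self _ _
    have h4 : q.k * l ≤ q.j * N := by
      have := Nat.lt_div_mul_add (a := q.k * l + N - 1) hN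
      rw [← hj] at this
      omega
    refine ⟨by rwa [mul_comm], ?_, Or.inr (by omega), fun h5 h6 => absurd ⟨h5, h6⟩ hc⟩
    rw [hw, add_mul, mul_comm l, mul_comm w]
    omega

/-- The new edge has height at most `2N / D'`, with `D'` the reduced width of the child. Added to
the remaining `2N(sz - 1) / D'` this makes `2N sz / D'`, which by `step_interval` is at most the
share `2N S / D` in the potential of the parent, whose reduced width is `D`. -/
theorem Good.step {N : ℕ} {K : ℝ} {p : Placement} {off sz S : ℕ} (hp : p.Good N K (S + 1))
    (hsz : 1 ≤ sz) (hS : off + sz ≤ S) : (step N p off sz S).Good N K sz := by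
  obtain ⟨h1, h2, h3, h4⟩ := step_interval (N := N) hp.lo_add hsz hS
  have hN : 0 < N := by have := hp.lo_add; have := hp.hi_le; omega
  obtain ⟨h5, h6, h7, -⟩ := step_vector (N := N) (p := p) (off := off) (sz := sz) (S := S) hN
    (by omega)
  set q := Placement.step N p off sz S with hq
  have hy : q.y = p.y + q.k := rfl
  have hx : q.x = p.x + q.k - q.j := rfl
  -- An inherited `k` satisfied the bound for a wider interval. Since `k ≥ 1`, narrowing the
  -- interval lowers the left side at least as much as the right.
  have hk : q.k * (q.hi - q.lo) < N + (q.hi - q.lo) := by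
    rcases h7 with ⟨h7, -⟩ | h7
    · have hk := hp.k_mul
      have hkp := hp.k_pos
      rw [h7]
      obtain ⟨e, he⟩ : ∃ e, p.hi - p.lo = q.hi - q.lo + e :=
        ⟨(p.hi - p.lo) - (q.hi - q.lo), by omega⟩
      rw [he, mul_add] at hk
      have := Nat.mul_le_mul_right e hkp
      omega
    · exact h7
  refine ⟨hsz, h2, h3.trans hp.hi_le, h5, h6, hk, by omega, ?_, ?_⟩
  · have := hp.x_le
    omega
  · have hD : (0 : ℝ) < (p.hi : ℝ) - p.lo - (S + 1) ^ 2 := by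
      have : (p.lo : ℝ) + (S + 1) ^ 2 < p.hi := by exact_mod_cast hp.lo_add
      linarith
    have hD' : (0 : ℝ) < (q.hi : ℝ) - q.lo - sz ^ 2 := by
      have : (q.lo : ℝ) + sz ^ 2 < q.hi := by exact_mod_cast h2
      linarith
    have hqw : q.lo < q.hi := by omega
    have hw : (0 : ℝ) < (q.hi : ℝ) - q.lo := by
      have : (q.lo : ℝ) < q.hi := by exact_mod_cast hqw
      linarith
    have hwN : (q.hi : ℝ) - q.lo ≤ N := by
      have : (q.hi : ℝ) ≤ N := by exact_mod_cast h3.trans hp.hi_le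
      have : (0 : ℝ) ≤ q.lo := by positivity
      linarith
    have hkr : (q.k : ℝ) * (q.hi - q.lo) < N + (q.hi - q.lo) := by
      have : ((q.k * (q.hi - q.lo) : ℕ) : ℝ) < ((N + (q.hi - q.lo) : ℕ) : ℝ) := by
        exact_mod_cast hk
      push_cast [hqw.le] at this
      exact this
    have hk2 : (q.k : ℝ) ≤ 2 * N / (q.hi - q.lo - sz ^ 2) := by
      rw [le_div_iff₀ hD']
      have : (q.k : ℝ) * (q.hi - q.lo - sz ^ 2) ≤ q.k * (q.hi - q.lo) := by
        have : (0 : ℝ) ≤ q.k * sz ^ 2 := by positivity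
        linarith
      linarith
    have hdiv : 2 * N * (sz : ℝ) / (q.hi - q.lo - sz ^ 2) ≤
        2 * N * S / (p.hi - p.lo - (S + 1) ^ 2) := by
      rw [div_le_div_iff₀ hD' hD]
      have := mul_le_mul_of_nonneg_left h4 (by positivity : (0 : ℝ) ≤ 2 * N)
      linarith
    have hc := hp.cost
    push_cast at hc
    have hsplit : 2 * N * ((sz : ℝ) - 1) / (q.hi - q.lo - sz ^ 2) =
        2 * N * (sz : ℝ) / (q.hi - q.lo - sz ^ 2) - 2 * N / (q.hi - q.lo - sz ^ 2) := by
      ring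
    have e1 : 2 * N * ((S : ℝ) + 1 - 1) / (p.hi - p.lo - (S + 1) ^ 2) =
        2 * N * S / (p.hi - p.lo - (S + 1) ^ 2) := by
      ring_nf
    rw [hsplit, hy]
    push_cast
    rw [e1] at hc
    linarith

/-- Placement of the root. -/
def root (N : ℕ) : Placement := ⟨0, N, 0, 1, 0, 0⟩

/-- Bound on the height of the drawing. -/
noncomputable def height (n : ℕ) : ℝ :=
  2 * (n ^ 3 + 1) * (n - 1) / ((n ^ 3 + 1) - n ^ 2)

/-- The root carries a fictitious entering vector `(1, 1)` although it sits at height 0; this is why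
`Good.k_le` allows `y + 1`. -/
theorem root_good {n : ℕ} (hn : 1 ≤ n) : (root (n ^ 3 + 1)).Good (n ^ 3 + 1) (height n) n := by
  have : n ^ 2 ≤ n ^ 3 := Nat.pow_le_pow_right hn (by norm_num)
  refine ⟨hn, ?_, le_rfl, ?_, ?_, ?_, ?_, ?_, ?_⟩ <;> simp [root, height]
  omega

/-- Clearing denominators reduces this to `n³ < N`, which explains the choice `N = n³ + 1`. -/
theorem height_lt {n : ℕ} (hn : 1 ≤ n) : height n < 2 * n := by
  have h1 : (n : ℝ) ^ 2 ≤ n ^ 3 := by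
    exact_mod_cast Nat.pow_le_pow_right hn (by norm_num)
  rw [height, div_lt_iff₀ (by linarith)]
  nlinarith

theorem Good.y_lt {N n : ℕ} {sz : ℕ} {p : Placement} (hn : 1 ≤ n) (h : p.Good N (height n) sz) :
    p.y < 2 * n := by
  have := h.y_le.trans_lt (height_lt hn)
  exact_mod_cast this

end Placement
end TreeDrawing

namespace TreeDrawing

/-! ### A weakest-precondition calculus that counts steps. -/

/-- Started in `s` with `τ` steps elapsed, `p` halts, and `Q` holds of the total number of
elapsed steps and the final configuration. -/
def WP (W : ℕ) (p : Program) (τ : ℕ) (s : Config) (Q : ℕ → Config → Prop) : Prop :=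
  ∃ t s', Runs W p s t s' ∧ Q (τ + t) s'

/-- Sequential composition of a list of programs. -/
def Program.block (l : List Program) : Program := l.foldr .seq .skip

namespace Config

@[simp] theorem setReg_mem (s : Config) (d x : ℕ) : (s.setReg d x).mem = s.mem := rfl

@[simp] theorem setMem_reg (s : Config) (a x : ℕ) : (s.setMem a x).reg = s.reg := rfl

theorem setReg_reg (s : Config) (d x i : ℕ) :
    (s.setReg d x).reg i = if i = d then x else s.reg i := by
  simp [setReg, Function.update_apply]

theorem setMem_mem (s : Config) (a x : ℕ) :
    (s.setMem a x).mem = Function.update s.mem a x := rfl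

theorem setReg_reg_of_ne (s : Config) {d x i : ℕ} (h : i ≠ d) :
    (s.setReg d x).reg i = s.reg i := by
  simp [setReg_reg, h]

end Config

section WP

variable {W τ : ℕ} {s : Config} {Q : ℕ → Config → Prop}

theorem WP.mono {p : Program} {Q' : ℕ → Config → Prop} (h : WP W p τ s Q)
    (hQ : ∀ τ s, Q τ s → Q' τ s) : WP W p τ s Q' := by
  obtain ⟨t, s', hr, hq⟩ := h
  exact ⟨t, s', hr, hQ _ _ hq⟩

theorem wp_block_nil (h : Q (τ + 1) s) : WP W (.block []) τ s Q :=
  ⟨1, s, .skip s, h⟩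

theorem wp_block_cons {p : Program} {l : List Program}
    (h : WP W p τ s fun τ' s' => WP W (.block l) τ' s' Q) : WP W (.block (p :: l)) τ s Q := by
  obtain ⟨t, s', hr, t', s'', hr', hq⟩ := h
  exact ⟨t + t', s'', .seq hr hr', by rwa [← add_assoc]⟩

theorem wp_const {d c : ℕ} {l : List Program} (h : c < W)
    (hl : WP W (.block l) (τ + 1) (s.setReg d c) Q) :
    WP W (.block (.const d c :: l)) τ s Q :=
  wp_block_cons ⟨1, _, .const s d c h, hl⟩

theorem wp_arith {o : Op} {d a b x : ℕ} {l : List Program}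
    (hx : o.eval (s.reg a) (s.reg b) = x) (h : x < W)
    (hl : WP W (.block l) (τ + 1) (s.setReg d x) Q) :
    WP W (.block (.arith o d a b :: l)) τ s Q := by
  subst hx
  exact wp_block_cons ⟨1, _, .arith s o d a b h, hl⟩

theorem wp_load {d a x : ℕ} {l : List Program} (hx : s.mem (s.reg a) = x) (h : x < W)
    (hl : WP W (.block l) (τ + 1) (s.setReg d x) Q) :
    WP W (.block (.load d a :: l)) τ s Q := by
  subst hx
  exact wp_block_cons ⟨1, _, .load s d a h, hl⟩

theorem wp_store {a b x y : ℕ} {l : List Program} (hx : s.reg a = x) (hy : s.reg b = y)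
    (h : y < W) (hl : WP W (.block l) (τ + 1) (s.setMem x y) Q) :
    WP W (.block (.store a b :: l)) τ s Q := by
  subst hx hy
  exact wp_block_cons ⟨1, _, .store s a b h, hl⟩

theorem wp_ifLt {a b : ℕ} {p q : Program} (ht : s.reg a < s.reg b → WP W p (τ + 1) s Q)
    (hf : ¬ s.reg a < s.reg b → WP W q (τ + 1) s Q) : WP W (.ifLt a b p q) τ s Q := by
  by_cases h : s.reg a < s.reg b
  · obtain ⟨t, s', hr, hq⟩ := ht h
    exact ⟨t + 1, s', .ifTrue h hr, by rwa [add_comm t, ← add_assoc]⟩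
  · obtain ⟨t, s', hr, hq⟩ := hf h
    exact ⟨t + 1, s', .ifFalse h hr, by rwa [add_comm t, ← add_assoc]⟩

/-- A loop with `m` iterations; `I i τ s` is the invariant before iteration `i`, when `τ` steps
have elapsed. -/
theorem wp_whileLt {a b : ℕ} {p : Program} (I : ℕ → ℕ → Config → Prop) (m : ℕ)
    (step : ∀ i < m, ∀ τ s, I i τ s → s.reg a < s.reg b ∧
      WP W p τ s fun τ' s' => I (i + 1) (τ' + 1) s')
    (start : I 0 τ s) (finish : ∀ τ s, I m τ s → ¬ s.reg a < s.reg b ∧ Q (τ + 1) s) :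
    WP W (.whileLt a b p) τ s Q := by
  suffices h : ∀ k i, i + k = m → ∀ τ s, I i τ s → WP W (.whileLt a b p) τ s Q from
    h m 0 (zero_add m) τ s start
  intro k
  induction k with
  | zero =>
    intro i hi τ s hI
    obtain rfl : i = m := hi
    obtain ⟨h, hq⟩ := finish τ s hI
    exact ⟨1, s, .whileFalse h, hq⟩
  | succ k ih =>
    intro i hi τ s hI
    obtain ⟨h, t, s', hr, hI'⟩ := step i (by omega) τ s hI
    obtain ⟨t', s'', hr', hq⟩ := ih (i + 1) (by omega) _ s' hI'
    refine ⟨t + t' + 1, s'', .whileTrue h hr hr', ?_⟩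
    rwa [show τ + (t + t' + 1) = τ + t + 1 + t' by omega]

end WP

/-! ### Program for the placement of one child. -/

/-- Choose the vector of the entering edge: inherit that of the parent if it lies in the
interval of the child. -/
def chooseVector : Program :=
  .ifLt 27 36 (.block fresh) (.ifLt 27 37
    (.block [.arith .add 34 24 2, .arith .add 35 23 2]) (.block fresh))
where
  fresh : List Program :=
    [.arith .sub 36 33 32, .arith .add 34 4 36, .arith .sub 34 34 3, .arith .div 34 34 36,
     .arith .mul 35 34 32, .arith .add 35 35 4, .arith .sub 35 35 3, .arith .div 35 35 4]

/-- Place the child in register `30`, and advance the offset in register `29`. -/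
def placeChild : Program := .block
  [.arith .add 31 7 30, .load 31 31,
   .arith .mul 32 22 29, .arith .div 32 32 20, .arith .add 32 21 32,
   .arith .add 29 29 31,
   .arith .mul 33 22 29, .arith .div 33 33 20, .arith .add 33 21 33,
   .arith .mul 36 32 24, .arith .mul 37 33 24,
   chooseVector,
   .arith .add 31 8 30, .store 31 32,
   .arith .add 31 9 30, .store 31 33,
   .arith .add 31 10 30, .store 31 35,
   .arith .add 31 11 30, .store 31 34,
   .arith .add 36 25 34, .arith .sub 36 36 35, .arith .add 31 12 30, .store 31 36,
   .arith .add 36 26 34, .arith .add 31 13 30, .store 31 36]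

theorem wp_chooseVector {W τ : ℕ} {s : Config} {Q : ℕ → Config → Prop} {N l h j k B : ℕ}
    (h2 : s.reg 2 = 0) (h3 : s.reg 3 = 1) (h4 : s.reg 4 = N) (h23 : s.reg 23 = j)
    (h24 : s.reg 24 = k) (h27 : s.reg 27 = j * N) (h32 : s.reg 32 = l) (h33 : s.reg 33 = h)
    (h36 : s.reg 36 = l * k) (h37 : s.reg 37 = h * k) (hN : 0 < N) (hlh : l < h) (hhN : h ≤ N)
    (hj : j ≤ B) (hk : k ≤ B) (hNB : 2 * N ≤ B) (hW : 3 * (B * B) + 3 * B < W)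
    (hQ : ∀ τ' s', τ' ≤ τ + 12 → (∀ i < 34, s'.reg i = s.reg i) → s'.mem = s.mem →
      s'.reg 34 = (if l * k ≤ j * N ∧ j * N < h * k then k else (N + (h - l) - 1) / (h - l)) →
      s'.reg 35 = (if l * k ≤ j * N ∧ j * N < h * k then j else
        ((N + (h - l) - 1) / (h - l) * l + N - 1) / N) → Q τ' s') :
    WP W chooseVector τ s Q := by
  -- Quotients are bounded by their numerators: the first is below `2 * N ≤ B`, so every product
  -- stays within `B * B`.
  have hd : (N + (h - l) - 1) / (h - l) ≤ N + (h - l) - 1 := Nat.div_le_self _ _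
  have hdB : (N + (h - l) - 1) / (h - l) ≤ B := by omega
  have hm : (N + (h - l) - 1) / (h - l) * l ≤ B * B := Nat.mul_le_mul hdB (by omega)
  have hd' : ((N + (h - l) - 1) / (h - l) * l + N - 1) / N ≤
    (N + (h - l) - 1) / (h - l) * l + N - 1 := Nat.div_le_self _ _
  have fresh : ∀ τ', τ' ≤ τ + 2 → ¬ (l * k ≤ j * N ∧ j * N < h * k) →
      WP W (.block chooseVector.fresh) τ' s Q := by
    intro τ' hτ' hc
    unfold chooseVector.fresh
    repeat'
      first
      | (refine wp_arith (by simp only [Config.setReg_reg, Op.eval, Nat.reduceEqDiff, if_true,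
           if_false, h3, h4, h32, h33] <;> rfl) ?_ ?_
         · omega)
      | apply wp_block_nil
    apply hQ
    · omega
    · intro i hi
      repeat rw [Config.setReg_reg_of_ne _ (by omega)]
    · rfl
    · simp only [Config.setReg_reg, Op.eval, Nat.reduceEqDiff, if_true, if_false,
             h3, h4, h32, h33, if_neg hc]
    · simp only [Config.setReg_reg, Op.eval, Nat.reduceEqDiff, if_true, if_false,
             h3, h4, h32, h33, if_neg hc]
  refine wp_ifLt (fun h1 => fresh _ (by omega) (by omega)) fun h1 => wp_ifLt (fun h1' => ?_)
    fun h1' => fresh _ (by omega) (by omega)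
  rw [h27, h36] at h1
  rw [h27, h37] at h1'
  have hc : l * k ≤ j * N ∧ j * N < h * k := by omega
  refine wp_arith (by simp only [Op.eval, h2, h24] <;> rfl) (by omega) ?_
  refine wp_arith (by simp only [Config.setReg_reg, Op.eval, Nat.reduceEqDiff, if_false, h2, h23] <;> rfl)
    (by omega) ?_
  refine wp_block_nil (hQ _ _ (by omega) ?_ rfl ?_ ?_)
  · intro i hi
    repeat rw [Config.setReg_reg_of_ne _ (by omega)]
  · simp only [Config.setReg_reg, Op.eval, Nat.reduceEqDiff, if_true, if_false, h2, h24, if_pos hc, add_zero]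
  · simp only [Config.setReg_reg, Op.eval, Nat.reduceEqDiff, if_true, if_false, h2, h23, if_pos hc, add_zero]
end TreeDrawing

namespace TreeDrawing

/-- Contents of the registers that are constant during the placement of the vertices. -/
structure ConstRegs (n N : ℕ) (R : ℕ → ℕ) : Prop where
  r0 : R 0 = n
  r2 : R 2 = 0
  r3 : R 3 = 1
  r4 : R 4 = N
  -- Registers 5 to 13 hold the bases of the arrays behind the input: parents, search order, sizes,
  -- and then the fields `lo`, `hi`, `j`, `k`, `x`, `y` of the placements.
  r5 : R 5 = 3 * n
  r6 : R 6 = 4 * n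
  r7 : R 7 = 5 * n
  r8 : R 8 = 6 * n
  r9 : R 9 = 7 * n
  r10 : R 10 = 8 * n
  r11 : R 11 = 9 * n
  r12 : R 12 = 10 * n
  r13 : R 13 = 11 * n

/-- Contents of the registers that describe the vertex whose children are being placed. -/
structure VertexRegs (N S : ℕ) (p : Placement) (R : ℕ → ℕ) : Prop where
  r20 : R 20 = S
  r21 : R 21 = p.lo
  r22 : R 22 = p.hi - p.lo
  r23 : R 23 = p.j
  r24 : R 24 = p.k
  r25 : R 25 = p.x
  r26 : R 26 = p.y
  r27 : R 27 = p.j * N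

/-- The memory after storing the placement `q` of vertex `w`. -/
def storePlacement (n w : ℕ) (q : Placement) (M : ℕ → ℕ) : ℕ → ℕ :=
  Function.update (Function.update (Function.update (Function.update (Function.update
    (Function.update M (6 * n + w) q.lo) (7 * n + w) q.hi) (8 * n + w) q.j) (9 * n + w) q.k)
    (10 * n + w) q.x) (11 * n + w) q.y

theorem wp_placeChild {W τ : ℕ} {s : Config} {Q : ℕ → Config → Prop} {n N S off sz w B : ℕ}
    {p : Placement} (hc : ConstRegs n N s.reg) (hv : VertexRegs N S p s.reg)
    (h29 : s.reg 29 = off) (h30 : s.reg 30 = w) (hsz : s.mem (5 * n + w) = sz)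
    (hw : w < n) (hB : 12 * n ≤ B) (hNB : 2 * N ≤ B) (hS : off + sz ≤ S) (hSB : S ≤ B)
    (hhi : p.hi ≤ N) (hlo : p.lo < p.hi) (hj : p.j ≤ B) (hk : p.k ≤ B) (hx : p.x ≤ B)
    (hy : p.y ≤ B)
    (hq : (p.step N off sz S).lo < (p.step N off sz S).hi) (hqhi : (p.step N off sz S).hi ≤ N)
    (hqk : (p.step N off sz S).k ≤ B) (hqj : (p.step N off sz S).j ≤ B)
    (hW : 3 * (B * B) + 3 * B < W)
    (hQ : ∀ τ' s', τ' ≤ τ + 40 → (∀ i < 29, s'.reg i = s.reg i) → s'.reg 29 = off + sz →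
      s'.mem = storePlacement n w (p.step N off sz S) s.mem → Q τ' s') :
    WP W placeChild τ s Q := by
  obtain ⟨q, hqdef⟩ : ∃ q, q = p.step N off sz S := ⟨_, rfl⟩
  have hqj' := p.step_j N off sz S
  rw [← hqdef] at hq hqhi hqk hqj hqj' hQ
  obtain ⟨d, hd⟩ : ∃ d, d = p.hi - p.lo := ⟨_, rfl⟩
  have hqlo : q.lo = p.lo + d * off / S := by rw [hqdef, hd]; rfl
  have hqh : q.hi = p.lo + d * (off + sz) / S := by rw [hqdef, hd]; rfl
  have h22 := hv.r22
  rw [← hd] at h22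
  have hdB : d ≤ B := by omega
  have m1 : d * off ≤ B * B := Nat.mul_le_mul hdB (by omega)
  have m2 : d * (off + sz) ≤ B * B := Nat.mul_le_mul hdB (by omega)
  have m3 : q.lo * p.k ≤ B * B := Nat.mul_le_mul (by omega) hk
  have m4 : q.hi * p.k ≤ B * B := Nat.mul_le_mul (by omega) hk
  have d1 := Nat.div_le_self (d * off) S
  have d2 := Nat.div_le_self (d * (off + sz)) S
  have hB1 : B ≤ B * B := Nat.le_mul_self B
  unfold placeChild
  repeat'
    first
    | (refine wp_arith (by simp only [Config.setReg_reg, Op.eval, Nat.reduceEqDiff, if_true,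
         if_false, hc.r7, h30, h22, h29, hv.r20, hv.r21, hv.r24, ← hqlo, ← hqh] <;> rfl) ?_ ?_
       · omega)
    | (refine wp_load (by simp only [Config.setReg_reg, if_true, Config.setReg_mem, hsz] <;> rfl)
         ?_ ?_
       · omega)
  apply wp_block_cons
  refine wp_chooseVector (N := N) (l := q.lo) (h := q.hi) (j := p.j) (k := p.k) (B := B)
    ?_ ?_ ?_ ?_ ?_ ?_ ?_ ?_ ?_ ?_ (by omega) hq hqhi hj hk hNB hW ?_
  -- The eleventh goal is the continuation after the choice of the vector; the others only look up
  -- registers.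
  on_goal 11 =>
    intro τ' s' hτ' hreg hmem h34 h35
    replace h34 : s'.reg 34 = q.k := by rw [h34, hqdef]; rfl
    replace h35 : s'.reg 35 = q.j := by rw [h35, hqj']
    simp only [Config.setReg_reg] at hreg
    simp only [Config.setReg_mem] at hmem
    have hr : ∀ i < 29, s'.reg i = s.reg i := by
      intro i hi
      rw [hreg i (by omega)]
      repeat rw [if_neg (by omega)]
    have k8 := (hr 8 (by omega)).trans hc.r8
    have k9 := (hr 9 (by omega)).trans hc.r9
    have k10 := (hr 10 (by omega)).trans hc.r10
    have k11 := (hr 11 (by omega)).trans hc.r11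
    have k12 := (hr 12 (by omega)).trans hc.r12
    have k13 := (hr 13 (by omega)).trans hc.r13
    have k25 := (hr 25 (by omega)).trans hv.r25
    have k26 := (hr 26 (by omega)).trans hv.r26
    have k30 := (hreg 30 (by omega)).trans h30
    have k29 : s'.reg 29 = off + sz := hreg 29 (by omega)
    have k32 : s'.reg 32 = q.lo := hreg 32 (by omega)
    have k33 : s'.reg 33 = q.hi := hreg 33 (by omega)
    have hqx : p.x + q.k - q.j = q.x := by rw [hqdef]; rfl
    have hqy : p.y + q.k = q.y := by rw [hqdef]; rfl
    repeat'
      first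
      | (refine wp_arith (by simp only [Config.setReg_reg, Op.eval, Nat.reduceEqDiff, if_true,
           if_false, Config.setMem_reg, k8, k9, k10, k11, k12, k13, k25, k26, k30, h34, h35, hqx,
           hqy] <;> rfl) ?_ ?_
         · omega)
      | (refine wp_store (by simp only [Config.setReg_reg, if_true] <;> rfl)
           (by simp only [Config.setReg_reg, Nat.reduceEqDiff, if_true, if_false,
             Config.setMem_reg, h34, h35, k32, k33] <;> rfl) ?_ ?_
         · omega)
      | apply wp_block_nil
    apply hQ
    · omega
    · intro i hi
      simp only [Config.setReg_reg, Config.setMem_reg]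
      repeat rw [if_neg (by omega)]
      exact hr i hi
    · simp only [Config.setReg_reg, Config.setMem_reg, Nat.reduceEqDiff, if_false, k29]
    · simp only [Config.setReg_mem, Config.setMem_mem, hmem]
      rfl
  all_goals
    simp only [Config.setReg_reg, Nat.reduceEqDiff, if_true, if_false, hv.r23, hv.r24, hv.r27,
      hc.r2, hc.r3, hc.r4]
end TreeDrawing

namespace TreeDrawing

/-! ### The adjacency arrays in memory. -/

section Input

variable {n : ℕ} (ord : Fin n → List (Fin n))

/-- The adjacency arrays are at the beginning of the memory `M`. -/
structure InputMem (M : ℕ → ℕ) : Prop where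
  start : ∀ u : Fin n, M u = listAddr ord u
  finish : ∀ u : Fin n, M (u + 1) = listAddr ord u + (ord u).length
  entry : ∀ u : Fin n, ∀ i, (h : i < (ord u).length) → M (listAddr ord u + i) = (ord u)[i]

theorem listAddr_succ (u : Fin n) :
    listAddr ord (u + 1) = listAddr ord u + (ord u).length := by
  have hu : (u : ℕ) < (List.finRange n).length := by simp
  unfold listAddr
  rw [List.take_succ_eq_append_getElem hu]
  simp [add_assoc]

theorem listAddr_add_length_le (u : Fin n) :
    listAddr ord u + (ord u).length ≤ n + 1 + ∑ v, (ord v).length := by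
  rw [← listAddr_succ]
  unfold listAddr
  have h1 : ∑ v, (ord v).length = ((List.finRange n).map fun v => (ord v).length).sum := by
    rw [← List.ofFn_eq_map, List.sum_ofFn]
  rw [h1]
  gcongr
  apply List.Sublist.sum_le_sum ((List.take_sublist _ _).map _)
  simp

theorem inputWords_eq : inputWords ord = (List.range (n + 1)).map (listAddr ord) ++
    (List.finRange n).flatMap fun v => (ord v).map Fin.val := by
  simp [inputWords, List.map_eq_flatMap]

theorem inputMem_inputConfig (r : Fin n) : InputMem ord (inputConfig r ord).mem := by
  have h1 : ∀ i < n + 1, (inputConfig r ord).mem i = listAddr ord i := by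
    intro i hi
    change (inputWords ord).getD i 0 = _
    rw [inputWords_eq, List.getD_append _ _ _ _ (by simpa using hi)]
    rw [List.getD_eq_getElem _ _ (by simpa using hi)]
    simp
  refine ⟨fun u => h1 u (by omega), fun u => ?_, fun u i hi => ?_⟩
  · rw [h1 _ (by omega), listAddr_succ]
  · change (inputWords ord).getD _ 0 = _
    rw [inputWords_eq, List.getD_append_right _ _ _ _ (by simp [listAddr]; omega)]
    have hu : (u : ℕ) < (List.finRange n).length := by simp
    have hsplit := List.take_append_drop (u : ℕ) (List.finRange n)
    rw [List.drop_eq_getElem_cons hu, List.getElem_finRange] at hsplit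
    have hidx : listAddr ord u + i - ((List.range (n + 1)).map (listAddr ord)).length =
        (((List.finRange n).take u).flatMap fun v => (ord v).map Fin.val).length + i := by
      simp only [listAddr, List.length_map, List.length_range, List.length_flatMap]

      omega
    rw [hidx]
    conv_lhs => enter [1]; rw [← hsplit]
    rw [List.flatMap_append, List.getD_append_right _ _ _ _ (by omega), Nat.add_sub_cancel_left,
      List.flatMap_cons, List.getD_append _ _ _ _ (by simpa using hi),
      List.getD_eq_getElem _ _ (by simpa using hi)]
    simp

/-- By `hsum` the arrays end below address `3 * n`, so writes to the working arrays leave them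
intact. -/
theorem InputMem.congr {ord : Fin n → List (Fin n)} {M M' : ℕ → ℕ} (h : InputMem ord M)
    (hsum : ∑ u, (ord u).length + 2 = 2 * n) (hM : ∀ i < 3 * n, M' i = M i) :
    InputMem ord M' := by
  refine ⟨fun u => ?_, fun u => ?_, fun u i hi => ?_⟩
  · rw [hM _ (by omega), h.start]
  · rw [hM _ (by omega), h.finish]
  · have := listAddr_add_length_le ord u
    rw [hM _ (by omega), h.entry]

end Input

/-! ### Breadth-first order, independently of the machine. -/

section SearchList

variable {n : ℕ} {r : Fin n} {ord : Fin n → List (Fin n)} {par : Fin n → Fin n}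
  {depth : Fin n → ℕ}

/-- The list of vertices found by a breadth-first search that has processed the first `i` of
them. -/
structure SearchList (r : Fin n) (par : Fin n → Fin n) (i : ℕ) (L : List (Fin n)) : Prop where
  nodup : L.Nodup
  root_mem : r ∈ L
  le_length : i ≤ L.length
  parent_before : ∀ j, (h : j < L.length) → L[j] = r ∨ par L[j] ∈ L.take j
  mem_iff : ∀ w, w ≠ r → (w ∈ L ↔ par w ∈ L.take i)

theorem searchList_singleton (r : Fin n) (par : Fin n → Fin n) : SearchList r par 0 [r] := by
  refine ⟨by simp, by simp, by simp, ?_, ?_⟩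
  · intro j h
    simp only [List.length_singleton, Nat.lt_one_iff] at h
    simp [h]
  · intro w hw
    simp [hw]

theorem getElem_notMem_take {L : List (Fin n)} (hL : L.Nodup) {i : ℕ} (hi : i < L.length) :
    L[i] ∉ L.take i := by
  intro hm
  obtain ⟨j, hj, he⟩ := List.mem_take_iff_getElem.1 hm
  have := (hL.getElem_inj_iff).1 he
  omega

/-- When every vertex found has been processed, the set of found vertices contains the root and is
closed under taking children. -/
theorem SearchList.forall_mem {L : List (Fin n)} {i : ℕ} (hr : IsRooting r ord par depth)
    (h : SearchList r par i L) (hi : L.length ≤ i) (v : Fin n) : v ∈ L := by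
  refine hr.induction h.root_mem (fun v hv hp => ?_) v
  rw [h.mem_iff v hv]
  rwa [List.take_of_length_le hi]

theorem length_eq_of_forall_mem {L : List (Fin n)} (hL : L.Nodup) (h : ∀ v, v ∈ L) :
    L.length = n := by
  rw [← List.toFinset_card_of_nodup hL, (Finset.eq_univ_iff_forall.2 (by simpa using h) :
    L.toFinset = Finset.univ), Finset.card_fin]

theorem length_le_of_nodup {L : List (Fin n)} (hL : L.Nodup) : L.length ≤ n := by
  simpa using hL.length_le_card

/-- The queue cannot run empty early: if all vertices found were processed, there would be `n` of
them. -/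
theorem SearchList.lt_length {L : List (Fin n)} (hr : IsRooting r ord par depth) {i : ℕ}
    (h : SearchList r par i L) (hi : i < n) : i < L.length := by
  refine lt_of_le_of_ne h.le_length ?_
  rintro rfl
  have := length_eq_of_forall_mem h.nodup (h.forall_mem hr le_rfl)
  omega

theorem IsRooting.mem_filter_ord (hr : IsRooting r ord par depth) {u w : Fin n} :
    w ∈ (ord u).filter (· ≠ par u) ↔ w ≠ r ∧ par w = u := by
  rw [List.mem_filter, decide_eq_true_iff, hr.mem_ord_of_mem_childList, hr.mem_childList]

/-- The appended children are new: a child of `L[i]` already in `L` would have its parent among the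
first `i` entries, contradicting the absence of repetitions. -/
theorem SearchList.succ {L : List (Fin n)} (hr : IsRooting r ord par depth) {i : ℕ}
    (h : SearchList r par i L) (hi : i < L.length) :
    SearchList r par (i + 1) (L ++ (ord L[i]).filter (· ≠ par L[i])) := by
  have hC := fun w => hr.mem_filter_ord (u := L[i]) (w := w)
  have htake : ∀ j, j ≤ L.length → ∀ C : List (Fin n), (L ++ C).take j = L.take j := by
    intro j hj C
    exact List.take_append_of_le_length hj
  refine ⟨?_, ?_, ?_, ?_, ?_⟩
  · refine List.Nodup.append h.nodup ((hr.nodup_ord _).filter _) ?_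
    intro w hw hw'
    obtain ⟨h1, h2⟩ := (hC w).1 hw'
    have := (h.mem_iff w h1).1 hw
    rw [h2] at this
    exact getElem_notMem_take h.nodup hi this
  · exact List.mem_append_left _ h.root_mem
  · rw [List.length_append]
    omega
  · intro j hj
    by_cases hjL : j < L.length
    · rw [List.getElem_append_left hjL, htake j hjL.le]
      exact h.parent_before j hjL
    · right
      rw [List.getElem_append_right (by omega)]
      have hm := List.getElem_mem (l := (ord L[i]).filter (· ≠ par L[i])) (n := j - L.length)
        (by rw [List.length_append] at hj; omega)
      rw [((hC _).1 hm).2]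
      rw [List.mem_take_iff_getElem]
      exact ⟨i, by rw [List.length_append] at *; omega, List.getElem_append_left hi⟩
  · intro w hw
    rw [htake _ hi, List.take_succ_eq_append_getElem hi, List.mem_append, List.mem_append,
      h.mem_iff w hw, hC]
    simp [hw]

end SearchList

end TreeDrawing

namespace TreeDrawing

variable {n : ℕ} {r : Fin n} {ord : Fin n → List (Fin n)} {par : Fin n → Fin n}
  {depth : Fin n → ℕ}

/-! ### Scanning an adjacency list. -/

/-- Load vertex number `R[14]` of the search order, its parent and the bounds of its adjacency
list. -/
def fetch : Program := .block
  [.arith .add 31 6 14, .load 16 31, .arith .add 31 5 16, .load 17 31, .load 28 16,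
   .arith .add 31 16 3, .load 19 31]

/-- Run through the adjacency list at the addresses from `R[28]` to `R[19]`, and execute `reset`
at the parent `R[17]` and `child` at the other neighbours. -/
def scan (reset child : Program) : Program := .whileLt 28 19 (.block
  [.load 30 28, .arith .add 28 28 3, .arith .sub 31 30 17, .arith .sub 32 17 30,
   .arith .add 31 31 32, .ifLt 2 31 child reset])

theorem wp_fetch {W τ N i : ℕ} {s : Config} {Q : ℕ → Config → Prop} {u : Fin n}
    (hc : ConstRegs n N s.reg) (h14 : s.reg 14 = i) (hi : i < n)
    (hu : s.mem (4 * n + i) = u) (hp : s.mem (3 * n + u) = par u) (hin : InputMem ord s.mem)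
    (hsum : ∑ u, (ord u).length + 2 = 2 * n) (hW : 12 * n < W)
    (hQ : ∀ s', s'.mem = s.mem → (∀ i < 28, i ≠ 16 → i ≠ 17 → i ≠ 19 → s'.reg i = s.reg i) →
      s'.reg 16 = (u : ℕ) → s'.reg 17 = (par u : ℕ) → s'.reg 28 = listAddr ord u →
      s'.reg 19 = listAddr ord u + (ord u).length → Q (τ + 8) s') : WP W fetch τ s Q := by
  have h1 := listAddr_add_length_le ord u
  have h2 := hin.start u
  have h3 := hin.finish u
  have h4 := u.isLt
  have h5 := (par u).isLt
  unfold fetch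
  repeat'
    first
    | (refine wp_arith (by simp only [Config.setReg_reg, Op.eval, Nat.reduceEqDiff, if_true,
         if_false, hc.r6, hc.r5, hc.r3, h14] <;> rfl) ?_ ?_
       · omega)
    | (refine wp_load (by simp only [Config.setReg_reg, Nat.reduceEqDiff, if_true, if_false,
         Config.setReg_mem, hu, hp, h2, h3] <;> rfl) ?_ ?_
       · omega)
    | apply wp_block_nil
  apply hQ
  · rfl
  · intro i _ _ _ _
    simp only [Config.setReg_reg]
    repeat rw [if_neg (by omega)]
  all_goals simp only [Config.setReg_reg, Nat.reduceEqDiff, if_true, if_false]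

/-- The invariant `J` is indexed by the part of the list already scanned, and `hstable` requires it
to survive changes of the pointer 28 and of the scratch registers from 30 on. Each entry costs at
most `T` for the executed body and 8 steps of overhead. -/
theorem wp_scan {W τ a₀ T : ℕ} {s : Config} {Q : ℕ → Config → Prop} {reset child : Program}
    {l : List (Fin n)} {p : Fin n} (J : List (Fin n) → Config → Prop)
    (hJ : ∀ done s, J done s → s.reg 2 = 0 ∧ s.reg 3 = 1 ∧ s.reg 17 = p ∧
      s.reg 19 = a₀ + l.length ∧ ∀ i, (h : i < l.length) → s.mem (a₀ + i) = l[i])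
    (hstable : ∀ done s s', J done s → s'.mem = s.mem →
      (∀ i < 30, i ≠ 28 → s'.reg i = s.reg i) → J done s')
    (hchild : ∀ done w rest, l = done ++ w :: rest → w ≠ p → ∀ τ s, J done s → s.reg 30 = w →
      WP W child τ s fun τ' s' => τ' ≤ τ + T ∧ J (done ++ [w]) s' ∧ s'.reg 28 = s.reg 28)
    (hreset : ∀ done w rest, l = done ++ w :: rest → w = p → ∀ τ s, J done s →
      WP W reset τ s fun τ' s' => τ' ≤ τ + T ∧ J (done ++ [w]) s' ∧ s'.reg 28 = s.reg 28)
    (start : J [] s) (h28 : s.reg 28 = a₀) (hn : 2 * n < W) (ha : a₀ + l.length < W)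
    (hQ : ∀ τ' s', τ' ≤ τ + (T + 8) * l.length + 1 → J l s' → Q τ' s') :
    WP W (scan reset child) τ s Q := by
  refine wp_whileLt (fun i τ' s => τ' ≤ τ + (T + 8) * i ∧ J (l.take i) s ∧ s.reg 28 = a₀ + i)
    l.length ?_ ⟨by simp, by simpa using start, h28⟩ ?_
  · rintro i hi τ₁ s₁ ⟨hτ, hJs, h28⟩
    obtain ⟨h2, h3, h17, h19, hmem⟩ := hJ _ _ hJs
    refine ⟨by omega, ?_⟩
    have hw := hmem i hi
    obtain ⟨w, hwdef⟩ : ∃ w, w = l[i] := ⟨_, rfl⟩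
    rw [← hwdef] at hw
    have hsplit : l = l.take i ++ w :: l.drop (i + 1) := by
      rw [hwdef, ← List.drop_eq_getElem_cons hi, List.take_append_drop]
    have htake : l.take (i + 1) = l.take i ++ [w] := by
      rw [hwdef, List.take_succ_eq_append_getElem hi]
    have hwn := w.isLt
    have hpn := p.isLt
    refine wp_load (by rw [h28, hw]) (by omega) ?_
    repeat
      (refine wp_arith (by simp only [Config.setReg_reg, Op.eval, Nat.reduceEqDiff, if_true,
         if_false, h28, h3, h17] <;> rfl) ?_ ?_
       · omega)
    apply wp_block_cons
    generalize hs₂ : Config.setReg _ 31 _ = s₂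
    have hreg : ∀ i < 30, i ≠ 28 → s₂.reg i = s₁.reg i := by
      intro i _ _
      rw [← hs₂]
      simp only [Config.setReg_reg]
      repeat rw [if_neg (by omega)]
    have hJ₂ : J (l.take i) s₂ := hstable _ _ _ hJs (by rw [← hs₂]; rfl) hreg
    have h30 : s₂.reg 30 = w := by rw [← hs₂]; rfl
    have h28' : s₂.reg 28 = a₀ + i + 1 := by rw [← hs₂]; rfl
    -- One of the two truncated differences vanishes, so their sum is positive exactly when `w` and
    -- `p` differ.
    have h31 : s₂.reg 31 = ((w : ℕ) - p) + (p - w) := by rw [← hs₂]; rfl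
    have h2' : s₂.reg 2 = 0 := by rw [hreg 2 (by omega) (by omega), h2]
    have fin : ∀ {P : Program},
        (WP W P (τ₁ + 1 + 1 + 1 + 1 + 1 + 1) s₂ fun τ' s' =>
          τ' ≤ τ₁ + 1 + 1 + 1 + 1 + 1 + 1 + T ∧ J (l.take i ++ [w]) s' ∧
            s'.reg 28 = s₂.reg 28) →
        WP W P (τ₁ + 1 + 1 + 1 + 1 + 1 + 1) s₂ fun τ' s' => WP W (.block []) τ' s'
          fun τ' s' => τ' + 1 ≤ τ + (T + 8) * (i + 1) ∧ J (l.take (i + 1)) s' ∧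
            s'.reg 28 = a₀ + (i + 1) := by
      intro P hP
      refine hP.mono fun τ' s' ⟨h1, h2, h3⟩ => wp_block_nil ⟨?_, ?_, ?_⟩
      · rw [mul_add]
        omega
      · rwa [htake]
      · omega
    refine wp_ifLt (fun hlt => fin ?_) (fun hlt => fin ?_)
    · refine hchild _ w _ hsplit ?_ _ _ hJ₂ h30
      rintro rfl
      omega
    · exact hreset _ w _ hsplit (Fin.ext (by omega)) _ _ hJ₂
  · rintro τ₁ s₁ ⟨hτ, hJs, h28⟩
    rw [List.take_length] at hJs
    obtain ⟨h2, h3, h17, h19, hmem⟩ := hJ _ _ hJs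
    exact ⟨by omega, hQ _ _ (by omega) hJs⟩

end TreeDrawing

namespace TreeDrawing

variable {n : ℕ} {r : Fin n} {ord : Fin n → List (Fin n)} {par : Fin n → Fin n}
  {depth : Fin n → ℕ}

/-! ### The breadth-first search program. -/

/-- Append the vertex `R[30]` to the search order, as a child of the vertex `R[16]`. -/
def discover : Program := .block
  [.arith .add 31 5 30, .store 31 16, .arith .add 31 6 15, .store 31 30,
   .arith .add 31 7 30, .store 31 3, .arith .add 15 15 3]

/-- Breadth-first search: compute the search order and the parents, and set the sizes to `1`. -/
def search : Program := .block
  [.arith .add 31 5 1, .store 31 1, .store 6 1, .arith .add 31 7 1, .store 31 3,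
   .const 14 0, .arith .add 15 3 2,
   .whileLt 14 15 (.block [fetch, scan (.block []) discover, .arith .add 14 14 3])]

/-- The memory `M` contains the search order `L` and the parents of its vertices. -/
structure SearchMem (par : Fin n → Fin n) (L : List (Fin n)) (M : ℕ → ℕ) : Prop where
  order : ∀ i, (h : i < L.length) → M (4 * n + i) = L[i]
  parent : ∀ v ∈ L, M (3 * n + v) = par v

/-- The memory after recording the vertex `w` in entry `i` of the search order, with parent
`p`. -/
def storeVertex (n i p w : ℕ) (M : ℕ → ℕ) : ℕ → ℕ :=
  Function.update (Function.update (Function.update M (3 * n + w) p) (4 * n + i) w) (5 * n + w) 1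

theorem SearchMem.append {L : List (Fin n)} {M : ℕ → ℕ} {w : Fin n} (h : SearchMem par L M)
    (hw : w ∉ L) (hL : L.length < n) :
    SearchMem par (L ++ [w]) (storeVertex n L.length (par w) w M) := by
  refine ⟨fun i hi => ?_, fun v hv => ?_⟩
  · rw [List.length_append, List.length_singleton] at hi
    have hwn := w.isLt
    unfold storeVertex
    rw [Function.update_of_ne (by omega)]
    by_cases hiL : i < L.length
    · rw [Function.update_of_ne (by omega), Function.update_of_ne (by omega),
        List.getElem_append_left hiL, h.order]
    · obtain rfl : i = L.length := by omega
      simp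
  · have hvn := v.isLt
    have hwn := w.isLt
    unfold storeVertex
    rw [Function.update_of_ne (by omega), Function.update_of_ne (by omega)]
    by_cases hvw : v = w
    · subst hvw
      simp
    · have : (v : ℕ) ≠ w := fun he => hvw (Fin.ext he)
      rw [Function.update_of_ne (by omega), h.parent]
      simpa [hvw] using hv

theorem storeVertex_size {L : List (Fin n)} {M : ℕ → ℕ} {w : Fin n} {i p : ℕ}
    (h : ∀ v ∈ L, M (5 * n + v) = 1) (hi : i < n) :
    ∀ v ∈ L ++ [w], storeVertex n i p w M (5 * n + v) = 1 := by
  intro v hv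
  have hvn := v.isLt
  have hwn := w.isLt
  unfold storeVertex
  by_cases hvw : v = w
  · subst hvw
    simp
  · have : (v : ℕ) ≠ w := fun he => hvw (Fin.ext he)
    rw [Function.update_of_ne (by omega), Function.update_of_ne (by omega),
      Function.update_of_ne (by omega), h]
    simpa [hvw] using hv

theorem storeVertex_of_lt {M : ℕ → ℕ} {i p w a : ℕ} (ha : a < 3 * n) :
    storeVertex n i p w M a = M a := by
  unfold storeVertex
  rw [Function.update_of_ne (by omega), Function.update_of_ne (by omega),
    Function.update_of_ne (by omega)]

theorem wp_discover {W τ N p m : ℕ} {s : Config} {Q : ℕ → Config → Prop} {w : Fin n}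
    (hc : ConstRegs n N s.reg) (h15 : s.reg 15 = m) (h16 : s.reg 16 = p) (h30 : s.reg 30 = w)
    (hm : m < n) (hp : p < n) (hW : 12 * n < W)
    (hQ : ∀ s', (∀ i < 30, i ≠ 15 → s'.reg i = s.reg i) → s'.reg 15 = m + 1 →
      s'.mem = storeVertex n m p w s.mem → Q (τ + 8) s') : WP W discover τ s Q := by
  have hwn := w.isLt
  unfold discover
  repeat'
    first
    | (refine wp_arith (by simp only [Config.setReg_reg, Config.setMem_reg, Op.eval,
         Nat.reduceEqDiff, if_true, if_false, hc.r6, hc.r5, hc.r3, hc.r7, h15, h30] <;> rfl) ?_ ?_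
       · omega)
    | (refine wp_store (by simp only [Config.setReg_reg, if_true] <;> rfl)
         (by simp only [Config.setReg_reg, Config.setMem_reg,
         Nat.reduceEqDiff, if_true, if_false, hc.r3, h16, h30] <;> rfl) ?_ ?_
       · omega)
    | apply wp_block_nil
  apply hQ
  · intro i _ _
    simp only [Config.setReg_reg, Config.setMem_reg]
    repeat rw [if_neg (by omega)]
  all_goals rfl

theorem ConstRegs.congr {N : ℕ} {R R' : ℕ → ℕ} (h : ConstRegs n N R) (h0 : R' 0 = R 0)
    (hR : ∀ i < 14, 2 ≤ i → R' i = R i) : ConstRegs n N R' := by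
  constructor
  · exact h0.trans h.r0
  all_goals rw [hR _ (by omega) (by omega)]
  exacts [h.r2, h.r3, h.r4, h.r5, h.r6, h.r7, h.r8, h.r9, h.r10, h.r11, h.r12, h.r13]

theorem wp_search_scan {W τ N i : ℕ} {s : Config} {Q : ℕ → Config → Prop}
    {L : List (Fin n)} {u : Fin n} (hr : IsRooting r ord par depth) (hc : ConstRegs n N s.reg)
    (hL : SearchList r par i L) (hi : i < L.length)
    (hu : L[i] = u)
    (hmem : SearchMem par L s.mem) (hsize : ∀ v ∈ L, s.mem (5 * n + v) = 1)
    (hin : InputMem ord s.mem) (h15 : s.reg 15 = L.length) (h16 : s.reg 16 = u)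
    (h17 : s.reg 17 = par u) (h28 : s.reg 28 = listAddr ord u)
    (h19 : s.reg 19 = listAddr ord u + (ord u).length) (hW : 12 * n < W)
    (hQ : ∀ τ' s' L', τ' ≤ τ + 16 * (ord u).length + 1 →
      L' = L ++ (ord u).filter (· ≠ par u) → (∀ i < 15, s'.reg i = s.reg i) →
      s'.reg 15 = L'.length → SearchMem par L' s'.mem → (∀ v ∈ L', s'.mem (5 * n + v) = 1) →
      (∀ a < 3 * n, s'.mem a = s.mem a) → Q τ' s') :
    WP W (scan (.block []) discover) τ s Q := by
  have hsucc := hL.succ hr hi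
  rw [hu] at hsucc
  have hlen := length_le_of_nodup hsucc.nodup
  have haddr := listAddr_add_length_le ord u
  have hsum := hr.sum_length
  let J : List (Fin n) → Config → Prop := fun done s' =>
    (∀ i < 28, i ≠ 15 → s'.reg i = s.reg i) ∧
    s'.reg 15 = (L ++ done.filter (· ≠ par u)).length ∧
    SearchMem par (L ++ done.filter (· ≠ par u)) s'.mem ∧
    (∀ v ∈ L ++ done.filter (· ≠ par u), s'.mem (5 * n + v) = 1) ∧
    ∀ a < 3 * n, s'.mem a = s.mem a
  refine wp_scan (l := ord u) (p := par u) (a₀ := listAddr ord u) (T := 8) J ?_ ?_ ?_ ?_ ?_ h28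
    (by omega) (by omega) ?_
  · rintro done s' ⟨hreg, -, -, -, hmem'⟩
    refine ⟨?_, ?_, ?_, ?_, ?_⟩
    · rw [hreg 2 (by omega) (by omega), hc.r2]
    · rw [hreg 3 (by omega) (by omega), hc.r3]
    · rw [hreg 17 (by omega) (by omega), h17]
    · rw [hreg 19 (by omega) (by omega), h19]
    · intro i hi
      rw [hmem' _ (by omega), hin.entry]
  · rintro done s' s'' ⟨h1, h2, h3, h4, h5⟩ hm hreg
    refine ⟨fun i hi hi' => ?_, ?_, ?_, ?_, ?_⟩
    · rw [hreg i (by omega) (by omega), h1 i hi hi']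
    · rw [hreg 15 (by omega) (by omega), h2]
    all_goals rwa [hm]
  · rintro done w rest hsplit hw τ' s' ⟨h1, h2, h3, h4, h5⟩ h30
    have hfilter : (done ++ [w]).filter (· ≠ par u) = done.filter (· ≠ par u) ++ [w] := by
      simp [hw]
    have hnd : (L ++ (done.filter (· ≠ par u) ++ [w])).Nodup := by
      rw [← hfilter]
      refine hsucc.nodup.sublist (List.Sublist.append_left ?_ _)
      rw [hsplit]
      exact ((List.sublist_append_left [w] rest).append_left done).filter _
    have hpw : par w = u := (hr.mem_filter_ord.1 (by
      rw [List.mem_filter, hsplit]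
      simp [hw])).2
    rw [← List.append_assoc] at hnd
    have hlen' := length_le_of_nodup hnd
    rw [List.length_append, List.length_singleton] at hlen'
    have hw' : w ∉ L ++ done.filter (· ≠ par u) := fun hm =>
      (List.nodup_append.1 hnd).2.2 _ hm _ (by simp) rfl
    have hc' : ConstRegs n N s'.reg := hc.congr (h1 0 (by omega) (by omega))
      fun i hi hi' => h1 i (by omega) (by omega)
    refine wp_discover (p := u) hc' h2 ?_ h30 (by omega) u.isLt hW ?_
    · rw [h1 16 (by omega) (by omega), h16]
    intro s'' hreg h15' hmem'
    refine ⟨le_rfl, ⟨fun i hi hi' => ?_, ?_, ?_, ?_, ?_⟩, hreg 28 (by omega) (by omega)⟩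
    · rw [hreg i (by omega) hi', h1 i hi hi']
    · rw [h15', hfilter, ← List.append_assoc, List.length_append (bs := [w]),
        List.length_singleton]
    · have := h3.append hw' (by omega)
      rwa [hpw, List.append_assoc, ← hfilter, ← hmem'] at this
    · rw [hmem', hfilter, ← List.append_assoc]
      exact storeVertex_size h4 (by omega)
    · intro a ha
      rw [hmem', storeVertex_of_lt ha, h5 a ha]
  · rintro done w rest hsplit rfl τ' s' hJ
    refine wp_block_nil ⟨by omega, ?_, rfl⟩
    have : (done ++ [par u]).filter (· ≠ par u) = done.filter (· ≠ par u) := by simp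
    simpa only [J, this] using hJ
  · refine ⟨fun _ _ _ => rfl, by simpa using h15, by simpa using hmem, by simpa using hsize,
      fun _ _ => rfl⟩
  · rintro τ' s' hτ ⟨h1, h2, h3, h4, h5⟩
    exact hQ τ' s' _ (by omega) rfl (fun i hi => h1 i (by omega) (by omega)) h2 h3 h4 h5

theorem wp_search {W τ N : ℕ} {s : Config} {Q : ℕ → Config → Prop}
    (hr : IsRooting r ord par depth) (hc : ConstRegs n N s.reg) (h1 : s.reg 1 = r)
    (hin : InputMem ord s.mem) (hW : 12 * n < W)
    (hQ : ∀ τ' s' L, τ' ≤ τ + 50 * n + 10 → SearchList r par n L →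
      (∀ i < 14, s'.reg i = s.reg i) → SearchMem par L s'.mem →
      (∀ v ∈ L, s'.mem (5 * n + v) = 1) → (∀ a < 3 * n, s'.mem a = s.mem a) → Q τ' s') :
    WP W search τ s Q := by
  have hrn := r.isLt
  unfold search
  repeat'
    first
    | (refine wp_arith (by simp only [Config.setReg_reg, Config.setMem_reg, Op.eval,
         Nat.reduceEqDiff, if_true, if_false, hc.r2, hc.r6, hc.r5, hc.r3, hc.r7, h1] <;> rfl) ?_ ?_
       · omega)
    | (refine wp_store (by simp only [Config.setReg_reg, Config.setMem_reg,
         Nat.reduceEqDiff, if_true, if_false, hc.r6] <;> rfl)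
         (by simp only [Config.setReg_reg, Config.setMem_reg,
         Nat.reduceEqDiff, if_true, if_false, hc.r3, h1] <;> rfl) ?_ ?_
       · omega)
    | (refine wp_const ?_ ?_
       · omega)
  apply wp_block_cons
  generalize hs₁ : Config.setReg _ 15 _ = s₁
  have hreg : ∀ i < 14, s₁.reg i = s.reg i := by
    intro i _
    rw [← hs₁]
    simp only [Config.setReg_reg, Config.setMem_reg]
    repeat rw [if_neg (by omega)]
  -- Initialisation has the effect of discovering the root as entry 0 with itself as parent.
  have hmem : s₁.mem = storeVertex n 0 r r s.mem := by
    rw [← hs₁]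
    rfl
  -- Time is charged to the processed vertices. At the end the charges add up to `12 * n` plus 16
  -- times the total list length `2 * n - 2`.
  refine wp_whileLt (fun i τ' s' => ∃ L, SearchList r par i L ∧ SearchMem par L s'.mem ∧
    (∀ v ∈ L, s'.mem (5 * n + v) = 1) ∧ (∀ i < 14, s'.reg i = s.reg i) ∧ s'.reg 14 = i ∧
    s'.reg 15 = L.length ∧ (∀ a < 3 * n, s'.mem a = s.mem a) ∧
    τ' ≤ τ + 7 + ((L.take i).map fun v => 12 + 16 * (ord v).length).sum) n ?_ ?_ ?_
  · rintro i hi τ₂ s₂ ⟨L, hL, hm, hsz, hreg₂, h14, h15, hm₂, hτ⟩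
    have hiL := hL.lt_length hr hi
    refine ⟨by omega, wp_block_cons ?_⟩
    have hc₂ : ConstRegs n N s₂.reg := hc.congr (hreg₂ 0 (by omega)) fun i hi _ => hreg₂ i hi
    have hin₂ := hin.congr hr.sum_length hm₂
    refine wp_fetch (par := par) hc₂ h14 hi (hm.order i hiL) (hm.parent _ (List.getElem_mem hiL))
      hin₂ hr.sum_length hW ?_
    intro s₃ hm₃ hreg₃ h16 h17 h28 h19
    refine wp_block_cons (wp_search_scan hr
      (hc₂.congr (hreg₃ _ (by omega) (by omega) (by omega) (by omega))
        fun i hi _ => hreg₃ _ (by omega) (by omega) (by omega) (by omega)) hL hiL rfl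
      (by rwa [hm₃]) (by rwa [hm₃]) (by rwa [hm₃])
      (by rw [hreg₃ _ (by omega) (by omega) (by omega) (by omega), h15]) h16 h17 h28 h19 hW ?_)
    intro τ₄ s₄ L' hτ₄ hL' hreg₄ h15₄ hm₄ hsz₄ hin₄
    have h14₄ : s₄.reg 14 = i := by
      rw [hreg₄ _ (by omega), hreg₃ _ (by omega) (by omega) (by omega) (by omega), h14]
    have h3₄ : s₄.reg 3 = 1 := by
      rw [hreg₄ _ (by omega), hreg₃ _ (by omega) (by omega) (by omega) (by omega), hc₂.r3]
    refine wp_arith (by simp only [Op.eval, h14₄, h3₄] <;> rfl) (by omega) (wp_block_nil ?_)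
    refine ⟨L', ?_, hm₄, hsz₄, ?_, rfl, ?_, ?_, ?_⟩
    · rw [hL']
      exact hL.succ hr hiL
    · intro j hj
      rw [Config.setReg_reg_of_ne _ (by omega), hreg₄ _ (by omega),
        hreg₃ _ (by omega) (by omega) (by omega) (by omega), hreg₂ j hj]
    · rw [Config.setReg_reg_of_ne _ (by omega), h15₄]
    · intro a ha
      rw [Config.setReg_mem, hin₄ a ha, hm₃, hm₂ a ha]
    · rw [hL', List.take_append_of_le_length hiL, List.take_succ_eq_append_getElem hiL,
        List.map_append, List.sum_append, List.map_singleton, List.sum_singleton]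
      omega
  · refine ⟨[r], searchList_singleton r par, ?_, ?_, hreg, ?_, ?_, ?_, ?_⟩
    · rw [hmem]
      have := (SearchMem.append (par := par) (L := []) (M := s.mem) (w := r)
        ⟨by simp, by simp⟩ (by simp) (by simpa using Nat.zero_lt_of_lt hrn))
      simpa [hr.par_root] using this
    · rw [hmem]
      simpa using storeVertex_size (L := []) (M := s.mem) (w := r) (by simp)
        (Nat.zero_lt_of_lt hrn)
    · rw [← hs₁]
      rfl
    · rw [← hs₁]
      rfl
    · intro a ha
      rw [hmem, storeVertex_of_lt ha]
    · simp
  · rintro τ₂ s₂ ⟨L, hL, hm, hsz, hreg₂, h14, h15, hm₂, hτ⟩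
    have hlen := length_le_of_nodup hL.nodup
    refine ⟨by omega, wp_block_nil (hQ _ _ L ?_ hL hreg₂ hm hsz hm₂)⟩
    have hall : ∀ v, v ∈ L := hL.forall_mem hr hlen
    have : L.take n = L := List.take_of_length_le hlen
    rw [this, ← List.sum_toFinset _ hL.nodup,
      (Finset.eq_univ_iff_forall.2 (by simpa using hall) : L.toFinset = Finset.univ),
      Finset.sum_add_distrib, ← Finset.mul_sum] at hτ
    have := hr.sum_length
    simp only [Finset.sum_const, Finset.card_univ, Fintype.card_fin, smul_eq_mul] at hτ
    omega

end TreeDrawing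

namespace TreeDrawing

variable {n : ℕ} {r : Fin n} {ord : Fin n → List (Fin n)} {par : Fin n → Fin n}
  {depth : Fin n → ℕ}

/-! ### Computing the subtree sizes. -/

/-- Add the size of every subtree to that of its parent, in reverse search order. -/
def computeSizes : Program := .block
  [.arith .add 14 0 2, .whileLt 3 14 (.block
    [.arith .sub 14 14 3, .arith .add 31 6 14, .load 16 31, .arith .add 31 5 16, .load 17 31,
     .arith .add 31 7 16, .load 31 31, .arith .add 32 7 17, .load 33 32, .arith .add 33 33 31,
     .store 32 33])]

/-- Parents precede their children in the search order, so the reverse order meets all children of a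
vertex before the vertex itself. -/
theorem SearchList.child_notMem_take {i m : ℕ} {L : List (Fin n)} (h : SearchList r par i L)
    (hm : m < L.length) {w : Fin n} (hw : w ≠ r) (hp : par w = L[m]) : w ∉ L.take (m + 1) := by
  intro hmem
  obtain ⟨j, hj, rfl⟩ := List.mem_take_iff_getElem.1 hmem
  rcases h.parent_before j (by omega) with h1 | h1
  · exact hw h1
  · rw [hp] at h1
    refine getElem_notMem_take h.nodup hm (List.take_subset_take_left _ ?_ h1)
    omega

theorem SearchList.mem_take_one {i : ℕ} {L : List (Fin n)} (h : SearchList r par i L)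
    {w : Fin n} (hw : w ≠ r) : w ∉ L.take 1 := by
  intro hmem
  obtain ⟨j, hj, rfl⟩ := List.mem_take_iff_getElem.1 hmem
  rcases h.parent_before j (by omega) with h1 | h1
  · exact hw h1
  · obtain rfl : j = 0 := by omega
    simp at h1

/-- A cell holds 1 plus the sizes of the children already processed. When the turn of a vertex
comes, all its children have been processed, so its cell is final and may be added to that of its
parent. The loop stops before entry 0, the root. -/
theorem wp_computeSizes {W τ N : ℕ} {s : Config} {Q : ℕ → Config → Prop} {L : List (Fin n)}
    {size : Fin n → ℕ} (hr : IsRooting r ord par depth)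
    (hsize : ∀ u, size u = 1 + ((childList ord par u).map size).sum) (hroot : size r = n)
    (hc : ConstRegs n N s.reg) (hL : SearchList r par n L) (hmem : SearchMem par L s.mem)
    (hone : ∀ v ∈ L, s.mem (5 * n + v) = 1) (hW : 12 * n < W)
    (hQ : ∀ τ' s', τ' ≤ τ + 13 * n + 10 → (∀ i < 14, s'.reg i = s.reg i) →
      (∀ v : Fin n, s'.mem (5 * n + v) = size v) → (∀ a < 5 * n, s'.mem a = s.mem a) →
      Q τ' s') : WP W computeSizes τ s Q := by
  have hrn := r.isLt
  have hlen : L.length = n := le_antisymm (length_le_of_nodup hL.nodup) hL.le_length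
  have hall := hL.forall_mem hr hlen.le
  have hsize' : ∀ u, size u = 1 + ∑ w with w ≠ r ∧ par w = u, size w := fun u => by
    rw [hsize, hr.sum_childList]
  have hle := hr.size_le hsize hroot
  refine wp_arith (by simp only [Op.eval, hc.r0, hc.r2] <;> rfl) (by omega) (wp_block_cons ?_)
  refine wp_whileLt (fun i τ' s' => τ' ≤ τ + 1 + 13 * i ∧ (∀ i < 14, s'.reg i = s.reg i) ∧
    s'.reg 14 = n - i ∧ (∀ a < 5 * n, s'.mem a = s.mem a) ∧
    ∀ v : Fin n, s'.mem (5 * n + v) =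
      1 + ∑ w with w ≠ r ∧ par w = v ∧ w ∉ L.take (n - i), size w) (n - 1) ?_ ?_ ?_
  · rintro i hi τ₁ s₁ ⟨hτ, hreg, h14, hm, hsz⟩
    have k3 : s₁.reg 3 = 1 := (hreg 3 (by omega)).trans hc.r3
    have k5 : s₁.reg 5 = 3 * n := (hreg 5 (by omega)).trans hc.r5
    have k6 : s₁.reg 6 = 4 * n := (hreg 6 (by omega)).trans hc.r6
    have k7 : s₁.reg 7 = 5 * n := (hreg 7 (by omega)).trans hc.r7
    refine ⟨by omega, ?_⟩
    obtain ⟨m, hmdef⟩ : ∃ m, m = n - i - 1 := ⟨_, rfl⟩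
    have hm1 : n - i = m + 1 := by omega
    have hmL : m < L.length := by omega
    obtain ⟨v, hv⟩ : ∃ v, v = L[m] := ⟨_, rfl⟩
    rw [hm1] at hsz
    have ho : s₁.mem (4 * n + m) = v := by
      rw [hm _ (by omega), hmem.order m hmL, hv]
    have hp : s₁.mem (3 * n + v) = par v := by
      rw [hm _ (by omega), hmem.parent v (hall v)]
    have hszv : s₁.mem (5 * n + v) = size v := by
      rw [hsz, hsize']
      congr 1
      apply Finset.sum_congr _ fun _ _ => rfl
      ext w
      simp only [Finset.mem_filter, Finset.mem_univ, true_and]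
      constructor
      · tauto
      · rintro ⟨h1, h2⟩
        exact ⟨h1, h2, hL.child_notMem_take hmL h1 (h2.trans hv)⟩
    have hvr : v ≠ r := by
      rintro rfl
      have h1 : L[0] = v := by
        by_contra hne
        exact hL.mem_take_one hne (by rw [List.mem_take_iff_getElem]; exact ⟨0, by omega, rfl⟩)
      have := (hL.nodup.getElem_inj_iff).1 (h1.trans hv)
      omega
    have hvm : v ∉ L.take m := by
      rw [hv]
      exact getElem_notMem_take hL.nodup hmL
    have hvm1 : v ∈ L.take (m + 1) := by
      rw [List.take_succ_eq_append_getElem hmL, ← hv]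
      simp
    have htake : ∀ w, w ∈ L.take (m + 1) ↔ w ∈ L.take m ∨ w = v := by
      intro w
      rw [List.take_succ_eq_append_getElem hmL, ← hv]
      simp
    have hnew : ∀ u : Fin n, 1 + ∑ w with w ≠ r ∧ par w = u ∧ w ∉ L.take m, size w =
        s₁.mem (5 * n + u) + if u = par v then size v else 0 := by
      intro u
      rw [hsz, add_assoc]
      congr 1
      split_ifs with hu
      · rw [add_comm, ← Finset.sum_insert (by simp [hvm1])]
        apply Finset.sum_congr _ fun _ _ => rfl
        ext w
        simp only [Finset.mem_filter, Finset.mem_univ, true_and, Finset.mem_insert, htake]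
        by_cases hwv : w = v
        · subst hwv
          simp [hvr, hu, hvm]
        · simp [hwv]
      · rw [add_zero]
        apply Finset.sum_congr _ fun _ _ => rfl
        ext w
        simp only [Finset.mem_filter, Finset.mem_univ, true_and, htake]
        have : par w = u → w ≠ v := by
          rintro rfl rfl
          exact hu rfl
        tauto
    have hpb : s₁.mem (5 * n + par v) + size v ≤ n := by
      refine le_trans ?_ (hle (par v))
      have h1 := hnew (par v)
      rw [if_pos rfl] at h1
      rw [← h1, hsize' (par v)]
      refine Nat.add_le_add_left (Finset.sum_le_sum_of_subset ?_) 1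
      intro w
      simp only [Finset.mem_filter, Finset.mem_univ, true_and]
      tauto
    have hvn := v.isLt
    have hpn := (par v).isLt
    refine wp_arith (x := m) (by simp only [Op.eval, h14, k3]; omega) (by omega) ?_
    repeat'
      first
      | (refine wp_arith (by simp only [Config.setReg_reg, Op.eval, Nat.reduceEqDiff, if_true,
           if_false, k5, k6, k7] <;> rfl) ?_ ?_
         · omega)
      | (refine wp_load (by simp only [Config.setReg_reg, Config.setReg_mem, Nat.reduceEqDiff,
           if_true, if_false, ho, hp, hszv] <;> rfl) ?_ ?_
         · omega)
      | (refine wp_store (by simp only [Config.setReg_reg, Nat.reduceEqDiff, if_true,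
           if_false] <;> rfl) (by simp only [Config.setReg_reg, Nat.reduceEqDiff, if_true,
           if_false] <;> rfl) ?_ ?_
         · omega)
    refine wp_block_nil ⟨by omega, ?_, ?_, ?_, ?_⟩
    · intro j hj
      simp only [Config.setReg_reg, Config.setMem_reg]
      repeat rw [if_neg (by omega)]
      exact hreg j hj
    · simp only [Config.setReg_reg, Config.setMem_reg, Nat.reduceEqDiff, if_true, if_false]
      omega
    · intro a ha
      rw [Config.setMem_mem, Function.update_of_ne (by omega)]
      exact hm a ha
    · intro u
      rw [show n - (i + 1) = m by omega, hnew u, Config.setMem_mem]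
      by_cases hu : u = par v
      · subst hu
        simp
      · have : (u : ℕ) ≠ par v := fun he => hu (Fin.ext he)
        rw [Function.update_of_ne (by omega), if_neg hu]
        rfl
  · refine ⟨by omega, ?_, by rfl, fun _ _ => rfl, ?_⟩
    · intro j hj
      rw [Config.setReg_reg_of_ne _ (by omega)]
    · intro v
      rw [Config.setReg_mem, hone v (hall v), Nat.sub_zero, List.take_of_length_le hlen.le]
      simp [hall]
  · rintro τ₁ s₁ ⟨hτ, hreg, h14, hm, hsz⟩
    refine ⟨?_, wp_block_nil (hQ _ _ (by omega) hreg ?_ hm)⟩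
    · rw [h14, (hreg 3 (by omega)).trans hc.r3]
      omega
    · intro v
      rw [hsz, hsize', show n - (n - 1) = 1 by omega]
      congr 1
      apply Finset.sum_congr _ fun _ _ => rfl
      ext w
      simp only [Finset.mem_filter, Finset.mem_univ, true_and]
      have := fun h => hL.mem_take_one (w := w) h
      tauto

end TreeDrawing

namespace TreeDrawing

variable {n : ℕ} {r : Fin n} {ord : Fin n → List (Fin n)} {par : Fin n → Fin n}
  {depth : Fin n → ℕ} {size : Fin n → ℕ}

/-! ### Offsets of the children when the list does not begin at the parent. -/

/-- The offset computed by a scan of the list `l` that starts from `c`. -/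
def cursor (size : Fin n → ℕ) (p : Fin n) (c : ℕ) (l : List (Fin n)) : ℕ :=
  l.foldl (fun c w => if w = p then 0 else c + size w) c

theorem cursor_concat (size : Fin n → ℕ) (p : Fin n) (c : ℕ) (l : List (Fin n)) (w : Fin n) :
    cursor size p c (l ++ [w]) = if w = p then 0 else cursor size p c l + size w := by
  simp [cursor]

theorem cursor_append_cons (size : Fin n → ℕ) (p : Fin n) (c : ℕ) (l l' : List (Fin n)) :
    cursor size p c (l ++ p :: l') = cursor size p 0 l' := by
  simp [cursor]

theorem cursor_of_notMem {p : Fin n} {l : List (Fin n)} (h : p ∉ l) (c : ℕ) :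
    cursor size p c l = c + (l.map size).sum := by
  induction l generalizing c with
  | nil => simp [cursor]
  | cons a l ih =>
    simp only [List.mem_cons, not_or] at h
    have := ih h.2 (c + size a)
    simp only [cursor, List.foldl_cons, if_neg (Ne.symm h.1)] at this ⊢
    rw [this, List.map_cons, List.sum_cons, add_assoc]

theorem cursor_le (p : Fin n) (c : ℕ) (l : List (Fin n)) :
    cursor size p c l ≤ c + ((l.filter (· ≠ p)).map size).sum := by
  induction l generalizing c with
  | nil => simp [cursor]
  | cons a l ih =>
    by_cases ha : a = p
    · subst ha
      have := ih 0
      simp only [cursor, List.foldl_cons, if_true] at this ⊢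
      simp only [ne_eq, not_true_eq_false, decide_false, Bool.false_eq_true, not_false_eq_true,
        List.filter_cons_of_neg]
      simp only [ne_eq] at this
      omega
    · have := ih (c + size a)
      simp only [cursor, List.foldl_cons, if_neg ha] at this ⊢
      rw [List.filter_cons_of_pos (by simpa using ha), List.map_cons, List.sum_cons]
      omega

/-- The initial offset at the vertex `u`. -/
def initialOffset (ord : Fin n → List (Fin n)) (par : Fin n → Fin n) (size : Fin n → ℕ)
    (u : Fin n) : ℕ :=
  if cursor size (par u) 0 (ord u) < size u - 1 then cursor size (par u) 0 (ord u) else 0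

theorem IsRooting.filter_ord_perm (hr : IsRooting r ord par depth) (u : Fin n) :
    ((ord u).filter (· ≠ par u)).Perm (childList ord par u) := by
  refine (List.perm_ext_iff_of_nodup ((hr.nodup_ord u).filter _) (hr.nodup_childList u)).2 ?_
  intro w
  rw [hr.mem_filter_ord, hr.mem_childList]

theorem IsRooting.cursor_prefix_le (hr : IsRooting r ord par depth)
    (hsize : ∀ u, size u = 1 + ((childList ord par u).map size).sum) {u : Fin n}
    {done rest : List (Fin n)} (h : ord u = done ++ rest) :
    cursor size (par u) 0 done ≤ size u := by
  have h1 := cursor_le (size := size) (par u) 0 done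
  have h2 : ((done.filter (· ≠ par u)).map size).sum ≤ ((childList ord par u).map size).sum := by
    rw [← ((hr.filter_ord_perm u).map size).sum_eq, h, List.filter_append, List.map_append,
      List.sum_append]
    exact Nat.le_add_right _ _
  have h3 := hsize u
  omega

/-- Away from the root, let `ord u = A ++ par u :: B`. The children are ordered as `B ++ A`, but a
scan meets `A` first. A preliminary scan that resets at the parent ends with the total size of `B`.
Starting the second scan from this value places `A` after `B`, and the reset at the parent starts
`B` from 0. At the root nothing is reset and the preliminary scan returns the full `size u - 1`; the
test in `initialOffset` turns this into 0. -/
theorem IsRooting.cursor_eq (hr : IsRooting r ord par depth)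
    (hsize : ∀ u, size u = 1 + ((childList ord par u).map size).sum) {u w : Fin n}
    {done rest : List (Fin n)} (h : ord u = done ++ w :: rest) (hw : w ≠ par u) :
    ∃ pre post, childList ord par u = pre ++ w :: post ∧
      cursor size (par u) (initialOffset ord par size u) done = (pre.map size).sum := by
  have hu := hsize u
  have hw1 := hsize w
  have hnd := hr.nodup_ord u
  by_cases hur : u = r
  · subst hur
    have hp := hr.par_notMem_root
    rw [hr.childList_root] at hu ⊢
    refine ⟨done, rest, h, ?_⟩
    have h0 : initialOffset ord par size u = 0 := by
      unfold initialOffset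
      rw [cursor_of_notMem hp]
      exact if_neg (by omega)
    rw [h0, cursor_of_notMem, zero_add]
    intro hmem
    apply hp
    rw [h]
    exact List.mem_append_left _ hmem
  · obtain ⟨A, B, hA, hB⟩ := hr.exists_ord_eq hur
    rw [hA] at hnd
    have hpA : par u ∉ A := fun hm => (List.nodup_append.1 hnd).2.2 _ hm _ (by simp) rfl
    have hpB : par u ∉ B := by
      have := (List.nodup_append.1 hnd).2.1
      rw [List.nodup_cons] at this
      exact this.1
    have h0 : initialOffset ord par size u =
        if (B.map size).sum < size u - 1 then (B.map size).sum else 0 := by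
      unfold initialOffset
      rw [hA, cursor_append_cons, cursor_of_notMem hpB, zero_add]
    rw [hB] at hu ⊢
    rw [List.map_append, List.sum_append] at hu
    rw [hA] at h
    rcases List.append_eq_append_iff.1 h with ⟨a', h1, h2⟩ | ⟨a', h1, h2⟩
    · rcases a' with _ | ⟨x, a''⟩
      · simp only [List.nil_append, List.cons.injEq] at h2
        exact absurd h2.1.symm hw
      · simp only [List.cons_append, List.cons.injEq] at h2
        obtain ⟨rfl, h2⟩ := h2
        refine ⟨a'', rest ++ A, by rw [h2]; simp, ?_⟩
        rw [h1, cursor_append_cons, cursor_of_notMem, zero_add]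
        intro hm
        rw [h2] at hpB
        exact hpB (List.mem_append_left _ hm)
    · rcases a' with _ | ⟨x, a''⟩
      · simp only [List.nil_append, List.cons.injEq] at h2
        exact absurd h2.1 hw
      · simp only [List.cons_append, List.cons.injEq] at h2
        obtain ⟨rfl, h2⟩ := h2
        refine ⟨B ++ done, a'', by rw [h1]; simp, ?_⟩
        have hAs : (A.map size).sum = (done.map size).sum + (size w + (a''.map size).sum) := by
          rw [h1]
          simp
        -- Here `A` contains `w`, whose subtree is nonempty, so the total of `B` is strictly below
        -- `size u - 1`.
        rw [h0, if_pos (by omega), cursor_of_notMem, List.map_append, List.sum_append]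
        intro hm
        apply hpA
        rw [h1]
        exact List.mem_append_left _ hm

/-! ### The family of all placements. -/

/-- `pl` is the family of placements of the vertices. -/
structure IsPlacement (r : Fin n) (ord : Fin n → List (Fin n)) (par : Fin n → Fin n)
    (size : Fin n → ℕ) (N : ℕ) (pl : Fin n → Placement) : Prop where
  root : pl r = Placement.root N
  child : ∀ u w pre post, childList ord par u = pre ++ w :: post →
    pl w = (pl u).step N (pre.map size).sum (size w) (size u - 1)

/-- Placement of a vertex of depth at most `k`. -/
def placementAux (r : Fin n) (ord : Fin n → List (Fin n)) (par : Fin n → Fin n)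
    (size : Fin n → ℕ) (N : ℕ) : ℕ → Fin n → Placement
  | 0, _ => Placement.root N
  | k + 1, v => if v = r then Placement.root N else
      (placementAux r ord par size N k (par v)).step N
        (((childList ord par (par v)).takeWhile (· ≠ v)).map size).sum (size v) (size (par v) - 1)

theorem IsRooting.exists_isPlacement (hr : IsRooting r ord par depth) (size : Fin n → ℕ) (N : ℕ) :
    ∃ pl, IsPlacement r ord par size N pl := by
  refine ⟨fun v => placementAux r ord par size N (depth v) v, ?_, ?_⟩
  · cases depth r <;> simp [placementAux]
  · intro u w pre post h
    have hw := hr.mem_childList.1 (show w ∈ childList ord par u by rw [h]; simp)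
    have hnd := hr.nodup_childList u
    rw [hr.depth_par w hw.1, placementAux, if_neg hw.1, hw.2, h]
    rw [h] at hnd
    have hpre : w ∉ pre := fun hm => (List.nodup_append.1 hnd).2.2 _ hm _ (by simp) rfl
    rw [List.takeWhile_append_of_pos]
    · simp
    · intro a ha
      simp only [ne_eq, decide_not, Bool.not_eq_eq_eq_not, Bool.not_true, decide_eq_false_iff_not]
      rintro rfl
      exact hpre ha

theorem IsPlacement.good {pl : Fin n → Placement} (hr : IsRooting r ord par depth)
    (hsize : ∀ u, size u = 1 + ((childList ord par u).map size).sum) (hroot : size r = n)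
    (hpl : IsPlacement r ord par size (n ^ 3 + 1) pl) (v : Fin n) :
    (pl v).Good (n ^ 3 + 1) (Placement.height n) (size v) := by
  refine hr.induction (P := fun v => (pl v).Good (n ^ 3 + 1) (Placement.height n) (size v))
    ?_ (fun v hv hp => ?_) v
  · rw [hpl.root, hroot]
    exact Placement.root_good (by have := r.isLt; omega)
  · obtain ⟨pre, post, h⟩ := List.append_of_mem (hr.mem_childList.2 ⟨hv, rfl⟩)
    have h1 := hsize (par v)
    have h2 := hsize v
    rw [hpl.child _ _ _ _ h]
    rw [h] at h1
    simp only [List.map_append, List.sum_append, List.map_cons, List.sum_cons] at h1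
    apply Placement.Good.step
    · rwa [Nat.sub_add_cancel (by omega)]
    · omega
    · omega

end TreeDrawing

namespace TreeDrawing

variable {n : ℕ} {r : Fin n} {ord : Fin n → List (Fin n)} {par : Fin n → Fin n}
  {depth : Fin n → ℕ} {size : Fin n → ℕ}

/-! ### Program for the placement of all vertices. -/

/-- Load the size and the placement of the vertex `R[16]`. -/
def loadPlacement : Program := .block
  [.arith .add 31 7 16, .load 20 31, .arith .sub 20 20 3,
   .arith .add 31 8 16, .load 21 31, .arith .add 31 9 16, .load 22 31, .arith .sub 22 22 21,
   .arith .add 31 10 16, .load 23 31, .arith .add 31 11 16, .load 24 31,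
   .arith .add 31 12 16, .load 25 31, .arith .add 31 13 16, .load 26 31, .arith .mul 27 23 4]

/-- Set the offset to `0`. -/
def resetOffset : Program := .block [.const 29 0]

/-- Advance the offset by the size of the vertex `R[30]`. -/
def advanceOffset : Program := .block [.arith .add 31 7 30, .load 31 31, .arith .add 29 29 31]

/-- Place the children of vertex number `R[14]` of the search order. -/
def placeChildren : Program := .block
  [fetch, loadPlacement, resetOffset, scan resetOffset advanceOffset,
   -- A preliminary total equal to `size u - 1` means that no reset occurred or that no child
   -- precedes the parent; the offset then starts from 0. Afterwards the pointer 28 is rewound to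
   -- the start of the list.
   .ifLt 29 20 (.block []) resetOffset, .load 28 16, scan resetOffset placeChild,
   .arith .add 14 14 3]

/-- Place all vertices, in search order. -/
def placeAll : Program := .block
  -- Registers 2, 3 and 4 hold 0, 1 and `N`, so these stores write `Placement.root N` for the root.
  [.arith .add 31 8 1, .store 31 2, .arith .add 31 9 1, .store 31 4,
   .arith .add 31 10 1, .store 31 2, .arith .add 31 11 1, .store 31 3,
   .arith .add 31 12 1, .store 31 2, .arith .add 31 13 1, .store 31 2,
   .const 14 0, .whileLt 14 0 placeChildren]

/-- The memory `M` contains the placement `q` of vertex `v`. -/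
structure Placed (n : ℕ) (q : Placement) (v : ℕ) (M : ℕ → ℕ) : Prop where
  lo : M (6 * n + v) = q.lo
  hi : M (7 * n + v) = q.hi
  j : M (8 * n + v) = q.j
  k : M (9 * n + v) = q.k
  x : M (10 * n + v) = q.x
  y : M (11 * n + v) = q.y

theorem placed_storePlacement {w : ℕ} (hw : w < n) (q : Placement) (M : ℕ → ℕ) :
    Placed n q w (storePlacement n w q M) := by
  unfold storePlacement
  constructor
  all_goals
    repeat rw [Function.update_of_ne (by omega)]
    rw [Function.update_self]

theorem Placed.storePlacement_of_ne {v w : ℕ} {p q : Placement} {M : ℕ → ℕ}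
    (h : Placed n p v M) (hv : v < n) (hw : w < n) (hne : v ≠ w) :
    Placed n p v (storePlacement n w q M) := by
  unfold storePlacement
  constructor
  all_goals repeat rw [Function.update_of_ne (by omega)]
  exacts [h.lo, h.hi, h.j, h.k, h.x, h.y]

theorem storePlacement_of_lt {w a : ℕ} {q : Placement} {M : ℕ → ℕ} (ha : a < 6 * n) :
    storePlacement n w q M a = M a := by
  unfold storePlacement
  repeat rw [Function.update_of_ne (by omega)]

theorem wp_loadPlacement {W τ N B : ℕ} {s : Config} {Q : ℕ → Config → Prop} {u : Fin n} {S : ℕ}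
    {p : Placement} (hc : ConstRegs n N s.reg) (h16 : s.reg 16 = u)
    (hsz : s.mem (5 * n + u) = S + 1) (hp : Placed n p u s.mem) (hS : S < n)
    (hhi : p.hi ≤ N) (hlo : p.lo < p.hi) (hj : p.j ≤ B) (hk : p.k ≤ B) (hx : p.x ≤ B)
    (hy : p.y ≤ B) (hNB : 2 * N ≤ B) (hB : 12 * n ≤ B) (hW : 3 * (B * B) + 3 * B < W)
    (hQ : ∀ s', VertexRegs N S p s'.reg → s'.mem = s.mem →
      (∀ i < 31, i < 20 ∨ 27 < i → s'.reg i = s.reg i) → Q (τ + 18) s') :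
    WP W loadPlacement τ s Q := by
  have hun := u.isLt
  have hjN : p.j * N ≤ B * B := Nat.mul_le_mul hj (by omega)
  unfold loadPlacement
  repeat'
    first
    | (refine wp_arith (by simp only [Config.setReg_reg, Op.eval, Nat.reduceEqDiff, if_true,
         if_false, hc.r3, hc.r4, hc.r7, hc.r8, hc.r9, hc.r10, hc.r11, hc.r12, hc.r13, h16,
         Nat.add_sub_cancel] <;> rfl) ?_ ?_
       · omega)
    | (refine wp_load (by simp only [Config.setReg_reg, Config.setReg_mem, if_true, hsz, hp.lo,
         hp.hi, hp.j, hp.k, hp.x, hp.y] <;> rfl) ?_ ?_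
       · omega)
    | apply wp_block_nil
  apply hQ
  · constructor <;> rfl
  · rfl
  · intro i _ _
    simp only [Config.setReg_reg]
    repeat rw [if_neg (by omega)]

theorem wp_resetOffset {W τ : ℕ} {s : Config} {Q : ℕ → Config → Prop} (hW : 0 < W)
    (hQ : Q (τ + 2) (s.setReg 29 0)) : WP W resetOffset τ s Q :=
  wp_const hW (wp_block_nil hQ)

theorem wp_advanceOffset {W τ N c sz : ℕ} {s : Config} {Q : ℕ → Config → Prop} {w : Fin n}
    (hc : ConstRegs n N s.reg) (h29 : s.reg 29 = c) (h30 : s.reg 30 = w)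
    (hsz : s.mem (5 * n + w) = sz) (hW : 12 * n < W) (hcW : c + sz < W)
    (hQ : ∀ s', (∀ i < 29, s'.reg i = s.reg i) → s'.reg 29 = c + sz → s'.mem = s.mem →
      Q (τ + 4) s') : WP W advanceOffset τ s Q := by
  have hwn := w.isLt
  refine wp_arith (by simp only [Op.eval, hc.r7, h30] <;> rfl) (by omega) ?_
  refine wp_load (by simp only [Config.setReg_reg, Config.setReg_mem, if_true, hsz] <;> rfl)
    (by omega) ?_
  refine wp_arith (by simp only [Config.setReg_reg, Op.eval, Nat.reduceEqDiff, if_true, if_false,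
    h29] <;> rfl) (by omega) (wp_block_nil (hQ _ ?_ ?_ ?_))
  · intro i _
    simp only [Config.setReg_reg]
    repeat rw [if_neg (by omega)]
  all_goals rfl

theorem wp_scan_advanceOffset {W τ N : ℕ} {s : Config} {Q : ℕ → Config → Prop} {u : Fin n}
    (hr : IsRooting r ord par depth)
    (hsize : ∀ u, size u = 1 + ((childList ord par u).map size).sum) (hroot : size r = n)
    (hc : ConstRegs n N s.reg) (hin : InputMem ord s.mem)
    (hmem : ∀ v : Fin n, s.mem (5 * n + v) = size v) (h17 : s.reg 17 = par u)
    (h28 : s.reg 28 = listAddr ord u) (h19 : s.reg 19 = listAddr ord u + (ord u).length)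
    (h29 : s.reg 29 = 0) (hW : 12 * n < W)
    (hQ : ∀ τ' s', τ' ≤ τ + 12 * (ord u).length + 1 → (∀ i < 28, s'.reg i = s.reg i) →
      s'.reg 29 = cursor size (par u) 0 (ord u) → s'.mem = s.mem → Q τ' s') :
    WP W (scan resetOffset advanceOffset) τ s Q := by
  have haddr := listAddr_add_length_le ord u
  have hsum := hr.sum_length
  have hun := u.isLt
  let J : List (Fin n) → Config → Prop := fun done s' =>
    (∀ i < 28, s'.reg i = s.reg i) ∧ s'.reg 29 = cursor size (par u) 0 done ∧ s'.mem = s.mem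
  refine wp_scan (l := ord u) (p := par u) (a₀ := listAddr ord u) (T := 4) J ?_ ?_ ?_ ?_ ?_ h28
    (by omega) (by omega) ?_
  · rintro done s' ⟨hreg, -, hm⟩
    refine ⟨?_, ?_, ?_, ?_, ?_⟩
    · rw [hreg 2 (by omega), hc.r2]
    · rw [hreg 3 (by omega), hc.r3]
    · rw [hreg 17 (by omega), h17]
    · rw [hreg 19 (by omega), h19]
    · intro i hi
      rw [hm, hin.entry]
  · rintro done s' s'' ⟨h1, h2, h3⟩ hm hreg
    refine ⟨fun i hi => ?_, ?_, ?_⟩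
    · rw [hreg i (by omega) (by omega), h1 i hi]
    · rw [hreg 29 (by omega) (by omega), h2]
    · rw [hm, h3]
  · rintro done w rest hsplit hw τ' s' ⟨h1, h2, h3⟩ h30
    have hcur : cursor size (par u) 0 done + size w ≤ n := by
      have := hr.cursor_prefix_le hsize (u := u) (done := done ++ [w]) (rest := rest)
        (by rw [hsplit]; simp)
      rw [cursor_concat, if_neg hw] at this
      exact this.trans (hr.size_le hsize hroot u)
    refine wp_advanceOffset (hc.congr (h1 0 (by omega)) fun i hi _ => h1 i (by omega)) h2 h30
      (by rw [h3, hmem]) hW (by omega) fun s'' hreg h29' hm => ⟨by omega, ⟨?_, ?_, ?_⟩, ?_⟩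
    · intro i hi
      rw [hreg i (by omega), h1 i hi]
    · rw [h29', cursor_concat, if_neg hw]
    · rw [hm, h3]
    · exact hreg 28 (by omega)
  · rintro done w rest hsplit rfl τ' s' ⟨h1, h2, h3⟩
    refine wp_resetOffset (by omega) ⟨by omega, ⟨?_, ?_, ?_⟩, rfl⟩
    · intro i hi
      rw [Config.setReg_reg_of_ne _ (by omega), h1 i hi]
    · rw [cursor_concat, if_pos rfl]
      rfl
    · exact h3
  · exact ⟨fun _ _ => rfl, h29, rfl⟩
  · rintro τ' s' hτ ⟨h1, h2, h3⟩
    exact hQ τ' s' (by omega) h1 h2 h3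

/-- `D` collects vertices placed earlier: the scan has to preserve their placements while it adds
those of the children of `u`. -/
theorem wp_scan_placeChild {W τ B : ℕ} {s : Config} {Q : ℕ → Config → Prop} {u : Fin n}
    {pl : Fin n → Placement} {D : Set (Fin n)} (hr : IsRooting r ord par depth)
    (hsize : ∀ u, size u = 1 + ((childList ord par u).map size).sum) (hroot : size r = n)
    (hpl : IsPlacement r ord par size (n ^ 3 + 1) pl)
    (hc : ConstRegs n (n ^ 3 + 1) s.reg) (hin : InputMem ord s.mem)
    (hmem : ∀ v : Fin n, s.mem (5 * n + v) = size v) (h17 : s.reg 17 = par u)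
    (hv : VertexRegs (n ^ 3 + 1) (size u - 1) (pl u) s.reg)
    (h28 : s.reg 28 = listAddr ord u) (h19 : s.reg 19 = listAddr ord u + (ord u).length)
    (h29 : s.reg 29 = initialOffset ord par size u) (hD : ∀ v ∈ D, Placed n (pl v) v s.mem)
    (hNB : 2 * (n ^ 3 + 1) ≤ B) (hB : 12 * n ≤ B) (hW : 3 * (B * B) + 3 * B < W)
    (hQ : ∀ τ' s', τ' ≤ τ + 48 * (ord u).length + 1 → (∀ i < 28, s'.reg i = s.reg i) →
      (∀ v, v ∈ D ∨ v ∈ childList ord par u → Placed n (pl v) v s'.mem) →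
      (∀ a < 6 * n, s'.mem a = s.mem a) → Q τ' s') :
    WP W (scan resetOffset placeChild) τ s Q := by
  have haddr := listAddr_add_length_le ord u
  have hsum := hr.sum_length
  have hun := u.isLt
  have hgood := hpl.good hr hsize hroot
  have hle := hr.size_le hsize hroot
  let J : List (Fin n) → Config → Prop := fun done s' =>
    (∀ i < 28, s'.reg i = s.reg i) ∧
    s'.reg 29 = cursor size (par u) (initialOffset ord par size u) done ∧
    (∀ v, v ∈ D ∨ (v ∈ done ∧ v ≠ par u) → Placed n (pl v) v s'.mem) ∧
    ∀ a < 6 * n, s'.mem a = s.mem a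
  refine wp_scan (l := ord u) (p := par u) (a₀ := listAddr ord u) (T := 40) J ?_ ?_ ?_ ?_ ?_ h28
    (by omega) (by omega) ?_
  · rintro done s' ⟨hreg, -, -, hm⟩
    refine ⟨?_, ?_, ?_, ?_, ?_⟩
    · rw [hreg 2 (by omega), hc.r2]
    · rw [hreg 3 (by omega), hc.r3]
    · rw [hreg 17 (by omega), h17]
    · rw [hreg 19 (by omega), h19]
    · intro i hi
      rw [hm _ (by omega), hin.entry]
  · rintro done s' s'' ⟨h1, h2, h3, h4⟩ hm hreg
    refine ⟨fun i hi => ?_, ?_, ?_, ?_⟩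
    · rw [hreg i (by omega) (by omega), h1 i hi]
    · rw [hreg 29 (by omega) (by omega), h2]
    all_goals rwa [hm]
  · rintro done w rest hsplit hw τ' s' ⟨h1, h2, h3, h4⟩ h30
    obtain ⟨pre, post, hch, hcur⟩ := hr.cursor_eq hsize hsplit hw
    have hS : (pre.map size).sum + size w ≤ size u - 1 := by
      have := hsize u
      rw [hch] at this
      simp only [List.map_append, List.sum_append, List.map_cons, List.sum_cons] at this
      omega
    have hplw := hpl.child _ _ _ _ hch
    have hgu := hgood u
    have hgw := hgood w
    have hju := hgu.j_lt
    have hku := hgu.k_le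
    have hyu := hgu.y_lt (by omega)
    have hxu := hgu.x_le
    have hjw := hgw.j_lt
    have hkw := hgw.k_le
    have hyw := hgw.y_lt (by omega)
    have hlw := hgw.lo_add
    have hlu := hgu.lo_add
    have hsu := hle u
    rw [hcur] at h2
    have hv' : VertexRegs (n ^ 3 + 1) (size u - 1) (pl u) s'.reg := by
      constructor
      all_goals rw [h1 _ (by omega)]
      exacts [hv.r20, hv.r21, hv.r22, hv.r23, hv.r24, hv.r25, hv.r26, hv.r27]
    refine wp_placeChild (B := B) (w := w) (hc.congr (h1 0 (by omega)) fun i hi _ => h1 i (by omega)) hv' h2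
      h30 ((h4 _ (by omega)).trans (hmem w)) w.isLt hB hNB hS (by omega) hgu.hi_le (by omega)
      (by omega) (by omega) (by omega) (by omega) ?_ ?_ ?_ ?_ hW ?_
    · rw [← hplw]
      omega
    · rw [← hplw]
      exact hgw.hi_le
    · rw [← hplw]
      omega
    · rw [← hplw]
      omega
    · rw [← hplw]
      intro τ'' s'' hτ hreg h29' hm
      refine ⟨hτ, ⟨?_, ?_, ?_, ?_⟩, hreg 28 (by omega)⟩
      · intro i hi
        rw [hreg i (by omega), h1 i hi]
      · rw [h29', cursor_concat, if_neg hw, hcur]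
      · intro v hvd
        rw [hm]
        by_cases hvw : v = w
        · rw [hvw]
          exact placed_storePlacement w.isLt _ _
        · refine (h3 v ?_).storePlacement_of_ne v.isLt w.isLt fun he => hvw (Fin.ext he)
          simpa [hvw] using hvd
      · intro a ha
        rw [hm, storePlacement_of_lt ha, h4 a ha]
  · rintro done w rest hsplit rfl τ' s' ⟨h1, h2, h3, h4⟩
    refine wp_resetOffset (by omega) ⟨by omega, ⟨?_, ?_, ?_, ?_⟩, rfl⟩
    · intro i hi
      rw [Config.setReg_reg_of_ne _ (by omega), h1 i hi]
    · rw [cursor_concat, if_pos rfl]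
      rfl
    · intro v hvd
      refine h3 v (hvd.imp_right fun h => ⟨?_, h.2⟩)
      simpa [h.2] using h.1
    · exact h4
  · exact ⟨fun _ _ => rfl, h29, fun v hvd => hD v (by simpa using hvd), fun _ _ => rfl⟩
  · rintro τ' s' hτ ⟨h1, h2, h3, h4⟩
    exact hQ τ' s' (by omega) h1
      (fun v hvd => h3 v (hvd.imp_right hr.mem_ord_of_mem_childList.2)) h4

theorem wp_placeChildren {W τ B i : ℕ} {s : Config} {Q : ℕ → Config → Prop} {u : Fin n}
    {pl : Fin n → Placement} {D : Set (Fin n)} (hr : IsRooting r ord par depth)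
    (hsize : ∀ u, size u = 1 + ((childList ord par u).map size).sum) (hroot : size r = n)
    (hpl : IsPlacement r ord par size (n ^ 3 + 1) pl)
    (hc : ConstRegs n (n ^ 3 + 1) s.reg) (hin : InputMem ord s.mem)
    (hmem : ∀ v : Fin n, s.mem (5 * n + v) = size v) (h14 : s.reg 14 = i) (hi : i < n)
    (hord : s.mem (4 * n + i) = u) (hpar : s.mem (3 * n + u) = par u)
    (hD : ∀ v ∈ D, Placed n (pl v) v s.mem) (hu : u ∈ D)
    (hNB : 2 * (n ^ 3 + 1) ≤ B) (hB : 12 * n ≤ B) (hW : 3 * (B * B) + 3 * B < W)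
    (hQ : ∀ τ' s', τ' ≤ τ + 40 + 60 * (ord u).length → (∀ i < 14, s'.reg i = s.reg i) →
      s'.reg 14 = i + 1 → (∀ v, v ∈ D ∨ v ∈ childList ord par u → Placed n (pl v) v s'.mem) →
      (∀ a < 6 * n, s'.mem a = s.mem a) → Q τ' s') :
    WP W placeChildren τ s Q := by
  have hgood := hpl.good hr hsize hroot
  have hle := hr.size_le hsize hroot u
  have hgu := hgood u
  have hju := hgu.j_lt
  have hku := hgu.k_le
  have hyu := hgu.y_lt (by omega)
  have hxu := hgu.x_le
  have hlu := hgu.lo_add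
  have hsu := hgu.sz_pos
  have haddr := listAddr_add_length_le ord u
  have hsum := hr.sum_length
  refine wp_block_cons (wp_fetch (par := par) hc h14 hi hord hpar hin hr.sum_length (by omega) ?_)
  intro s₁ hm₁ hreg₁ h16₁ h17₁ h28₁ h19₁
  have hc₁ : ConstRegs n (n ^ 3 + 1) s₁.reg := hc.congr (hreg₁ _ (by omega) (by omega) (by omega)
    (by omega)) fun i hi _ => hreg₁ i (by omega) (by omega) (by omega) (by omega)
  refine wp_block_cons (wp_loadPlacement (B := B) (S := size u - 1) (p := pl u) hc₁ h16₁
    (by rw [hm₁, hmem]; omega) (by rw [hm₁]; exact hD u hu) (by omega) hgu.hi_le (by omega)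
    (by omega) (by omega) (by omega) (by omega) hNB hB hW ?_)
  intro s₂ hv₂ hm₂ hreg₂
  refine wp_block_cons (wp_resetOffset (by omega) (wp_block_cons ?_))
  have hreg₂' : ∀ i < 29, i < 20 ∨ 27 < i → (s₂.setReg 29 0).reg i = s₁.reg i := by
    intro i hi hi'
    rw [Config.setReg_reg_of_ne _ (by omega), hreg₂ i (by omega) hi']
  have hc₂ : ConstRegs n (n ^ 3 + 1) (s₂.setReg 29 0).reg := hc₁.congr
    (hreg₂' 0 (by omega) (by omega)) fun i hi _ => hreg₂' i (by omega) (by omega)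
  refine wp_scan_advanceOffset (u := u) hr hsize hroot hc₂ (by rwa [Config.setReg_mem, hm₂, hm₁])
    (by rwa [Config.setReg_mem, hm₂, hm₁]) ?_ ?_ ?_ rfl (by omega) ?_
  · rw [hreg₂' _ (by omega) (by omega), h17₁]
  · rw [hreg₂' _ (by omega) (by omega), h28₁]
  · rw [hreg₂' _ (by omega) (by omega), h19₁]
  intro τ₃ s₃ hτ₃ hreg₃ h29₃ hm₃
  rw [Config.setReg_mem, hm₂, hm₁] at hm₃
  have hreg₃' : ∀ i < 28, s₃.reg i = s₂.reg i := fun i hi => by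
    rw [hreg₃ i hi, Config.setReg_reg_of_ne _ (by omega)]
  have wrap : ∀ {P : ℕ → Config → Prop}, (∀ τ' s', τ' ≤ τ₃ + 3 → (∀ i < 28, s'.reg i = s₂.reg i) →
      s'.reg 29 = initialOffset ord par size u → s'.mem = s.mem → P τ' s') →
      WP W (.ifLt 29 20 (.block []) resetOffset) τ₃ s₃ P := by
    intro P hP
    have h20 : s₃.reg 20 = size u - 1 := by rw [hreg₃' _ (by omega), hv₂.r20]
    refine wp_ifLt (fun h => wp_block_nil (hP _ _ (by omega) hreg₃' ?_ hm₃))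
      fun h => wp_resetOffset (by omega) (hP _ _ (by omega) (fun i hi => ?_) ?_ hm₃)
    · rw [h29₃, h20] at h
      rw [initialOffset, if_pos h, h29₃]
    · rw [Config.setReg_reg_of_ne _ (by omega), hreg₃' i hi]
    · rw [h29₃, h20] at h
      rw [initialOffset, if_neg h]
      rfl
  refine wp_block_cons (wrap ?_)
  intro τ₄ s₄ hτ₄ hreg₄ h29₄ hm₄
  have hreg₄' : ∀ i < 20, s₄.reg i = s₁.reg i := fun i hi => by
    rw [hreg₄ i (by omega), hreg₂ i (by omega) (by omega)]
  refine wp_load (by rw [hreg₄' 16 (by omega), h16₁, hm₄, hin.start]) (by omega)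
    (wp_block_cons ?_)
  have hreg₅ : ∀ i < 28, (s₄.setReg 28 (listAddr ord u)).reg i = s₂.reg i := fun i hi => by
    rw [Config.setReg_reg_of_ne _ (by omega), hreg₄ i hi]
  have hreg₅' : ∀ i < 20, (s₄.setReg 28 (listAddr ord u)).reg i = s₁.reg i := fun i hi => by
    rw [Config.setReg_reg_of_ne _ (by omega), hreg₄' i hi]
  have hc₅ : ConstRegs n (n ^ 3 + 1) (s₄.setReg 28 (listAddr ord u)).reg := hc₁.congr
    (hreg₅' 0 (by omega)) fun i hi _ => hreg₅' i (by omega)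
  have hv₅ : VertexRegs (n ^ 3 + 1) (size u - 1) (pl u) (s₄.setReg 28 (listAddr ord u)).reg := by
    constructor
    all_goals rw [hreg₅ _ (by omega)]
    exacts [hv₂.r20, hv₂.r21, hv₂.r22, hv₂.r23, hv₂.r24, hv₂.r25, hv₂.r26, hv₂.r27]
  refine wp_scan_placeChild (B := B) (u := u) (D := D) hr hsize hroot hpl hc₅
    (by rwa [Config.setReg_mem, hm₄]) (by rwa [Config.setReg_mem, hm₄])
    (by rw [hreg₅' _ (by omega), h17₁]) hv₅ rfl (by rw [hreg₅' _ (by omega), h19₁])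
    (by rw [Config.setReg_reg_of_ne _ (by omega), h29₄])
    (by rwa [Config.setReg_mem, hm₄]) hNB hB hW ?_
  intro τ₆ s₆ hτ₆ hreg₆ hpl₆ hm₆
  have hreg₆' : ∀ i < 15, s₆.reg i = s.reg i := fun i hi => by
    rw [hreg₆ i (by omega), hreg₅' i (by omega),
      hreg₁ i (by omega) (by omega) (by omega) (by omega)]
  refine wp_arith (x := i + 1) (by rw [hreg₆' 14 (by omega), hreg₆' 3 (by omega), h14, hc.r3]; rfl)
    (by omega) (wp_block_nil (hQ _ _ (by omega) ?_ rfl hpl₆ ?_))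
  · intro j hj
    rw [Config.setReg_reg_of_ne _ (by omega), hreg₆' j (by omega)]
  · intro a ha
    rw [Config.setReg_mem, hm₆ a ha, Config.setReg_mem, hm₄]

theorem wp_placeAll {W τ B : ℕ} {s : Config} {Q : ℕ → Config → Prop} {L : List (Fin n)}
    {pl : Fin n → Placement} (hr : IsRooting r ord par depth)
    (hsize : ∀ u, size u = 1 + ((childList ord par u).map size).sum) (hroot : size r = n)
    (hpl : IsPlacement r ord par size (n ^ 3 + 1) pl)
    (hc : ConstRegs n (n ^ 3 + 1) s.reg) (h1 : s.reg 1 = r) (hin : InputMem ord s.mem)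
    (hmem : ∀ v : Fin n, s.mem (5 * n + v) = size v) (hL : SearchList r par n L)
    (hLmem : SearchMem par L s.mem)
    (hNB : 2 * (n ^ 3 + 1) ≤ B) (hB : 12 * n ≤ B) (hW : 3 * (B * B) + 3 * B < W)
    (hQ : ∀ τ' s', τ' ≤ τ + 170 * n + 20 → (∀ i < 14, s'.reg i = s.reg i) →
      (∀ v, Placed n (pl v) v s'.mem) → Q τ' s') :
    WP W placeAll τ s Q := by
  have hrn := r.isLt
  have hlen : L.length = n := le_antisymm (length_le_of_nodup hL.nodup) hL.le_length
  have hall := hL.forall_mem hr hlen.le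
  unfold placeAll
  repeat'
    first
    | (refine wp_arith (by simp only [Config.setReg_reg, Config.setMem_reg, Op.eval,
         Nat.reduceEqDiff, if_true, if_false, hc.r8, hc.r9, hc.r10, hc.r11, hc.r12, hc.r13,
         h1] <;> rfl) ?_ ?_
       · omega)
    | (refine wp_store (by simp only [Config.setReg_reg, if_true] <;> rfl)
         (by simp only [Config.setReg_reg, Config.setMem_reg,
         Nat.reduceEqDiff, if_true, if_false, hc.r2, hc.r3, hc.r4] <;> rfl) ?_ ?_
       · omega)
    | (refine wp_const ?_ ?_
       · omega)
  apply wp_block_cons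
  generalize hs₁ : Config.setReg _ 14 _ = s₁
  have hreg : ∀ i < 14, s₁.reg i = s.reg i := by
    intro i _
    rw [← hs₁]
    simp only [Config.setReg_reg, Config.setMem_reg]
    repeat rw [if_neg (by omega)]
  have hm₁ : s₁.mem = storePlacement n r (Placement.root (n ^ 3 + 1)) s.mem := by
    rw [← hs₁]
    rfl
  -- After `i` rounds the root and all children of the first `i` vertices are placed. By
  -- `parent_before` this includes the vertex processed next.
  refine wp_whileLt (fun i τ' s' => (∀ i < 14, s'.reg i = s.reg i) ∧ s'.reg 14 = i ∧
    (∀ v, v = r ∨ par v ∈ L.take i → Placed n (pl v) v s'.mem) ∧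
    (∀ a < 6 * n, s'.mem a = s.mem a) ∧
    τ' ≤ τ + 13 + ((L.take i).map fun v => 41 + 60 * (ord v).length).sum) n ?_ ?_ ?_
  · rintro i hi τ₂ s₂ ⟨hreg₂, h14, hD, hm, hτ⟩
    have hiL : i < L.length := by omega
    refine ⟨by rw [h14, hreg₂ 0 (by omega), hc.r0]; exact hi, ?_⟩
    have hun := L[i].isLt
    refine wp_placeChildren (u := L[i]) (i := i) (D := {v | v = r ∨ par v ∈ L.take i}) hr hsize
      hroot hpl (hc.congr (hreg₂ 0 (by omega)) fun i hi _ => hreg₂ i hi)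
      (hin.congr hr.sum_length fun a ha => hm a (by omega))
      (fun v => by rw [hm _ (by omega), hmem]) h14 hi
      (by rw [hm _ (by omega), hLmem.order i hiL])
      (by rw [hm _ (by omega), hLmem.parent _ (hall _)]) hD (hL.parent_before i hiL) hNB hB hW ?_
    intro τ₃ s₃ hτ₃ hreg₃ h14₃ hD₃ hm₃
    refine ⟨?_, h14₃, ?_, ?_, ?_⟩
    · intro j hj
      rw [hreg₃ j hj, hreg₂ j hj]
    · intro v hv
      apply hD₃
      rw [hr.mem_childList]
      rw [List.take_succ_eq_append_getElem hiL, List.mem_append, List.mem_singleton] at hv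
      by_cases hvr : v = r
      · exact Or.inl (Or.inl hvr)
      · simp only [Set.mem_ofPred_eq]
        tauto
    · intro a ha
      rw [hm₃ a ha, hm a ha]
    · rw [List.take_succ_eq_append_getElem hiL, List.map_append, List.sum_append,
        List.map_singleton, List.sum_singleton]
      omega
  · refine ⟨hreg, ?_, ?_, ?_, ?_⟩
    · rw [← hs₁]
      rfl
    · rintro v (rfl | hv)
      · rw [hm₁, hpl.root]
        exact placed_storePlacement v.isLt _ _
      · simp at hv
    · intro a ha
      rw [hm₁, storePlacement_of_lt ha]
    · simp
  · rintro τ₂ s₂ ⟨hreg₂, h14, hD, hm, hτ⟩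
    refine ⟨by rw [h14, hreg₂ 0 (by omega), hc.r0]; omega, ?_⟩
    have htake : L.take n = L := List.take_of_length_le hlen.le
    rw [htake] at hD hτ
    refine wp_block_nil (hQ _ _ ?_ hreg₂ fun v => hD v (Or.inr (hall _)))
    rw [← List.sum_toFinset _ hL.nodup,
      (Finset.eq_univ_iff_forall.2 (by simpa using hall) : L.toFinset = Finset.univ),
      Finset.sum_add_distrib, ← Finset.mul_sum] at hτ
    have := hr.sum_length
    simp only [Finset.sum_const, Finset.card_univ, Fintype.card_fin, smul_eq_mul] at hτ
    omega

end TreeDrawing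

namespace TreeDrawing

variable {n : ℕ} {r : Fin n} {ord : Fin n → List (Fin n)} {par : Fin n → Fin n}
  {depth : Fin n → ℕ} {size : Fin n → ℕ}

/-! ### The whole program, its running time and its word size. -/

/-- The drawing algorithm. -/
def drawTree : Program := .block
  [.const 3 1, .arith .mul 4 0 0, .arith .mul 4 4 0, .arith .add 4 4 3,
   .arith .add 5 0 0, .arith .add 5 5 0, .arith .add 6 5 0, .arith .add 7 6 0,
   .arith .add 8 7 0, .arith .add 9 8 0, .arith .add 10 9 0, .arith .add 11 10 0,
   .arith .add 12 11 0, .arith .add 13 12 0,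
   search, computeSizes, placeAll,
   .arith .add 0 12 2, .arith .add 1 13 2]

theorem drawTree_runs {pl : Fin n → Placement} (hr : IsRooting r ord par depth)
    (hsize : ∀ u, size u = 1 + ((childList ord par u).map size).sum) (hroot : size r = n)
    (hpl : IsPlacement r ord par size (n ^ 3 + 1) pl) :
    ∃ t s, Runs (1000 * n ^ 6) drawTree (inputConfig r ord) t s ∧ t ≤ 1000 * n ∧
      outputDrawing n s = fun v => ⟨(pl v).x, (pl v).y⟩ := by
  have hn : 1 ≤ n := by have := r.isLt; omega
  have h3 : n ≤ n ^ 3 := Nat.le_self_pow (by norm_num) n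
  have h2 : n * n ≤ n ^ 3 := by
    rw [← pow_two]
    exact Nat.pow_le_pow_right hn (by norm_num)
  have h3' : n * n * n = n ^ 3 := by ring
  have h6 : n ^ 3 ≤ n ^ 6 := Nat.pow_le_pow_right hn (by norm_num)
  -- `B = 12 * n ^ 3` dominates both `2 * (n ^ 3 + 1)` and `12 * n`. The required `3 * (B * B) + 3 *
  -- B` is then `432 * n ^ 6 + 36 * n ^ 3`, below the word bound.
  have hBB : 12 * n ^ 3 * (12 * n ^ 3) = 144 * n ^ 6 := by ring
  suffices h : WP (1000 * n ^ 6) drawTree 0 (inputConfig r ord) fun τ s => τ ≤ 1000 * n ∧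
      outputDrawing n s = fun v => ⟨(pl v).x, (pl v).y⟩ by
    obtain ⟨t, s, h1, h2, h3⟩ := h
    exact ⟨t, s, h1, by omega, h3⟩
  have hin := inputMem_inputConfig ord r
  have r0 : (inputConfig r ord).reg 0 = n := rfl
  have r1 : (inputConfig r ord).reg 1 = r := rfl
  have r2 : (inputConfig r ord).reg 2 = 0 := rfl
  unfold drawTree
  refine wp_const (by omega) ?_
  repeat
    (refine wp_arith (by simp only [Config.setReg_reg, Op.eval, Nat.reduceEqDiff, if_true,
         if_false, r0] <;> rfl) ?_ ?_
     · omega)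
  apply wp_block_cons
  generalize hs₁ : Config.setReg _ 13 _ = s₁
  have hc₁ : ConstRegs n (n ^ 3 + 1) s₁.reg := by
    rw [← hs₁]
    constructor <;> simp only [Config.setReg_reg, Nat.reduceEqDiff, if_true, if_false, r0, r2, h3'] <;> omega
  have hm₁ : s₁.mem = (inputConfig r ord).mem := by
    rw [← hs₁]
    rfl
  have h1₁ : s₁.reg 1 = r := by
    rw [← hs₁]
    rfl
  refine wp_search hr hc₁ h1₁ (by rwa [hm₁]) (by omega) ?_
  intro τ₂ s₂ L hτ₂ hL hreg₂ hLm₂ hone hm₂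
  have hc₂ : ConstRegs n (n ^ 3 + 1) s₂.reg := hc₁.congr (hreg₂ 0 (by omega)) fun i hi _ => hreg₂ i hi
  refine wp_block_cons (wp_computeSizes hr hsize hroot hc₂ hL hLm₂ hone (by omega) ?_)
  intro τ₃ s₃ hτ₃ hreg₃ hsz hm₃
  have hc₃ : ConstRegs n (n ^ 3 + 1) s₃.reg := hc₂.congr (hreg₃ 0 (by omega)) fun i hi _ => hreg₃ i hi
  have hlen := length_le_of_nodup hL.nodup
  refine wp_block_cons (wp_placeAll (B := 12 * n ^ 3) hr hsize hroot hpl hc₃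
    (by rw [hreg₃ 1 (by omega), hreg₂ 1 (by omega), h1₁])
    (hin.congr hr.sum_length fun a ha => by rw [hm₃ a (by omega), hm₂ a ha, hm₁]) hsz hL
    ⟨fun i hi => by rw [hm₃ _ (by omega), hLm₂.order i hi],
      fun v hv => by rw [hm₃ _ (by omega), hLm₂.parent v hv]⟩ (by omega) (by omega) (by omega) ?_)
  intro τ₄ s₄ hτ₄ hreg₄ hpl₄
  have hc₄ : ConstRegs n (n ^ 3 + 1) s₄.reg := hc₃.congr (hreg₄ 0 (by omega)) fun i hi _ => hreg₄ i hi
  refine wp_arith (by simp only [Op.eval, hc₄.r12, hc₄.r2] <;> rfl) (by omega) ?_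
  refine wp_arith (by simp only [Config.setReg_reg, Op.eval, Nat.reduceEqDiff, if_false, hc₄.r13,
    hc₄.r2] <;> rfl) (by omega) (wp_block_nil ⟨by omega, ?_⟩)
  funext v
  simp only [outputDrawing, Config.setReg_reg, Config.setReg_mem, Nat.reduceEqDiff, zero_ne_one,
    if_true, if_false, add_zero, (hpl₄ v).x, (hpl₄ v).y]

end TreeDrawing

namespace TreeDrawing

variable {n : ℕ} {r : Fin n} {ord : Fin n → List (Fin n)} {par : Fin n → Fin n}
  {depth : Fin n → ℕ} {size : Fin n → ℕ}

/-! ### The placements form a cone drawing. -/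

theorem Placement.Good.lo_div_le {N : ℕ} {K : ℝ} {sz : ℕ} {p : Placement} (h : p.Good N K sz)
    (hN : 0 < N) : (p.lo : ℝ) / N ≤ p.j / p.k := by
  have := h.k_pos
  rw [div_le_div_iff₀ (by positivity) (by positivity)]
  exact_mod_cast h.lo_mul

theorem Placement.Good.lt_hi_div {N : ℕ} {K : ℝ} {sz : ℕ} {p : Placement} (h : p.Good N K sz)
    (hN : 0 < N) : (p.j : ℝ) / p.k < p.hi / N := by
  have := h.k_pos
  rw [div_lt_div_iff₀ (by positivity) (by positivity)]
  exact_mod_cast h.lt_hi_mul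

/-- Distinct fractions with denominators `k` and `N` differ by at least `1 / (k * N)`, which exceeds
`1 / (m * N)`. -/
theorem Placement.Good.lt_hi_div_sub {N m : ℕ} {K : ℝ} {sz : ℕ} {p : Placement}
    (h : p.Good N K sz) (hN : 0 < N) (hm : p.k < m) :
    (p.j : ℝ) / p.k < p.hi / N - 1 / (m * N) := by
  have hk : (0 : ℝ) < p.k := by exact_mod_cast h.k_pos
  have hN' : (0 : ℝ) < N := by exact_mod_cast hN
  have hm' : (p.k : ℝ) < m := by exact_mod_cast hm
  have h1 : (p.j : ℝ) * N + 1 ≤ p.hi * p.k := by exact_mod_cast h.lt_hi_mul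
  have h2 : (p.hi : ℝ) / N - p.j / p.k = (p.hi * p.k - p.j * N) / (p.k * N) := by
    field_simp
  have h3 : 1 / ((p.k : ℝ) * N) ≤ (p.hi * p.k - p.j * N) / (p.k * N) := by
    gcongr
    linarith
  have h4 : 1 / ((m : ℝ) * N) < 1 / (p.k * N) := by gcongr
  linarith

theorem IsPlacement.getElem {N : ℕ} {pl : Fin n → Placement}
    (hpl : IsPlacement r ord par size N pl) {u : Fin n} {i : ℕ}
    (hi : i < (childList ord par u).length) :
    pl (childList ord par u)[i] = (pl u).step N (((childList ord par u).take i).map size).sum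
      (size (childList ord par u)[i]) (size u - 1) := by
  apply hpl.child u _ _ ((childList ord par u).drop (i + 1))
  rw [← List.drop_eq_getElem_cons hi, List.take_append_drop]

theorem IsPlacement.lo_getElem {N : ℕ} {pl : Fin n → Placement}
    (hpl : IsPlacement r ord par size N pl) {u : Fin n} {i : ℕ}
    (hi : i < (childList ord par u).length) :
    (pl (childList ord par u)[i]).lo = (pl u).lo + ((pl u).hi - (pl u).lo) *
      (((childList ord par u).take i).map size).sum / (size u - 1) := by
  rw [hpl.getElem hi]
  rfl

theorem IsPlacement.hi_getElem {N : ℕ} {pl : Fin n → Placement}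
    (hpl : IsPlacement r ord par size N pl) {u : Fin n} {i : ℕ}
    (hi : i < (childList ord par u).length) :
    (pl (childList ord par u)[i]).hi = (pl u).lo + ((pl u).hi - (pl u).lo) *
      (((childList ord par u).take (i + 1)).map size).sum / (size u - 1) := by
  rw [hpl.getElem hi, List.take_succ_eq_append_getElem hi, List.map_append, List.sum_append,
    List.map_singleton, List.sum_singleton]
  rfl

/-- The integer intervals contain their left endpoints, whereas cones have to be open. Moving all
endpoints down by the same `1 / ((2n + 1) N)` frees the left ends, and the right ends remain above
the parameters because every `k` is at most `2n`. A common shift changes neither nesting nor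
disjointness. -/
theorem IsPlacement.isConeDrawing {pl : Fin n → Placement} (hr : IsRooting r ord par depth)
    (hsize : ∀ u, size u = 1 + ((childList ord par u).map size).sum) (hroot : size r = n)
    (hpl : IsPlacement r ord par size (n ^ 3 + 1) pl) :
    IsConeDrawing r ord par (fun v => ⟨(pl v).x, (pl v).y⟩) (fun v => (pl v).j / (pl v).k)
      (fun v => (pl v).lo / (n ^ 3 + 1 : ℕ) - 1 / ((2 * n + 1 : ℕ) * (n ^ 3 + 1 : ℕ)))
      (fun v => (pl v).hi / (n ^ 3 + 1 : ℕ) - 1 / ((2 * n + 1 : ℕ) * (n ^ 3 + 1 : ℕ))) := by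
  have hn : 1 ≤ n := by have := r.isLt; omega
  have hgood := hpl.good hr hsize hroot
  generalize n ^ 3 + 1 = N at *
  have hN : 0 < N := by
    have h1 := (hgood r).lo_add
    have h2 := (hgood r).hi_le
    omega
  have hN' : (0 : ℝ) < N := by exact_mod_cast hN
  have hε : (0 : ℝ) < 1 / ((2 * n + 1 : ℕ) * N) := by positivity
  generalize hεdef : (1 : ℝ) / ((2 * n + 1 : ℕ) * N) = ε at *
  have hsplit : ∀ v, v ≠ r → ∃ off, off + size v ≤ size (par v) - 1 ∧
      pl v = (pl (par v)).step N off (size v) (size (par v) - 1) := by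
    intro v hv
    obtain ⟨pre, post, h⟩ := List.append_of_mem (hr.mem_childList.2 ⟨hv, rfl⟩)
    refine ⟨_, ?_, hpl.child _ _ _ _ h⟩
    have h1 := hsize (par v)
    rw [h] at h1
    simp only [List.map_append, List.sum_append, List.map_cons, List.sum_cons] at h1
    omega
  have hinterval : ∀ v, v ≠ r → (pl (par v)).lo ≤ (pl v).lo ∧ (pl v).hi ≤ (pl (par v)).hi := by
    intro v hv
    obtain ⟨off, hoff, hs⟩ := hsplit v hv
    have hlo := (hgood (par v)).lo_add
    have hsz := (hgood (par v)).sz_pos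
    have := Placement.step_interval (N := N) (p := pl (par v)) (off := off) (sz := size v)
      (S := size (par v) - 1) (by rwa [Nat.sub_add_cancel hsz]) (hgood v).sz_pos hoff
    rw [← hs] at this
    exact ⟨this.1, this.2.2.1⟩
  have hinherit : ∀ v, v ≠ r → (pl v).lo * (pl (par v)).k ≤ (pl (par v)).j * N →
      (pl (par v)).j * N < (pl v).hi * (pl (par v)).k →
      ((pl v).j : ℝ) / (pl v).k = (pl (par v)).j / (pl (par v)).k := by
    intro v hv h1 h2
    obtain ⟨off, hoff, hs⟩ := hsplit v hv
    have hlo := (hgood v).lo_add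
    have := (Placement.step_vector (p := pl (par v)) (off := off) (sz := size v)
      (S := size (par v) - 1) hN (by rw [← hs]; omega)).2.2.2
    rw [← hs] at this
    rw [(this h1 h2).1, (this h1 h2).2]
  refine ⟨fun v hv => ?_, fun v => ?_, fun v => ?_, fun v hv => ?_, fun v hv => ?_, fun u => ?_,
    fun u hu hpos => ?_, fun u hu hpos => ?_⟩
  · have hk : (0 : ℝ) < (pl v).k := by exact_mod_cast (hgood v).k_pos
    refine ⟨(pl v).k, hk, ?_⟩
    obtain ⟨off, hoff, hs⟩ := hsplit v hv
    have hx : (pl v).x + (pl v).j = (pl (par v)).x + (pl v).k := by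
      have h1 : (pl v).x = (pl (par v)).x + (pl v).k - (pl v).j := by
        conv_lhs => rw [hs]
        conv_rhs => rw [hs]
        rfl
      have := (hgood v).j_lt
      omega
    have hy : (pl v).y = (pl (par v)).y + (pl v).k := by
      conv_lhs => rw [hs]
      conv_rhs => rw [hs]
      rfl
    have hx' : ((pl v).x : ℝ) + (pl v).j = (pl (par v)).x + (pl v).k := by exact_mod_cast hx
    apply Complex.ext
    · simp only [Complex.sub_re, Complex.mul_re, Complex.ofReal_re, Complex.ofReal_im, zero_mul,
        sub_zero]
      field_simp
      linarith
    · simp [hy]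
  · have := (hgood v).lo_div_le hN
    linarith
  · have h1 := (hgood v).k_le
    have h2 := (hgood v).y_lt hn
    have := (hgood v).lt_hi_div_sub hN (show (pl v).k < 2 * n + 1 by omega)
    rwa [hεdef] at this
  · have : ((pl (par v)).lo : ℝ) ≤ (pl v).lo := by exact_mod_cast (hinterval v hv).1
    gcongr
  · have : ((pl v).hi : ℝ) ≤ (pl (par v)).hi := by exact_mod_cast (hinterval v hv).2
    gcongr
  · rw [List.pairwise_iff_getElem]
    intro i j hi hj hij
    have : (pl (childList ord par u)[i]).hi ≤ (pl (childList ord par u)[j]).lo := by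
      rw [hpl.hi_getElem hi, hpl.lo_getElem hj]
      gcongr
      exact ((List.take_sublist_take_left (by omega)).map size).sum_le_sum (by simp)
    have : ((pl (childList ord par u)[i]).hi : ℝ) ≤ (pl (childList ord par u)[j]).lo := by
      exact_mod_cast this
    gcongr
  -- The first child shares the left end of the interval of `u`. So either its interval contains the
  -- parameter of `u`, which is then inherited, or it lies entirely below that parameter.
  · have hlo := hpl.lo_getElem hpos
    obtain ⟨hw, hp⟩ := hr.mem_childList.1 (List.getElem_mem hpos)
    generalize (childList ord par u)[0] = w at *
    simp only [List.take_zero, List.map_nil, List.sum_nil, mul_zero, Nat.zero_div,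
      add_zero] at hlo
    by_cases hlt : (pl u).j * N < (pl w).hi * (pl u).k
    · have := hinherit w hw (by rw [hp, hlo]; exact (hgood u).lo_mul) (by rwa [hp])
      rw [this, hp]
    · refine ((hgood w).lt_hi_div hN).le.trans ?_
      have hk : (0 : ℝ) < (pl u).k := by exact_mod_cast (hgood u).k_pos
      rw [div_le_div_iff₀ hN' hk]
      exact_mod_cast not_lt.1 hlt
  -- Symmetrically, the last child shares the right end: the sizes of all children add up to `size u
  -- - 1`, so the division is exact.
  · have hlast : (childList ord par u).length - 1 < (childList ord par u).length := by omega
    have hhi := hpl.hi_getElem hlast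
    obtain ⟨hw, hp⟩ := hr.mem_childList.1 (List.getElem_mem hlast)
    have hS : ((childList ord par u).map size).sum = size u - 1 := by
      have := hsize u
      omega
    have hS0 : 0 < size u - 1 := by
      have h1 := List.single_le_sum (fun x _ => Nat.zero_le x) _
        (List.mem_map_of_mem (f := size) (List.getElem_mem hlast))
      have h2 := hsize (childList ord par u)[(childList ord par u).length - 1]
      omega
    rw [Nat.sub_add_cancel hpos, List.take_length, hS, Nat.mul_div_cancel _ hS0] at hhi
    generalize (childList ord par u)[(childList ord par u).length - 1] = w at *
    have hhi' : (pl w).hi = (pl u).hi := by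
      have := (hgood u).lo_add
      omega
    by_cases hle : (pl w).lo * (pl u).k ≤ (pl u).j * N
    · have := hinherit w hw (by rwa [hp]) (by rw [hp, hhi']; exact (hgood u).lt_hi_mul)
      rw [this, hp]
    · refine le_trans ?_ ((hgood w).lo_div_le hN)
      have hk : (0 : ℝ) < (pl u).k := by exact_mod_cast (hgood u).k_pos
      rw [div_le_div_iff₀ hk hN']
      exact_mod_cast (not_le.1 hle).le

end TreeDrawing
-- The theorem.
theorem theorem2 :
    ∃ (P : TreeDrawing.Program) (c k : ℕ),
      ∀ (n : ℕ) (G : SimpleGraph (Fin n)) (r : Fin n) (ord : Fin n → List (Fin n)),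
        G.IsTree → TreeDrawing.IsEdgeOrder G ord →
        ∃ (t : ℕ) (s : TreeDrawing.Config),
          TreeDrawing.Runs (c * n ^ k) P (TreeDrawing.inputConfig r ord) t s ∧
          t ≤ c * n ∧
          TreeDrawing.IsMonotoneDrawing G (TreeDrawing.outputDrawing n s) ∧
          TreeDrawing.outputDrawing n s r = 0 ∧
          TreeDrawing.IsNonStrictlySlopeDisjoint G r (TreeDrawing.outputDrawing n s) ∧
          TreeDrawing.IsNearConvexMonotone G r ord (TreeDrawing.outputDrawing n s) ∧
          TreeDrawing.drawnSet G (TreeDrawing.outputDrawing n s) ⊆ TreeDrawing.secondOctant ∧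
          TreeDrawing.FitsInGrid (TreeDrawing.outputDrawing n s) (2 * n) := by
  refine ⟨TreeDrawing.drawTree, 1000, 6, fun n G r ord hG hord => ?_⟩
  obtain ⟨par, hr, hch⟩ := TreeDrawing.exists_isRooting hG r hord
  obtain ⟨size, hsize, hroot⟩ := hr.exists_size
  obtain ⟨pl, hpl⟩ := hr.exists_isPlacement size (n ^ 3 + 1)
  obtain ⟨t, s, hruns, ht, hout⟩ := TreeDrawing.drawTree_runs hr hsize hroot hpl
  have hcone := hpl.isConeDrawing hr hsize hroot
  have hgood := hpl.good hr hsize hroot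
  have hn : 1 ≤ n := by have := r.isLt; omega
  refine ⟨t, s, hruns, ht, ?_⟩
  rw [hout]
  refine ⟨hcone.isMonotoneDrawing hr hch, ?_, hcone.isNonStrictlySlopeDisjoint hr hch,
    hcone.isNearConvexMonotone hr hch,
    TreeDrawing.drawnSet_subset_secondOctant fun v => ⟨?_, ?_⟩, fun v => ?_⟩
  · simp only [hpl.root, TreeDrawing.Placement.root, Nat.cast_zero]
    rfl
  · exact Nat.cast_nonneg _
  · exact Nat.cast_le.2 (hgood v).x_le
  · have h1 := (hgood v).x_le
    have h2 := (hgood v).y_lt hn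
    exact ⟨(pl v).x, (pl v).y, by omega, h2, rfl⟩
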